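/- **Setting.** Let $\Gamma=\mathbb Z\gamma_e\oplus\mathbb Z\gamma_m$ with the antisymmetric pairing $\langle\gamma_m,\gamma_e\rangle=1$, let $U\subset\mathbb C$ be open (a coordinate patch of the base over which the charge lattice is trivialized), and let $Z(u):\Gamma\to\mathbb C$ be homomorphisms depending holomorphically on $u\in U$; write $a=Z_{\gamma_e}(u)$. A twisted unitary character is a map $\theta:\Gamma\to\mathbb R/2\pi\mathbb Z$ with $\theta_\gamma+\theta_{\gamma'}=\theta_{\gamma+\gamma'}+\pi\langle\gamma,\gamma'\rangle$. Put $\ell_\gamma=Z_\gamma\mathbb R_{-}$. For $R>0$ put $$\mathcal X^{\mathrm{sf}}_\gamma(\zeta)=\exp\!\Big(\frac{\pi R Z_\gamma}{\zeta}+i\theta_\gamma+\pi R\zeta\,\overline{Z_\gamma}\Big).$$ For a finitely supported $\Omega:\Gamma\to\mathbb Z$ let $\mathcal X=\mathcal X^{\Omega}$ be the limit, as $\nu\to\infty$, of the iterates $\mathcal X^{(0)}=\mathcal X^{\mathrm{sf}}$, $$\mathcal X^{(\nu+1)}_\gamma(\zeta)=\mathcal X^{\mathrm{sf}}_\gamma(\zeta)\exp\Big[-\frac1{4\pi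 i}\sum_{\gamma'}\Omega(\gamma')\langle\gamma,\gamma'\rangle\int_{\ell_{\gamma'}}\frac{d\zeta'}{\zeta'}\,\frac{\zeta'+\zeta}{\zeta'-\zeta}\,\log\big(1-\mathcal X^{(\nu)}_{\gamma'}(\zeta')\big)\Big].$$ **Walls.** The wall of type I is the set of $u\in U$ with $Z_{\gamma_e}(u),Z_{\gamma_m}(u)\neq0$ and $Z_{\gamma_e}(u)/Z_{\gamma_m}(u)\in\mathbb R_{+}$ (the ray $\ell_e$ meets $\ell_m$); the bound-state charge is then $\gamma_b=\gamma_e+\gamma_m$. The wall of type II is defined likewise by $Z_{\gamma_e}(u)/Z_{\gamma_m}(u)\in\mathbb R_{-}$ ($\ell_e$ meets $\ell_{-m}$), with $\gamma_b=\gamma_e-\gamma_m$. The two sides are $\mathcal B_{\mathrm{in}}=\{u\in U:\operatorname{Im}(Z_{\gamma_e}\overline{Z_{\gamma_m}})>0\}$ and $\mathcal B_{\mathrm{out}}=\{u\in U:\operatorname{Im}(Z_{\gamma_e}\overline{Z_{\gamma_m}})<0\}$. Let $\Omega_{\mathrm{in}}=1$ on $\pm\gamma_e,\pm\gamma_m$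 and $0$ elsewhere; let $\Omega_{\mathrm{out}}=1$ on $\pm\gamma_e,\pm\gamma_m,\pm\gamma_b$ and $0$ elsewhere. **Gauge functions.** With $\mathcal X=\mathcal X^{\Omega_{\mathrm{in}}}$ for $\psi_{\mathrm{in}}$, with $\mathcal X=\mathcal X^{\Omega_{\mathrm{out}}}$ for $\psi_{\mathrm{out}}$, and with $\varphi=\arg Z_{\gamma_b}(u)$, $$\psi_{\mathrm{in}}(u,\theta)=\frac1{2\pi}\int_0^1\frac{dt}{t}\log\left|\frac{1-\mathcal X_{\gamma_e}(-te^{i\arg a})}{1-\mathcal X_{-\gamma_e}(te^{i\arg a})}\right|,$$ $$\psi_{\mathrm{out}}(u,\theta)=\frac1{2\pi}\int_0^1\frac{dt}{t}\left\{\log\left|\frac{1-\mathcal X_{\gamma_e}(-te^{i\arg a})}{1-\mathcal X_{-\gamma_e}(te^{i\arg a})}\right|+\log\left|\frac{1-\mathcal X_{\gamma_b}(-te^{i\varphi})}{1-\mathcal X_{-\gamma_b}(te^{i\varphi})}\right|\right\}.$$ **Lemma.** For every $\delta>0$ there is $R_0>0$ such that for all $R\ge R_0$, for both types of wall, for all $U$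 and $Z$ as above, and for every point $u_0$ of the wall with $|Z_{\gamma_e}(u_0)|,|Z_{\gamma_m}(u_0)|\ge\delta$, the following hold. 1. For all $u$ in $\mathcal B_{\mathrm{in}}$ (respectively $\mathcal B_{\mathrm{out}}$) close enough to $u_0$ and all $\theta$: the iterates with $\Omega=\Omega_{\mathrm{in}}$ (respectively $\Omega_{\mathrm{out}}$) converge at each $\zeta\in\mathbb C^\times$ that lies on no ray $\ell_{\gamma'}$ with $\Omega(\gamma')\neq0$ and $\langle\gamma,\gamma'\rangle\ne0$; the limit $\mathcal X$ satisfies $|\mathcal X_{\gamma'}|<1$ on $\ell_{\gamma'}$ whenever $\Omega(\gamma')\ne0$ and solves the integral equation $$\mathcal X_\gamma(\zeta)=\mathcal X^{\mathrm{sf}}_\gamma(\zeta)\exp\Big[-\frac1{4\pi i}\sum_{\gamma'}\Omega(\gamma')\langle\gamma,\gamma'\rangle\int_{\ell_{\gamma'}}\frac{d\zeta'}{\zeta'}\frac{\zeta'+\zeta}{\zeta'-\zeta}\log\big(1-\mathcal X_{\gamma'}(\zeta')\big)\Big]$$ at those $\zeta$, with convergent integrals; and the integrals that define $\psi_{\mathrm{in}}(u,\theta)$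 (respectively $\psi_{\mathrm{out}}(u,\theta)$) converge. 2. For every $\theta$, the functions $\psi_{\mathrm{in}}$ and $\psi_{\mathrm{out}}$ coincide at the wall: there is a real number $l$ with $$\lim_{u\to u_0,\ u\in\mathcal B_{\mathrm{in}}}\psi_{\mathrm{in}}(u,\theta)=l=\lim_{u\to u_0,\ u\in\mathcal B_{\mathrm{out}}}\psi_{\mathrm{out}}(u,\theta).$$ -/

import Mathlib

open Filter Topology MeasureTheory

namespace Pentagon

/-- The charge lattice over a simply connected patch of the base, in the basis `γ_e, γ_m`:
the pair `(p, q)` is the charge `p γ_e + q γ_m`. -/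
abbrev Charge : Type := ℤ × ℤ

/-- The electric charge `γ_e`. -/
def γe : Charge := (1, 0)

/-- The magnetic charge `γ_m`. -/
def γm : Charge := (0, 1)

/-- The antisymmetric pairing on charges, normalised by `⟨γ_m, γ_e⟩ = 1`. -/
def pairing (γ γ' : Charge) : ℤ := γ.2 * γ'.1 - γ.1 * γ'.2

/-- Twisted unitary characters of the charge lattice, the points of a torus fibre:
maps to `ℝ / 2πℤ` with `θ_γ + θ_γ' = θ_{γ + γ'} + π ⟨γ, γ'⟩`. -/
structure TwistedCharacter where
  toFun : Charge → Real.Angle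
  twist : ∀ γ γ' : Charge,
    toFun γ + toFun γ' = toFun (γ + γ') + ((Real.pi * (pairing γ γ' : ℝ) : ℝ) : Real.Angle)

/-- The BPS ray `ℓ_γ = Z_γ ℝ_-` in the `ζ`-plane, for the value `Z` of the central charge at a
point of the base. -/
def bpsRay (Z : Charge →+ ℂ) (γ : Charge) : Set ℂ :=
  {ζ | ∃ t : ℝ, 0 < t ∧ ζ = -(t : ℂ) * Z γ}

/-- The integral of `f(ζ') dζ' / ζ'` along `ℓ_γ`, from `0` to `∞`, in the parametrisation
`ζ' = -t Z_γ`. -/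
noncomputable def rayIntegral (Z : Charge →+ ℂ) (γ : Charge) (f : ℂ → ℂ) : ℂ :=
  ∫ t in Set.Ioi (0 : ℝ), (t : ℂ)⁻¹ * f (-(t : ℂ) * Z γ)

/-- Convergence of the integral of `f(ζ') dζ' / ζ'` along `ℓ_γ`. -/
def RayIntegrable (Z : Charge →+ ℂ) (γ : Charge) (f : ℂ → ℂ) : Prop :=
  IntegrableOn (fun t : ℝ => (t : ℂ)⁻¹ * f (-(t : ℂ) * Z γ)) (Set.Ioi 0) volume

/-- The semiflat coordinate
`X^sf_γ(ζ) = exp(π R Z_γ / ζ + i θ_γ + π R ζ conj Z_γ)`. -/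
noncomputable def semiflat (R : ℝ) (Z : Charge →+ ℂ) (θ : TwistedCharacter)
    (γ : Charge) (ζ : ℂ) : ℂ :=
  Complex.exp ((Real.pi * R : ℝ) * Z γ / ζ) * ((θ.toFun γ).toCircle : ℂ) *
    Complex.exp ((Real.pi * R : ℝ) * ζ * (starRingEnd ℂ) (Z γ))

/-- The function `(ζ' + ζ) / (ζ' - ζ) * log (1 - X_γ'(ζ'))` of `ζ'`. -/
noncomputable def kernelLog (X : Charge → ℂ → ℂ) (γ' : Charge) (ζ ζ' : ℂ) : ℂ :=
  (ζ' + ζ) / (ζ' - ζ) * Complex.log (1 - X γ' ζ')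

/-- The right-hand side of the integral equation for the Riemann-Hilbert problem whose jump
along each BPS ray `ℓ` is the inverse of the product of the `K_γ ^ Ω(γ)` with `ℓ_γ = ℓ`:
`X^sf_γ(ζ) exp(-(1/4πi) ∑_γ' Ω(γ') ⟨γ,γ'⟩ ∫_{ℓ_γ'} dζ'/ζ' (ζ'+ζ)/(ζ'-ζ) log(1 - X_γ'(ζ')))`. -/
noncomputable def iterStep (R : ℝ) (Z : Charge →+ ℂ) (Ω : Charge → ℤ) (θ : TwistedCharacter)
    (X : Charge → ℂ → ℂ) (γ : Charge) (ζ : ℂ) : ℂ :=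
  semiflat R Z θ γ ζ *
    Complex.exp (-(1 / (4 * Real.pi * Complex.I)) *
      ∑ᶠ γ' : Charge, (Ω γ' : ℂ) * (pairing γ γ' : ℂ) * rayIntegral Z γ' (kernelLog X γ' ζ))

/-- The iterates `X^(ν)`, with `X^(0) = X^sf`. -/
noncomputable def iterate (R : ℝ) (Z : Charge →+ ℂ) (Ω : Charge → ℤ) (θ : TwistedCharacter) :
    ℕ → Charge → ℂ → ℂ
  | 0 => semiflat R Z θ
  | ν + 1 => iterStep R Z Ω θ (iterate R Z Ω θ ν)

/-- The corrected Darboux coordinates `X_γ(ζ)`, the limit of the iterates. -/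
noncomputable def darboux (R : ℝ) (Z : Charge →+ ℂ) (Ω : Charge → ℤ) (θ : TwistedCharacter)
    (γ : Charge) (ζ : ℂ) : ℂ :=
  limUnder atTop (fun ν : ℕ => iterate R Z Ω θ ν γ ζ)

/-- `ζ` is nonzero and lies on none of the rays where `X_γ` jumps. -/
def OffJumps (Z : Charge →+ ℂ) (Ω : Charge → ℤ) (γ : Charge) (ζ : ℂ) : Prop :=
  ζ ≠ 0 ∧ ∀ γ' : Charge, Ω γ' ≠ 0 → pairing γ γ' ≠ 0 → ζ ∉ bpsRay Z γ'

/-- `X` solves the integral equation: all its integrals converge, the functions `X_γ'` in the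
logarithms have modulus less than one on their own rays, and the equation holds wherever `X_γ`
does not jump. -/
structure IsSolution (R : ℝ) (Z : Charge →+ ℂ) (Ω : Charge → ℤ) (θ : TwistedCharacter)
    (X : Charge → ℂ → ℂ) : Prop where
  integrable : ∀ γ' : Charge, Ω γ' ≠ 0 → ∀ ζ : ℂ, ζ ≠ 0 → ζ ∉ bpsRay Z γ' →
    RayIntegrable Z γ' (kernelLog X γ' ζ)
  norm_lt_one : ∀ γ' : Charge, Ω γ' ≠ 0 → ∀ ζ ∈ bpsRay Z γ', ‖X γ' ζ‖ < 1
  equation : ∀ (γ : Charge) (ζ : ℂ), OffJumps Z Ω γ ζ → X γ ζ = iterStep R Z Ω θ X γ ζ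

/-- The iterates converge, and their limit solves the integral equation. -/
def DarbouxExists (R : ℝ) (Z : Charge →+ ℂ) (Ω : Charge → ℤ) (θ : TwistedCharacter) : Prop :=
  (∀ (γ : Charge) (ζ : ℂ), OffJumps Z Ω γ ζ →
    Tendsto (fun ν : ℕ => iterate R Z Ω θ ν γ ζ) atTop (𝓝 (darboux R Z Ω θ γ ζ))) ∧
  IsSolution R Z Ω θ (darboux R Z Ω θ)

/-- The two types of wall-crossing. -/
inductive WallType
  | typeI
  | typeII

/-- The charge whose ray collides with `ℓ_e` at the wall: `γ_m` for type I, `-γ_m` for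
type II. -/
def WallType.partner : WallType → Charge
  | .typeI => γm
  | .typeII => -γm

/-- The charge of the bound state which exists on the outer side of the wall only:
`γ_e + γ_m` for type I, `γ_e - γ_m` for type II. -/
def WallType.bound (τ : WallType) : Charge := γe + τ.partner

/-- The BPS invariants on the inner side: `1` on `±γ_e, ±γ_m`, else `0`. -/
def ΩIn (γ : Charge) : ℤ :=
  if γ = γe ∨ γ = -γe ∨ γ = γm ∨ γ = -γm then 1 else 0

/-- The BPS invariants on the outer side: `1` on `±γ_e, ±γ_m` and on plus or minus the bound
state, else `0`. -/
def ΩOut (τ : WallType) (γ : Charge) : ℤ :=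
  if γ = γe ∨ γ = -γe ∨ γ = γm ∨ γ = -γm ∨ γ = τ.bound ∨ γ = -τ.bound then 1 else 0

/-- The wall of the given type in the patch `U`: `Z_e` and `Z_{±m}` are nonzero and have the
same phase. -/
def wall (U : Set ℂ) (Z : ℂ → Charge →+ ℂ) (τ : WallType) : Set ℂ :=
  {u ∈ U | Z u γe ≠ 0 ∧ Z u γm ≠ 0 ∧ ∃ r : ℝ, 0 < r ∧ Z u γe = (r : ℂ) * Z u τ.partner}

/-- The inner side of the wall in the patch `U`: `ℓ_e` is reached from `ℓ_m` by a
counterclockwise rotation through an angle in `(0, π)`. -/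
def regionIn (U : Set ℂ) (Z : ℂ → Charge →+ ℂ) : Set ℂ :=
  {u ∈ U | 0 < (Z u γe * (starRingEnd ℂ) (Z u γm)).im}

/-- The outer side of the wall in the patch `U`. -/
def regionOut (U : Set ℂ) (Z : ℂ → Charge →+ ℂ) : Set ℂ :=
  {u ∈ U | (Z u γe * (starRingEnd ℂ) (Z u γm)).im < 0}

/-- With `φ = arg Z_γ`, the function
`(1/t) log |(1 - X_γ(-t e^{iφ})) / (1 - X_{-γ}(t e^{iφ}))|` of `t`. -/
noncomputable def gaugeIntegrand (Z : Charge →+ ℂ) (X : Charge → ℂ → ℂ) (γ : Charge)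
    (t : ℝ) : ℝ :=
  t⁻¹ * Real.log
    ‖(1 - X γ (-(t : ℂ) * Complex.exp (Complex.I * (Z γ).arg))) /
      (1 - X (-γ) ((t : ℂ) * Complex.exp (Complex.I * (Z γ).arg)))‖

/-- The gauge function `ψ_in`. -/
noncomputable def ψIn (R : ℝ) (Z : Charge →+ ℂ) (θ : TwistedCharacter) : ℝ :=
  1 / (2 * Real.pi) * ∫ t in (0 : ℝ)..1, gaugeIntegrand Z (darboux R Z ΩIn θ) γe t

/-- The gauge function `ψ_out`, with an extra term for the bound state. -/
noncomputable def ψOut (τ : WallType) (R : ℝ) (Z : Charge →+ ℂ) (θ : TwistedCharacter) : ℝ :=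
  1 / (2 * Real.pi) * ∫ t in (0 : ℝ)..1,
    (gaugeIntegrand Z (darboux R Z (ΩOut τ) θ) γe t +
      gaugeIntegrand Z (darboux R Z (ΩOut τ) θ) τ.bound t)

end Pentagon

open Filter Topology MeasureTheory

namespace Pentagon

/-! At the wall the rays of `γ_e` and `±γ_m` collide and the kernel `(ζ' + ζ) / (ζ' - ζ)` becomes
singular at the points where the coordinates are needed. The remedy is to rotate the contours before
taking the limit. In the equation of `γ`, the integral over `ℓ_γ'` may be moved to another direction
as long as the sector swept out avoids `ℓ_γ` and the iterates are holomorphic and small there. The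
new contours keep a fixed angle from the sectors where the coordinates are evaluated, so for large
`R` the integral operator contracts with constants that do not see the wall (`Admissible`). On their
own rays the Darboux coordinates agree with the solution along the rotated contours
(`Rotates.iter_eq`, `Rotates.darboux_eq_limit`). That solution exists at the wall too and depends
continuously on the central charge (`ConvergesTo.tendsto_limit`).

On the outer side the bound-state ray lies between those of `γ_e` and `γ_m`, so its contour is moved
to one side in the equation of `γ_e` and to the other in that of `γ_m`.

At one and the same central charge near the wall, the two contour problems are related
algebraically. If `x`, `y` are the inner solutions for `γ_e`, `γ_m`, the outer ones are `x / (1 -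
y)`, `y / (1 - x)` and `-x y / (1 - x - y)` (`crossed`). To see this, these functions are inserted
in the outer equations: products such as `(1 - x / (1 - y)) (1 + x y / (1 - x - y)) = 1 - x` merge
the logarithms, and moving an inner contour to its outer position across the evaluation point yields
a residue (`SectorDamped.cauchyTransform_sub`), which supplies the denominators. Uniqueness of the
fixed point finishes the comparison (`NearWall.solutionOut_eq_crossed`).

At the wall all rays lie on one line, and the same product identity says that the inner logarithm
for `γ_e` is the sum of the outer ones for `γ_e` and the bound state. Dominated convergence then
gives equal limits of the gauge functions. Type II reduces to type I by a rotation of the charge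
lattice, which makes `γ_e` play the part of `γ_m`; for this reason type I is proved for gauge
functions built from either charge. -/

/-! ### The damping function and its integral against `dt / t`. -/

/-- The common bound `exp (-c (t + 1/t))` of the coordinates along the integration contours. -/
noncomputable def damping (c t : ℝ) : ℝ := Real.exp (-c * (t + t⁻¹))

theorem damping_pos (c t : ℝ) : 0 < damping c t := Real.exp_pos _

theorem continuousOn_damping (c : ℝ) : ContinuousOn (damping c) (Set.Ioi 0) := by
  unfold damping
  have : ContinuousOn (fun t : ℝ => t⁻¹) (Set.Ioi 0) :=
    continuousOn_id.inv₀ fun _ ht => (Set.mem_Ioi.1 ht).ne'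
  fun_prop

/-- Since `t + 1/t ≥ 2`, the value is at most `exp (-4)`. The constant 1/48 leaves room for the
multiples used later: `8/48 < 1/2` keeps `log (1 - X)` tame, `3/48 < 1/8` keeps the pentagon
denominators away from zero. -/
theorem damping_le {c t : ℝ} (hc : 2 ≤ c) (ht : 0 < t) : damping c t ≤ 1 / 48 := by
  have h1 : 2 ≤ t + t⁻¹ := by
    have : t + t⁻¹ - 2 = (t - 1) ^ 2 * t⁻¹ := by field_simp; ring
    have h2 : 0 ≤ (t - 1) ^ 2 * t⁻¹ := by positivity
    linarith
  have h4 : damping c t ≤ Real.exp (-4) := Real.exp_le_exp.2 (by nlinarith)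
  have h5 : Real.exp (-4) = (Real.exp 1 ^ 4)⁻¹ := by
    rw [Real.exp_neg, ← Real.exp_nat_mul]; norm_num
  have h6 : (2.7 : ℝ) ^ 4 ≤ Real.exp 1 ^ 4 := by
    have := Real.exp_one_gt_d9
    gcongr; linarith
  rw [h5] at h4
  refine h4.trans ?_
  rw [inv_eq_one_div]
  apply one_div_le_one_div_of_le <;> norm_num
  norm_num at h6
  linarith

/-- The factor `exp (-c/t)` absorbs the singularity `1/t`, by `s ≤ exp s` at `s = c/t`; this also
produces the gain `1/c`. -/
theorem inv_mul_damping_le {c : ℝ} (hc : 0 < c) (t : ℝ) :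
    t⁻¹ * damping c t ≤ c⁻¹ * Real.exp (-c * t) := by
  unfold damping
  have h1 : c * t⁻¹ ≤ Real.exp (c * t⁻¹) := by linarith [Real.add_one_le_exp (c * t⁻¹)]
  have h2 : Real.exp (-c * (t + t⁻¹)) = Real.exp (-c * t) * (Real.exp (c * t⁻¹))⁻¹ := by
    rw [← Real.exp_neg, ← Real.exp_add]; ring_nf
  rw [h2]
  have h3 : t⁻¹ * (Real.exp (c * t⁻¹))⁻¹ ≤ c⁻¹ := by
    rw [← div_eq_mul_inv, div_le_iff₀ (Real.exp_pos _), ← div_eq_inv_mul, le_div_iff₀ hc]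
    linarith
  calc t⁻¹ * (Real.exp (-c * t) * (Real.exp (c * t⁻¹))⁻¹)
      = t⁻¹ * (Real.exp (c * t⁻¹))⁻¹ * Real.exp (-c * t) := by ring
    _ ≤ _ := by gcongr

theorem integrableOn_inv_mul_damping {c : ℝ} (hc : 0 < c) :
    IntegrableOn (fun t => t⁻¹ * damping c t) (Set.Ioi 0) := by
  have hm : ContinuousOn (fun t => t⁻¹ * damping c t) (Set.Ioi 0) :=
    (continuousOn_id.inv₀ fun _ ht => (Set.mem_Ioi.1 ht).ne').mul (continuousOn_damping c)
  refine Integrable.mono' ((exp_neg_integrableOn_Ioi 0 hc).const_mul c⁻¹)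
    (hm.aestronglyMeasurable measurableSet_Ioi) ?_
  filter_upwards [ae_restrict_mem measurableSet_Ioi] with t ht
  have ht' : 0 < t := ht
  rw [Real.norm_of_nonneg (mul_nonneg (by positivity) (damping_pos _ _).le)]
  exact inv_mul_damping_le hc t

theorem integral_inv_mul_damping_le {c : ℝ} (hc : 0 < c) :
    ∫ t in Set.Ioi 0, t⁻¹ * damping c t ≤ 1 / c ^ 2 := by
  have h := setIntegral_mono_on (integrableOn_inv_mul_damping hc)
    ((exp_neg_integrableOn_Ioi 0 hc).const_mul c⁻¹) measurableSet_Ioi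
    fun t _ => inv_mul_damping_le hc t
  refine h.trans (le_of_eq ?_)
  rw [integral_const_mul, integral_exp_mul_Ioi (by linarith)]
  field_simp
  simp

/-! ### Cauchy transforms along a ray, at points that keep an angle from it. -/

/-- `ζ` keeps a definite angle, of cosine `k`, from the ray in the unit direction `d`. -/
def Apart (k : ℝ) (ζ d : ℂ) : Prop := (ζ * (starRingEnd ℂ) d).re < k * ‖ζ‖

theorem Apart.ne_zero {k : ℝ} {ζ d : ℂ} (h : Apart k ζ d) : ζ ≠ 0 := by
  rintro rfl; simp [Apart] at h

theorem Apart.smul {k : ℝ} {ζ d : ℂ} (h : Apart k ζ d) {t : ℝ} (ht : 0 < t) :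
    Apart k (t * ζ) d := by
  unfold Apart at *
  rw [mul_assoc, Complex.re_ofReal_mul, norm_mul, Complex.norm_of_nonneg ht.le]
  nlinarith

theorem isOpen_apart (k : ℝ) (d : ℂ) : IsOpen {ζ | Apart k ζ d} := by
  unfold Apart
  exact isOpen_lt (by fun_prop) (by fun_prop)

/-- Law of cosines: with `r = ‖ζ‖`, the squared distance is at least `t² - 2 k t r + r² ≥ (1 - k)(t²
+ r²) ≥ (1 - k)/2 (t + r)²`. Lowering the constant to its square gives a bound without square roots.
-/
theorem Apart.norm_sub_ge {k : ℝ} (hk0 : 0 ≤ k) (hk1 : k < 1) {ζ d : ℂ} (hd : ‖d‖ = 1)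
    (h : Apart k ζ d) {t : ℝ} (ht : 0 < t) : (1 - k) / 2 * (t + ‖ζ‖) ≤ ‖t * d - ζ‖ := by
  have hr := norm_nonneg ζ
  have h1 : ‖t * d - ζ‖ ^ 2 = t ^ 2 - 2 * t * (ζ * (starRingEnd ℂ) d).re + ‖ζ‖ ^ 2 := by
    have hd2 : d.re ^ 2 + d.im ^ 2 = 1 := by
      have := Complex.sq_norm d
      rw [hd, Complex.normSq_apply] at this; nlinarith
    rw [Complex.sq_norm, Complex.sq_norm, Complex.normSq_apply, Complex.normSq_apply]
    simp
    linear_combination t ^ 2 * hd2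
  unfold Apart at h
  refine le_of_sq_le_sq ?_ (norm_nonneg _)
  rw [h1]
  have h2 : t * (ζ * (starRingEnd ℂ) d).re ≤ t * (k * ‖ζ‖) := by gcongr
  generalize ‖ζ‖ = r at *
  have h3 : t ^ 2 - 2 * t * (k * r) + r ^ 2 ≥ (1 - k) * (t ^ 2 + r ^ 2) := by
    nlinarith [mul_nonneg hk0 (sq_nonneg (t - r))]
  have h4 : (1 - k) * (t ^ 2 + r ^ 2) ≥ (1 - k) / 2 * (t + r) ^ 2 := by
    nlinarith [mul_nonneg (by linarith : 0 ≤ 1 - k) (sq_nonneg (t - r))]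
  have h5 : ((1 - k) / 2) ^ 2 * (t + r) ^ 2 ≤ (1 - k) / 2 * (t + r) ^ 2 := by
    gcongr; nlinarith
  nlinarith

theorem Apart.sub_ne_zero {k : ℝ} (hk0 : 0 ≤ k) (hk1 : k < 1) {ζ d : ℂ} (hd : ‖d‖ = 1)
    (h : Apart k ζ d) {t : ℝ} (ht : 0 < t) : t * d - ζ ≠ 0 := by
  have := h.norm_sub_ge hk0 hk1 hd ht
  have h2 : 0 < (1 - k) / 2 * (t + ‖ζ‖) :=
    mul_pos (by linarith) (by linarith [norm_nonneg ζ])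
  exact norm_pos_iff.1 (h2.trans_le this)

/-- The kernel is invariant under simultaneous scaling of `ζ'` and `ζ`, so the bound depends on the
angle alone and is uniform as `ζ` tends to `0` or `∞`. -/
theorem Apart.norm_kernel_le {k : ℝ} (hk0 : 0 ≤ k) (hk1 : k < 1) {ζ d : ℂ} (hd : ‖d‖ = 1)
    (h : Apart k ζ d) {t : ℝ} (ht : 0 < t) : ‖(t * d + ζ) / (t * d - ζ)‖ ≤ 2 / (1 - k) := by
  have h1 := h.norm_sub_ge hk0 hk1 hd ht
  have h2 : ‖t * d + ζ‖ ≤ t + ‖ζ‖ := by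
    refine (norm_add_le _ _).trans ?_
    rw [norm_mul, hd, Complex.norm_of_nonneg ht.le, mul_one]
  rw [norm_div, div_le_div_iff₀ (norm_pos_iff.2 (h.sub_ne_zero hk0 hk1 hd ht)) (by linarith)]
  nlinarith

/-- The integral of `(ζ' + ζ) / (ζ' - ζ) * g ζ'` against `dζ' / ζ'` along the ray in the
direction `d`. -/
noncomputable def cauchyTransform (d : ℂ) (g : ℂ → ℂ) (ζ : ℂ) : ℂ :=
  ∫ t in Set.Ioi (0 : ℝ), (t : ℂ)⁻¹ * ((t * d + ζ) / (t * d - ζ) * g (t * d))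

/-- `g` is measurable on the ray in the unit direction `d`, with bound `C * damping c`. -/
structure Damped (C c : ℝ) (d : ℂ) (g : ℂ → ℂ) : Prop where
  meas : AEStronglyMeasurable (fun t : ℝ => g (t * d)) (volume.restrict (Set.Ioi 0))
  bound : ∀ t : ℝ, 0 < t → ‖g (t * d)‖ ≤ C * damping c t

theorem measurable_kernel (d ζ : ℂ) :
    Measurable fun t : ℝ => ((t : ℂ) * d + ζ) / (t * d - ζ) := by fun_prop

theorem aestronglyMeasurable_integrand {d : ℂ} {g : ℂ → ℂ} (ζ : ℂ)
    (hg : AEStronglyMeasurable (fun t : ℝ => g (t * d)) (volume.restrict (Set.Ioi 0))) :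
    AEStronglyMeasurable (fun t : ℝ => (t : ℂ)⁻¹ * ((t * d + ζ) / (t * d - ζ) * g (t * d)))
      (volume.restrict (Set.Ioi 0)) := by
  have h1 : Measurable fun t : ℝ => (t : ℂ)⁻¹ := by fun_prop
  exact h1.aestronglyMeasurable.mul ((measurable_kernel d ζ).aestronglyMeasurable.mul hg)

theorem norm_integrand_le {K B t : ℝ} {d ζ : ℂ} {g : ℂ → ℂ} (ht : 0 < t) (hK : 0 ≤ K)
    (h1 : ‖(t * d + ζ) / (t * d - ζ)‖ ≤ K) (h2 : ‖g (t * d)‖ ≤ B) :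
    ‖(t : ℂ)⁻¹ * ((t * d + ζ) / (t * d - ζ) * g (t * d))‖ ≤ t⁻¹ * (K * B) := by
  rw [norm_mul, norm_inv, Complex.norm_of_nonneg ht.le, norm_mul]
  gcongr

theorem integrableOn_of_kernel_le {C c K : ℝ} (hc : 0 < c) (hK : 0 ≤ K) {d ζ : ℂ} {g : ℂ → ℂ}
    (hg : Damped C c d g) (h : ∀ t : ℝ, 0 < t → ‖(t * d + ζ) / (t * d - ζ)‖ ≤ K) :
    IntegrableOn (fun t : ℝ => (t : ℂ)⁻¹ * ((t * d + ζ) / (t * d - ζ) * g (t * d)))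
      (Set.Ioi 0) := by
  refine Integrable.mono' ((integrableOn_inv_mul_damping hc).const_mul (K * C))
    (aestronglyMeasurable_integrand ζ hg.meas) ?_
  filter_upwards [ae_restrict_mem measurableSet_Ioi] with t ht
  refine (norm_integrand_le ht hK (h t ht) (hg.bound t ht)).trans (le_of_eq (by ring))

theorem integrableOn_integrand {C c k : ℝ} (hc : 0 < c) (hk0 : 0 ≤ k) (hk1 : k < 1) {d ζ : ℂ}
    (hd : ‖d‖ = 1) {g : ℂ → ℂ} (hg : Damped C c d g) (h : Apart k ζ d) :
    IntegrableOn (fun t : ℝ => (t : ℂ)⁻¹ * ((t * d + ζ) / (t * d - ζ) * g (t * d)))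
      (Set.Ioi 0) :=
  integrableOn_of_kernel_le hc (div_nonneg zero_le_two (by linarith)) hg
    fun _ ht => h.norm_kernel_le hk0 hk1 hd ht

/-- The factor `1 / c²` is the source of the contraction: `c` grows linearly with `R`. -/
theorem norm_cauchyTransform_le {C c k : ℝ} (hc : 0 < c) (hC : 0 ≤ C) (hk0 : 0 ≤ k) (hk1 : k < 1)
    {d ζ : ℂ} (hd : ‖d‖ = 1) {g : ℂ → ℂ}
    (hg : ∀ t : ℝ, 0 < t → ‖g (t * d)‖ ≤ C * damping c t)
    (h : Apart k ζ d) : ‖cauchyTransform d g ζ‖ ≤ 2 * C / ((1 - k) * c ^ 2) := by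
  have hk : 0 < 1 - k := by linarith
  have h1 : ‖cauchyTransform d g ζ‖ ≤
      ∫ t in Set.Ioi (0 : ℝ), (2 / (1 - k) * C) * (t⁻¹ * damping c t) := by
    refine norm_integral_le_of_norm_le ((integrableOn_inv_mul_damping hc).const_mul _) ?_
    filter_upwards [ae_restrict_mem measurableSet_Ioi] with t ht
    refine (norm_integrand_le ht (by positivity) (h.norm_kernel_le hk0 hk1 hd ht)
      (hg t ht)).trans (le_of_eq (by ring))
  rw [integral_const_mul] at h1
  refine h1.trans ((mul_le_mul_of_nonneg_left (integral_inv_mul_damping_le hc)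
    (by positivity)).trans (le_of_eq ?_))
  field_simp

theorem cauchyTransform_add {C C' c k : ℝ} (hc : 0 < c) (hk0 : 0 ≤ k) (hk1 : k < 1) {d ζ : ℂ}
    (hd : ‖d‖ = 1) {g h : ℂ → ℂ} (hg : Damped C c d g) (hh : Damped C' c d h)
    (hζ : Apart k ζ d) :
    cauchyTransform d (fun z => g z + h z) ζ =
      cauchyTransform d g ζ + cauchyTransform d h ζ := by
  unfold cauchyTransform
  rw [← integral_add (integrableOn_integrand hc hk0 hk1 hd hg hζ)
    (integrableOn_integrand hc hk0 hk1 hd hh hζ)]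
  congr 1; ext t; ring

theorem cauchyTransform_congr {d : ℂ} {g h : ℂ → ℂ} (hgh : ∀ t : ℝ, 0 < t → g (t * d) = h (t * d))
    (ζ : ℂ) : cauchyTransform d g ζ = cauchyTransform d h ζ :=
  setIntegral_congr_fun measurableSet_Ioi fun t ht => by simp only [hgh t ht]

theorem differentiableAt_cauchyTransform {C c k : ℝ} (hc : 0 < c) (hk0 : 0 ≤ k) (hk1 : k < 1)
    {d ζ : ℂ} (hd : ‖d‖ = 1) {g : ℂ → ℂ} (hg : Damped C c d g) (h : Apart k ζ d) :
    DifferentiableAt ℂ (cauchyTransform d g) ζ := by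
  have hk : 0 < 1 - k := by linarith
  have hζ : 0 < ‖ζ‖ := norm_pos_iff.2 h.ne_zero
  set s : Set ℂ := {z | Apart k z d} ∩ {z | ‖ζ‖ / 2 < ‖z‖}
  have hs : s ∈ 𝓝 ζ := ((isOpen_apart k d).inter (isOpen_lt continuous_const continuous_norm)).mem_nhds
    ⟨h, by show ‖ζ‖ / 2 < ‖ζ‖; linarith⟩
  have hm : Measurable fun t : ℝ => (t : ℂ)⁻¹ * (2 * (t * d) / (t * d - ζ) ^ 2) := by fun_prop
  refine (hasDerivAt_integral_of_dominated_loc_of_deriv_le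
    (μ := volume.restrict (Set.Ioi 0))
    (F := fun z (t : ℝ) => (t : ℂ)⁻¹ * ((t * d + z) / (t * d - z) * g (t * d)))
    (F' := fun z (t : ℝ) => (t : ℂ)⁻¹ * ((2 * (t * d) / (t * d - z) ^ 2) * g (t * d)))
    (bound := fun t => (16 / ((1 - k) ^ 2 * ‖ζ‖) * C) * (t⁻¹ * damping c t))
    hs ?_ (integrableOn_integrand hc hk0 hk1 hd hg h) ?_ ?_
    ((integrableOn_inv_mul_damping hc).const_mul _) ?_).2.differentiableAt
  · exact Eventually.of_forall fun z => aestronglyMeasurable_integrand z hg.meas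
  · exact (hm.aestronglyMeasurable.mul hg.meas).congr (Eventually.of_forall fun t => by
      simp only [Pi.mul_apply]; ring)
  · filter_upwards [ae_restrict_mem measurableSet_Ioi] with t ht z hz
    have ht' : 0 < t := ht
    have h1 := hz.1.norm_sub_ge hk0 hk1 hd ht'
    have h2 : ‖ζ‖ / 2 < ‖z‖ := hz.2
    -- The lower bound is linear in `t`, so that the `t` in the numerator of the kernel's derivative
    -- cancels and `t⁻¹ * damping c t` remains as dominating function.
    have h3 : (1 - k) ^ 2 / 8 * (t * ‖ζ‖) ≤ ‖t * d - z‖ ^ 2 := by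
      have h4 : t * ‖ζ‖ / 2 ≤ (t + ‖z‖) ^ 2 := by nlinarith [norm_nonneg z]
      have h5 : ((1 - k) / 2 * (t + ‖z‖)) ^ 2 ≤ ‖t * d - z‖ ^ 2 := by gcongr
      nlinarith [mul_le_mul_of_nonneg_left h4 (sq_nonneg ((1 - k) / 2))]
    have h6 : ‖2 * (t * d) / (t * d - z) ^ 2‖ ≤ 16 / ((1 - k) ^ 2 * ‖ζ‖) := by
      rw [norm_div, norm_pow, norm_mul, norm_mul, hd, Complex.norm_of_nonneg ht'.le]
      rw [div_le_div_iff₀ ((by positivity : 0 < (1 - k) ^ 2 / 8 * (t * ‖ζ‖)).trans_le h3)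
        (by positivity)]
      simp
      nlinarith
    rw [norm_mul, norm_inv, Complex.norm_of_nonneg ht'.le, norm_mul]
    calc t⁻¹ * (‖2 * (t * d) / (t * d - z) ^ 2‖ * ‖g (t * d)‖)
        ≤ t⁻¹ * (16 / ((1 - k) ^ 2 * ‖ζ‖) * (C * damping c t)) := by
          gcongr; exact hg.bound t ht'
      _ = _ := by ring
  · filter_upwards [ae_restrict_mem measurableSet_Ioi] with t ht z hz
    have h1 : (t : ℂ) * d - z ≠ 0 := hz.1.sub_ne_zero hk0 hk1 hd ht
    have h2 : HasDerivAt (fun z : ℂ => (t * d + z) / (t * d - z))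
        (2 * (t * d) / (t * d - z) ^ 2) z := by
      have := ((hasDerivAt_id z).const_add ((t : ℂ) * d)).div
        ((hasDerivAt_id z).const_sub ((t : ℂ) * d)) h1
      refine this.congr_deriv ?_
      simp only [id]
      ring
    exact ((h2.mul_const _).const_mul _)

theorem norm_log_one_sub_le {z : ℂ} (hz : ‖z‖ ≤ 1 / 2) :
    ‖Complex.log (1 - z)‖ ≤ 3 / 2 * ‖z‖ := by
  have := Complex.norm_log_one_add_half_le_self (z := -z) (by simpa using hz)
  simpa [sub_eq_add_neg] using this

theorem one_sub_mem_slitPlane {z : ℂ} (hz : ‖z‖ ≤ 1 / 2) : 1 - z ∈ Complex.slitPlane := by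
  left
  have := Complex.abs_re_le_norm z
  simp
  linarith [le_abs_self z.re]

/-- Mean value inequality on the disc of radius 1/2, where the derivative `-1/(1 - x)` has modulus
at most 2. -/
theorem norm_log_one_sub_sub_le {z w : ℂ} (hz : ‖z‖ ≤ 1 / 2) (hw : ‖w‖ ≤ 1 / 2) :
    ‖Complex.log (1 - z) - Complex.log (1 - w)‖ ≤ 2 * ‖z - w‖ := by
  have hd : ∀ x ∈ Metric.closedBall (0 : ℂ) (1 / 2),
      HasDerivAt (fun z => Complex.log (1 - z)) (-1 / (1 - x)) x := fun x hx =>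
    ((hasDerivAt_id x).const_sub 1).clog (one_sub_mem_slitPlane (by simpa using hx))
  refine Convex.norm_image_sub_le_of_norm_deriv_le (𝕜 := ℂ) (s := Metric.closedBall (0 : ℂ) (1 / 2))
    (fun x hx => (hd x hx).differentiableAt) ?_ (convex_closedBall _ _)
    (by simpa using hw) (by simpa using hz)
  intro x hx
  rw [(hd x hx).deriv]
  have h1 : ‖x‖ ≤ 1 / 2 := by simpa using hx
  have h2 : 1 / 2 ≤ ‖1 - x‖ := by
    have := norm_sub_norm_le 1 x
    simp at this; linarith
  rw [norm_div, norm_neg, norm_one, div_le_iff₀ (by linarith)]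
  linarith

theorem norm_exp_le_three {w : ℂ} (hw : ‖w‖ ≤ 1) : ‖Complex.exp w‖ ≤ 3 := by
  have h := Real.exp_one_lt_d9
  refine (Complex.norm_exp_le_exp_norm w).trans ((Real.exp_le_exp.2 hw).trans (by linarith))

theorem norm_exp_sub_exp_le {z w : ℂ} (hz : ‖z‖ ≤ 1) (hw : ‖w‖ ≤ 1) :
    ‖Complex.exp z - Complex.exp w‖ ≤ 3 * ‖z - w‖ :=
  Convex.norm_image_sub_le_of_norm_deriv_le (𝕜 := ℂ) (s := Metric.closedBall (0 : ℂ) 1)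
    (fun x _ => Complex.differentiableAt_exp)
    (fun x hx => by rw [Complex.deriv_exp]; exact norm_exp_le_three (by simpa using hx))
    (convex_closedBall _ _) (by simpa using hw) (by simpa using hz)

/-! ### The contraction for the integral equation along fixed contours. -/

/-- The exponent in the integral equation with the integral for `γ'` in the equation of `γ` taken
along the ray in the direction `d γ γ'`. -/
noncomputable def contourExponent (G : Finset Charge) (d : Charge → Charge → ℂ)
    (X : Charge → ℂ → ℂ) (γ : Charge) (ζ : ℂ) : ℂ :=
  -(1 / (4 * Real.pi * Complex.I)) * ∑ γ' ∈ G,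
    (pairing γ γ' : ℂ) * cauchyTransform (d γ γ') (fun z => Complex.log (1 - X γ' z)) ζ

/-- The right-hand side of the integral equation along the contours `d`, with source `f`. -/
noncomputable def contourStep (f : Charge → ℂ → ℂ) (G : Finset Charge)
    (d : Charge → Charge → ℂ) (X : Charge → ℂ → ℂ) (γ : Charge) (ζ : ℂ) : ℂ :=
  f γ ζ * Complex.exp (contourExponent G d X γ ζ)

/-- The iterates of `contourStep`. -/
noncomputable def contourIter (f : Charge → ℂ → ℂ) (G : Finset Charge)
    (d : Charge → Charge → ℂ) : ℕ → Charge → ℂ → ℂ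
  | 0 => f
  | ν + 1 => contourStep f G d (contourIter f G d ν)

/-- The limit of the iterates of `contourStep`. -/
noncomputable def contourLimit (f : Charge → ℂ → ℂ) (G : Finset Charge)
    (d : Charge → Charge → ℂ) (γ : Charge) (ζ : ℂ) : ℂ :=
  limUnder atTop (fun ν : ℕ => contourIter f G d ν γ ζ)

/-- The points that keep a definite angle from the contours in the equation of `γ`. -/
def contourDomain (G : Finset Charge) (d : Charge → Charge → ℂ) (k : ℝ) (γ : Charge) : Set ℂ :=
  {ζ | ζ ≠ 0 ∧ ∀ γ' ∈ G, pairing γ γ' ≠ 0 → Apart k ζ (d γ γ')}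

/-- The hypotheses under which `contourStep` contracts. -/
structure Admissible (f : Charge → ℂ → ℂ) (G : Finset Charge) (d : Charge → Charge → ℂ)
    (k c : ℝ) : Prop where
  nonneg : 0 ≤ k
  lt_one : k < 1
  two_le : 2 ≤ c
  small : 100 ≤ (1 - k) * c ^ 2
  sum_le : ∀ γ ∈ G, ∑ γ' ∈ G, |(pairing γ γ' : ℝ)| ≤ 6
  diff : ∀ γ ∈ G, DifferentiableOn ℂ (f γ) {0}ᶜ
  unit : ∀ γ ∈ G, ∀ γ' ∈ G, pairing γ γ' ≠ 0 → ‖d γ γ'‖ = 1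
  mem : ∀ γ ∈ G, ∀ γ' ∈ G, pairing γ γ' ≠ 0 → d γ γ' ∈ contourDomain G d k γ'
  decay : ∀ γ ∈ G, ∀ γ' ∈ G, pairing γ γ' ≠ 0 → ∀ t : ℝ, 0 < t →
    ‖f γ' (t * d γ γ')‖ ≤ damping c t

/-- The functions `X γ'` are measurable on the contours and bounded by `8 * damping c`. -/
def Tame (G : Finset Charge) (d : Charge → Charge → ℂ) (c : ℝ) (X : Charge → ℂ → ℂ) : Prop :=
  ∀ γ ∈ G, ∀ γ' ∈ G, pairing γ γ' ≠ 0 → Damped 8 c (d γ γ') (X γ')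

theorem isOpen_contourDomain (G : Finset Charge) (d : Charge → Charge → ℂ) (k : ℝ) (γ : Charge) :
    IsOpen (contourDomain G d k γ) := by
  have : contourDomain G d k γ =
      {0}ᶜ ∩ ⋂ γ' ∈ G, {ζ | pairing γ γ' ≠ 0 → Apart k ζ (d γ γ')} := by
    ext ζ; simp [contourDomain]
  rw [this]
  refine isOpen_compl_singleton.inter (isOpen_biInter_finset fun γ' _ => ?_)
  by_cases h : pairing γ γ' = 0
  · simp [h]
  · simpa [h] using isOpen_apart k (d γ γ')

theorem smul_mem_contourDomain {G : Finset Charge} {d : Charge → Charge → ℂ} {k : ℝ} {γ : Charge}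
    {ζ : ℂ} (h : ζ ∈ contourDomain G d k γ) {t : ℝ} (ht : 0 < t) :
    (t : ℂ) * ζ ∈ contourDomain G d k γ :=
  ⟨mul_ne_zero (by exact_mod_cast ht.ne') h.1, fun γ' hγ' hp => (h.2 γ' hγ' hp).smul ht⟩

theorem Damped.le_half {c : ℝ} (hc : 2 ≤ c) {d : ℂ} {g : ℂ → ℂ} (hg : Damped 8 c d g) {t : ℝ}
    (ht : 0 < t) : ‖g (t * d)‖ ≤ 1 / 2 := by
  have := hg.bound t ht
  have := damping_le hc ht
  linarith

theorem aestronglyMeasurable_log_one_sub {μ : Measure ℝ} {g : ℝ → ℂ}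
    (hg : AEStronglyMeasurable g μ) :
    AEStronglyMeasurable (fun t => Complex.log (1 - g t)) μ :=
  ((Complex.measurable_log.comp_aemeasurable
    (aemeasurable_const.sub hg.aemeasurable))).aestronglyMeasurable

/-- On the disc of radius 1/2 the logarithm costs a factor 3/2, which turns the constant 8 into 12.
-/
theorem Damped.log {c : ℝ} (hc : 2 ≤ c) {d : ℂ} {g : ℂ → ℂ} (hg : Damped 8 c d g) :
    Damped 12 c d fun z => Complex.log (1 - g z) where
  meas := aestronglyMeasurable_log_one_sub hg.meas
  bound t ht := by
    have h1 := norm_log_one_sub_le (hg.le_half hc ht)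
    have := hg.bound t ht
    linarith

section

variable {f : Charge → ℂ → ℂ} {G : Finset Charge} {d : Charge → Charge → ℂ} {k c : ℝ}

/-- Three factors meet: the pairings sum to at most 6, `small` bounds each term by `2B/100`, and
`1/(4π) ≤ 1/12`. Together they give `B/100`; 96 is a convenient weakening. -/
theorem Admissible.norm_sum_le (H : Admissible f G d k c) {γ : Charge} (hγ : γ ∈ G) {B : ℝ}
    {g : Charge → ℂ} (hB : 0 ≤ B) (hg : ∀ γ' ∈ G, pairing γ γ' ≠ 0 → ‖g γ'‖ ≤ 2 * B / ((1 - k) * c ^ 2)) :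
    ‖-(1 / (4 * Real.pi * Complex.I)) * ∑ γ' ∈ G, (pairing γ γ' : ℂ) * g γ'‖ ≤ B / 96 := by
  have h1 : ‖∑ γ' ∈ G, (pairing γ γ' : ℂ) * g γ'‖ ≤ 12 * B / 100 := by
    calc ‖∑ γ' ∈ G, (pairing γ γ' : ℂ) * g γ'‖
        ≤ ∑ γ' ∈ G, |(pairing γ γ' : ℝ)| * (2 * B / 100) := by
          refine norm_sum_le_of_le _ fun γ' hγ' => ?_
          rw [norm_mul, Complex.norm_intCast]
          by_cases hp : pairing γ γ' = 0
          · simp [hp]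
          · gcongr
            refine (hg γ' hγ' hp).trans ?_
            have := H.small
            gcongr
      _ = (∑ γ' ∈ G, |(pairing γ γ' : ℝ)|) * (2 * B / 100) := by rw [Finset.sum_mul]
      _ ≤ 6 * (2 * B / 100) := by gcongr; exact H.sum_le γ hγ
      _ = _ := by ring
  have h2 : ‖-(1 / (4 * Real.pi * Complex.I))‖ = 1 / (4 * Real.pi) := by
    rw [norm_neg, norm_div, norm_mul, norm_mul, Complex.norm_I, Complex.norm_real,
      Real.norm_of_nonneg Real.pi_pos.le]
    simp
  have h3 : 1 / (4 * Real.pi) ≤ 1 / 12 := by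
    have := Real.pi_gt_three
    gcongr; linarith
  rw [norm_mul, h2]
  calc 1 / (4 * Real.pi) * _ ≤ 1 / 12 * (12 * B / 100) := by gcongr
    _ ≤ _ := by linarith

theorem Admissible.norm_exponent_le (H : Admissible f G d k c) {X : Charge → ℂ → ℂ}
    (hX : Tame G d c X) {γ : Charge} (hγ : γ ∈ G) {ζ : ℂ} (hζ : ζ ∈ contourDomain G d k γ) :
    ‖contourExponent G d X γ ζ‖ ≤ 1 := by
  refine (H.norm_sum_le hγ (B := 12) (by norm_num) fun γ' hγ' hp => ?_).trans (by norm_num)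
  exact norm_cauchyTransform_le (by linarith [H.two_le]) (by norm_num) H.nonneg H.lt_one
    (H.unit γ hγ γ' hγ' hp) ((hX γ hγ γ' hγ' hp).log H.two_le).bound (hζ.2 γ' hγ' hp)

theorem Admissible.norm_step_le (H : Admissible f G d k c) {X : Charge → ℂ → ℂ}
    (hX : Tame G d c X) {γ : Charge} (hγ : γ ∈ G) {ζ : ℂ} (hζ : ζ ∈ contourDomain G d k γ) :
    ‖contourStep f G d X γ ζ‖ ≤ 3 * ‖f γ ζ‖ := by
  rw [contourStep, norm_mul, mul_comm]
  gcongr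
  exact norm_exp_le_three (H.norm_exponent_le hX hγ hζ)

theorem differentiableOn_contourExponent (H : Admissible f G d k c) {X : Charge → ℂ → ℂ}
    (hX : Tame G d c X) {γ : Charge} (hγ : γ ∈ G) :
    DifferentiableOn ℂ (contourExponent G d X γ) (contourDomain G d k γ) := by
  intro ζ hζ
  refine DifferentiableAt.differentiableWithinAt ?_
  unfold contourExponent
  refine (DifferentiableAt.fun_sum fun γ' hγ' => ?_).const_mul _
  by_cases hp : pairing γ γ' = 0
  · simp [hp]
  · exact (differentiableAt_cauchyTransform (by linarith [H.two_le]) H.nonneg H.lt_one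
      (H.unit γ hγ γ' hγ' hp) ((hX γ hγ γ' hγ' hp).log H.two_le) (hζ.2 γ' hγ' hp)).const_mul _

theorem Admissible.differentiableOn_step (H : Admissible f G d k c) {X : Charge → ℂ → ℂ}
    (hX : Tame G d c X) {γ : Charge} (hγ : γ ∈ G) :
    DifferentiableOn ℂ (contourStep f G d X γ) (contourDomain G d k γ) :=
  ((H.diff γ hγ).mono fun _ h => h.1).mul (differentiableOn_contourExponent H hX hγ).cexp

/-- By `mem`, the contour for `γ'` in any equation runs inside the domain of `γ'`, which is a cone;
hence control of `X γ'` on its domain is control on every contour where it is integrated. -/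
theorem Admissible.tame_of_le (H : Admissible f G d k c) {X : Charge → ℂ → ℂ}
    (h1 : ∀ γ ∈ G, ContinuousOn (X γ) (contourDomain G d k γ))
    (h2 : ∀ γ ∈ G, ∀ ζ ∈ contourDomain G d k γ, ‖X γ ζ‖ ≤ 3 * ‖f γ ζ‖) : Tame G d c X := by
  intro γ hγ γ' hγ' hp
  have hm : ∀ t : ℝ, 0 < t → (t : ℂ) * d γ γ' ∈ contourDomain G d k γ' := fun t ht =>
    smul_mem_contourDomain (H.mem γ hγ γ' hγ' hp) ht
  refine ⟨ContinuousOn.aestronglyMeasurable ?_ measurableSet_Ioi, fun t ht => ?_⟩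
  · exact (h1 γ' hγ').comp (by fun_prop) fun t ht => hm t ht
  · refine (h2 γ' hγ' _ (hm t ht)).trans ?_
    have := H.decay γ hγ γ' hγ' hp t ht
    linarith [damping_pos c t]

/-- The bound does not deteriorate with `ν`: each step starts again from the source `f` and
multiplies it by the exponential of a number of modulus at most 1. -/
theorem Admissible.iter_spec (H : Admissible f G d k c) (ν : ℕ) :
    (∀ γ ∈ G, DifferentiableOn ℂ (contourIter f G d ν γ) (contourDomain G d k γ)) ∧
    ∀ γ ∈ G, ∀ ζ ∈ contourDomain G d k γ, ‖contourIter f G d ν γ ζ‖ ≤ 3 * ‖f γ ζ‖ := by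
  induction ν with
  | zero =>
    exact ⟨fun γ hγ => (H.diff γ hγ).mono fun _ h => h.1, fun γ _ ζ _ => by
      simp only [contourIter]; linarith [norm_nonneg (f γ ζ)]⟩
  | succ ν ih =>
    have hT := H.tame_of_le (fun γ hγ => (ih.1 γ hγ).continuousOn) ih.2
    exact ⟨fun γ hγ => H.differentiableOn_step hT hγ, fun γ hγ ζ hζ => H.norm_step_le hT hγ hζ⟩

theorem Admissible.tame_iter (H : Admissible f G d k c) (ν : ℕ) :
    Tame G d c (contourIter f G d ν) :=
  H.tame_of_le (fun γ hγ => ((H.iter_spec ν).1 γ hγ).continuousOn) (H.iter_spec ν).2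

/-- The exponents differ by at most `2Δ/96`, and the exponential has Lipschitz constant 3 on the
unit disc. Stating the result relative to `‖f γ ζ‖` makes it valid on the whole domain, and `decay`
turns it back into a damping bound on the contours, ready for iteration. -/
theorem Admissible.norm_step_sub_le (H : Admissible f G d k c) {X X' : Charge → ℂ → ℂ}
    (hX : Tame G d c X) (hX' : Tame G d c X') {Δ : ℝ} (hΔ : 0 ≤ Δ)
    (h : ∀ γ ∈ G, ∀ γ' ∈ G, pairing γ γ' ≠ 0 → ∀ t : ℝ, 0 < t →
      ‖X γ' (t * d γ γ') - X' γ' (t * d γ γ')‖ ≤ Δ * damping c t)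
    {γ : Charge} (hγ : γ ∈ G) {ζ : ℂ} (hζ : ζ ∈ contourDomain G d k γ) :
    ‖contourStep f G d X γ ζ - contourStep f G d X' γ ζ‖ ≤ Δ / 2 * ‖f γ ζ‖ := by
  have h1 : ‖contourExponent G d X γ ζ - contourExponent G d X' γ ζ‖ ≤ (2 * Δ) / 96 := by
    rw [contourExponent, contourExponent, ← mul_sub, ← Finset.sum_sub_distrib]
    simp_rw [← mul_sub]
    refine H.norm_sum_le hγ (by positivity) fun γ' hγ' hp => ?_
    have hd := H.unit γ hγ γ' hγ' hp
    have hc : 0 < c := by linarith [H.two_le]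
    have e : cauchyTransform (d γ γ') (fun z => Complex.log (1 - X γ' z)) ζ -
        cauchyTransform (d γ γ') (fun z => Complex.log (1 - X' γ' z)) ζ =
        cauchyTransform (d γ γ')
          (fun z => Complex.log (1 - X γ' z) - Complex.log (1 - X' γ' z)) ζ := by
      unfold cauchyTransform
      rw [← integral_sub
        (integrableOn_integrand hc H.nonneg H.lt_one hd ((hX γ hγ γ' hγ' hp).log H.two_le)
          (hζ.2 γ' hγ' hp))
        (integrableOn_integrand hc H.nonneg H.lt_one hd ((hX' γ hγ γ' hγ' hp).log H.two_le)
          (hζ.2 γ' hγ' hp))]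
      congr 1; ext t; ring
    rw [e]
    refine norm_cauchyTransform_le hc (by positivity) H.nonneg H.lt_one hd (fun t ht => ?_)
      (hζ.2 γ' hγ' hp)
    have h3 := norm_log_one_sub_sub_le ((hX γ hγ γ' hγ' hp).le_half H.two_le ht)
      ((hX' γ hγ γ' hγ' hp).le_half H.two_le ht)
    have h4 := h γ hγ γ' hγ' hp t ht
    linarith
  rw [contourStep, contourStep, ← mul_sub, norm_mul, mul_comm]
  gcongr
  have h2 := norm_exp_sub_exp_le (H.norm_exponent_le hX hγ hζ) (H.norm_exponent_le hX' hγ hζ)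
  linarith

theorem Admissible.norm_iter_succ_sub_le (H : Admissible f G d k c) (ν : ℕ) :
    ∀ γ ∈ G, ∀ ζ ∈ contourDomain G d k γ,
      ‖contourIter f G d (ν + 1) γ ζ - contourIter f G d ν γ ζ‖ ≤ 6 * (1 / 2) ^ ν * ‖f γ ζ‖ := by
  induction ν with
  | zero =>
    intro γ hγ ζ hζ
    have h1 := (H.iter_spec 1).2 γ hγ ζ hζ
    have h2 := (H.iter_spec 0).2 γ hγ ζ hζ
    -- Both iterates are at most `3 ‖f γ ζ‖`, which gives the initial constant 6.
    have := norm_sub_le (contourIter f G d (0 + 1) γ ζ) (contourIter f G d 0 γ ζ)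
    simp only [zero_add, pow_zero] at *
    linarith
  | succ ν ih =>
    intro γ hγ ζ hζ
    refine (H.norm_step_sub_le (H.tame_iter (ν + 1)) (H.tame_iter ν)
      (Δ := 6 * (1 / 2) ^ ν) (by positivity)
      (fun γ hγ γ' hγ' hp t ht => (ih γ' hγ' _
        (smul_mem_contourDomain (H.mem γ hγ γ' hγ' hp) ht)).trans ?_) hγ hζ).trans
      (le_of_eq ?_)
    · gcongr; exact H.decay γ hγ γ' hγ' hp t ht
    · ring

theorem Admissible.tendsto_iter (H : Admissible f G d k c) {γ : Charge} (hγ : γ ∈ G) {ζ : ℂ}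
    (hζ : ζ ∈ contourDomain G d k γ) :
    Tendsto (fun ν => contourIter f G d ν γ ζ) atTop (𝓝 (contourLimit f G d γ ζ)) := by
  refine CauchySeq.tendsto_limUnder (cauchySeq_of_le_geometric (1 / 2) (6 * ‖f γ ζ‖)
    (by norm_num) fun ν => ?_)
  rw [dist_comm, dist_eq_norm]
  refine (H.norm_iter_succ_sub_le ν γ hγ ζ hζ).trans (le_of_eq (by ring))

theorem Admissible.norm_iter_sub_limit_le (H : Admissible f G d k c) (ν : ℕ) {γ : Charge}
    (hγ : γ ∈ G) {ζ : ℂ} (hζ : ζ ∈ contourDomain G d k γ) :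
    ‖contourIter f G d ν γ ζ - contourLimit f G d γ ζ‖ ≤ 12 * (1 / 2) ^ ν * ‖f γ ζ‖ := by
  have := dist_le_of_le_geometric_of_tendsto (1 / 2) (6 * ‖f γ ζ‖) (by norm_num)
    (fun ν => ?_) (H.tendsto_iter hγ hζ) ν
  · rw [dist_eq_norm] at this
    refine this.trans (le_of_eq (by ring))
  · rw [dist_comm, dist_eq_norm]
    refine (H.norm_iter_succ_sub_le ν γ hγ ζ hζ).trans (le_of_eq (by ring))

theorem Admissible.norm_limit_le (H : Admissible f G d k c) {γ : Charge}
    (hγ : γ ∈ G) {ζ : ℂ} (hζ : ζ ∈ contourDomain G d k γ) :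
    ‖contourLimit f G d γ ζ‖ ≤ 3 * ‖f γ ζ‖ :=
  le_of_tendsto (H.tendsto_iter hγ hζ).norm
    (Eventually.of_forall fun ν => (H.iter_spec ν).2 γ hγ ζ hζ)

theorem Admissible.tame_limit (H : Admissible f G d k c) : Tame G d c (contourLimit f G d) := by
  intro γ hγ γ' hγ' hp
  have hm : ∀ t : ℝ, 0 < t → (t : ℂ) * d γ γ' ∈ contourDomain G d k γ' := fun t ht =>
    smul_mem_contourDomain (H.mem γ hγ γ' hγ' hp) ht
  refine ⟨aestronglyMeasurable_of_tendsto_ae atTop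
    (fun ν => (H.tame_iter ν γ hγ γ' hγ' hp).meas) ?_, fun t ht => ?_⟩
  · filter_upwards [ae_restrict_mem measurableSet_Ioi] with t ht
    exact H.tendsto_iter hγ' (hm t ht)
  · exact le_of_tendsto (H.tendsto_iter hγ' (hm t ht)).norm
      (Eventually.of_forall fun ν => (H.tame_iter ν γ hγ γ' hγ' hp).bound t ht)

theorem tendsto_half_pow_mul (C : ℝ) : Tendsto (fun ν : ℕ => (1 / 2 : ℝ) ^ ν * C) atTop (𝓝 0) := by
  simpa using (tendsto_pow_atTop_nhds_zero_of_lt_one (by norm_num : (0 : ℝ) ≤ 1 / 2)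
    (by norm_num)).mul_const C

theorem Admissible.limit_eq (H : Admissible f G d k c) {γ : Charge} (hγ : γ ∈ G) {ζ : ℂ}
    (hζ : ζ ∈ contourDomain G d k γ) :
    contourLimit f G d γ ζ = contourStep f G d (contourLimit f G d) γ ζ := by
  refine tendsto_nhds_unique ((H.tendsto_iter hγ hζ).comp (tendsto_add_atTop_nat 1)) ?_
  rw [tendsto_iff_norm_sub_tendsto_zero]
  refine squeeze_zero (fun _ => norm_nonneg _) (fun ν => ?_) (tendsto_half_pow_mul (6 * ‖f γ ζ‖))
  refine (H.norm_step_sub_le (H.tame_iter ν) H.tame_limit (Δ := 12 * (1 / 2) ^ ν) (by positivity)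
    (fun γ hγ γ' hγ' hp t ht => (H.norm_iter_sub_limit_le ν hγ'
        (smul_mem_contourDomain (H.mem γ hγ γ' hγ' hp) ht)).trans ?_) hγ hζ).trans
      (le_of_eq (by ring))
  gcongr; exact H.decay γ hγ γ' hγ' hp t ht

/-- Holomorphy comes from the fixed-point equation itself, since a Cauchy transform is holomorphic
off its contour for any tame density; no locally uniform convergence is needed. -/
theorem Admissible.differentiableOn_limit (H : Admissible f G d k c) {γ : Charge} (hγ : γ ∈ G) :
    DifferentiableOn ℂ (contourLimit f G d γ) (contourDomain G d k γ) :=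
  (H.differentiableOn_step H.tame_limit hγ).congr fun _ hζ => H.limit_eq hγ hζ

/-- Uniqueness. The operator reads `X` on the contours only, so the equation is required only there.
The iterates approach `X` geometrically, starting from `16 = 8 + 8`. -/
theorem Admissible.eq_limit_of_eq_step (H : Admissible f G d k c) {X : Charge → ℂ → ℂ}
    (hX : Tame G d c X)
    (h : ∀ γ ∈ G, ∀ γ' ∈ G, pairing γ γ' ≠ 0 → ∀ t : ℝ, 0 < t →
      X γ' (t * d γ γ') = contourStep f G d X γ' (t * d γ γ'))
    {γ : Charge} (hγ : γ ∈ G) {ζ : ℂ} (hζ : ζ ∈ contourDomain G d k γ) :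
    contourStep f G d X γ ζ = contourLimit f G d γ ζ := by
  have h1 : ∀ ν : ℕ, ∀ γ ∈ G, ∀ γ' ∈ G, pairing γ γ' ≠ 0 → ∀ t : ℝ, 0 < t →
      ‖contourIter f G d ν γ' (t * d γ γ') - X γ' (t * d γ γ')‖ ≤
        16 * (1 / 2) ^ ν * damping c t := by
    intro ν
    induction ν with
    | zero =>
      intro γ hγ γ' hγ' hp t ht
      have h2 := (H.tame_iter 0 γ hγ γ' hγ' hp).bound t ht
      have h3 := (hX γ hγ γ' hγ' hp).bound t ht
      refine (norm_sub_le _ _).trans ?_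
      rw [pow_zero]; linarith
    | succ ν ih =>
      intro γ hγ γ' hγ' hp t ht
      rw [h γ hγ γ' hγ' hp t ht]
      refine (H.norm_step_sub_le (H.tame_iter ν) hX (by positivity) ih hγ'
        (smul_mem_contourDomain (H.mem γ hγ γ' hγ' hp) ht)).trans ?_
      calc 16 * (1 / 2) ^ ν / 2 * ‖f γ' (t * d γ γ')‖
          ≤ 16 * (1 / 2) ^ ν / 2 * damping c t := by
            gcongr; exact H.decay γ hγ γ' hγ' hp t ht
        _ = _ := by ring
  refine tendsto_nhds_unique ?_ ((H.tendsto_iter hγ hζ).comp (tendsto_add_atTop_nat 1))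
  rw [tendsto_iff_norm_sub_tendsto_zero]
  refine squeeze_zero (fun _ => norm_nonneg _) (fun ν => ?_) (tendsto_half_pow_mul (8 * ‖f γ ζ‖))
  exact (H.norm_step_sub_le (H.tame_iter ν) hX (by positivity) (h1 ν) hγ hζ).trans
      (le_of_eq (by ring))

end

/-! ### Rotation of contours by Cauchy's theorem. -/

/-- The direction obtained from `D` by a rotation through the angle `φ`. -/
noncomputable def dir (D : ℂ) (φ : ℝ) : ℂ := D * Complex.exp (φ * Complex.I)

theorem continuous_dir (D : ℂ) : Continuous (dir D) := by
  unfold dir; fun_prop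

theorem norm_dir (D : ℂ) (φ : ℝ) : ‖dir D φ‖ = ‖D‖ := by
  rw [dir, norm_mul, Complex.norm_exp_ofReal_mul_I, mul_one]

theorem dir_zero (D : ℂ) : dir D 0 = D := by simp [dir]

theorem integral_inv_mul_eq (h : ℝ → ℂ) :
    ∫ t in Set.Ioi (0 : ℝ), (t : ℂ)⁻¹ * h t = ∫ s : ℝ, h (Real.exp s) := by
  have := integral_image_eq_integral_abs_deriv_smul (s := Set.univ) MeasurableSet.univ
    (fun x _ => (Real.hasDerivAt_exp x).hasDerivWithinAt) Real.exp_injective.injOn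
    (fun t : ℝ => (t : ℂ)⁻¹ * h t)
  rw [Set.image_univ, Real.range_exp, setIntegral_univ] at this
  rw [this]
  congr 1; ext s
  have h1 : ((Real.exp s : ℝ) : ℂ) ≠ 0 := by exact_mod_cast (Real.exp_pos s).ne'
  rw [abs_of_pos (Real.exp_pos s), Complex.real_smul]
  field_simp

theorem integrable_comp_exp {h : ℝ → ℂ}
    (hh : IntegrableOn (fun t : ℝ => (t : ℂ)⁻¹ * h t) (Set.Ioi 0)) :
    Integrable fun s : ℝ => h (Real.exp s) := by
  have := integrableOn_image_iff_integrableOn_abs_deriv_smul (s := Set.univ) MeasurableSet.univ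
    (fun x _ => (Real.hasDerivAt_exp x).hasDerivWithinAt) Real.exp_injective.injOn
    (fun t : ℝ => (t : ℂ)⁻¹ * h t)
  rw [Set.image_univ, Real.range_exp, integrableOn_univ] at this
  refine (this.1 hh).congr (Eventually.of_forall fun s => ?_)
  have h1 : ((Real.exp s : ℝ) : ℂ) ≠ 0 := by exact_mod_cast (Real.exp_pos s).ne'
  simp only
  rw [abs_of_pos (Real.exp_pos s), Complex.real_smul]
  field_simp

/-- Cauchy's theorem for a sector: the integral against `dζ / ζ` over a ray is unchanged when the
ray sweeps out a sector where the integrand is holomorphic and decays at `0` and `∞`. -/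
theorem integral_ray_eq_of_differentiableAt {D : ℂ} {φ₁ φ₂ : ℝ} {F : ℂ → ℂ} {B₀ B₁ : ℝ → ℝ}
    (hF : ∀ t : ℝ, 0 < t → ∀ ψ ∈ Set.uIcc φ₁ φ₂, DifferentiableAt ℂ F (t * dir D ψ))
    (h1 : IntegrableOn (fun t : ℝ => (t : ℂ)⁻¹ * F (t * dir D φ₁)) (Set.Ioi 0))
    (h2 : IntegrableOn (fun t : ℝ => (t : ℂ)⁻¹ * F (t * dir D φ₂)) (Set.Ioi 0))
    (hB0 : ∀ᶠ t : ℝ in 𝓝[>] 0, ∀ ψ ∈ Set.uIcc φ₁ φ₂, ‖F (t * dir D ψ)‖ ≤ B₀ t)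
    (hB1 : ∀ᶠ t : ℝ in atTop, ∀ ψ ∈ Set.uIcc φ₁ φ₂, ‖F (t * dir D ψ)‖ ≤ B₁ t)
    (hB0' : Tendsto B₀ (𝓝[>] 0) (𝓝 0)) (hB1' : Tendsto B₁ atTop (𝓝 0)) :
    ∫ t in Set.Ioi (0 : ℝ), (t : ℂ)⁻¹ * F (t * dir D φ₁) =
      ∫ t in Set.Ioi (0 : ℝ), (t : ℂ)⁻¹ * F (t * dir D φ₂) := by
  rw [integral_inv_mul_eq, integral_inv_mul_eq]
  have i1 := integrable_comp_exp h1
  have i2 := integrable_comp_exp h2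
  -- In the coordinate `w = log (ζ / D)` the sector is a horizontal strip and `dζ / ζ` becomes `dw`.
  -- Cauchy's theorem on the rectangle `[-T, T] × [φ₁, φ₂]` applies, and its vertical sides vanish
  -- as `T → ∞`.
  set g : ℂ → ℂ := fun w => F (D * Complex.exp w) with hg
  have hgx : ∀ x y : ℝ, g (x + y * Complex.I) = F ((Real.exp x : ℝ) * dir D y) := by
    intro x y
    simp only [hg, dir, Complex.exp_add, Complex.ofReal_exp]
    congr 1; ring
  have key : ∀ T : ℝ, (((∫ x in (-T)..T, F ((Real.exp x : ℝ) * dir D φ₁)) -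
      ∫ x in (-T)..T, F ((Real.exp x : ℝ) * dir D φ₂)) +
      Complex.I • ∫ y in φ₁..φ₂, F ((Real.exp T : ℝ) * dir D y)) -
      Complex.I • ∫ y in φ₁..φ₂, F ((Real.exp (-T) : ℝ) * dir D y) = 0 := by
    intro T
    have := Complex.integral_boundary_rect_eq_zero_of_differentiableOn g
      (⟨-T, φ₁⟩ : ℂ) (⟨T, φ₂⟩ : ℂ) (fun w hw => ?_)
    · simpa only [hgx] using this
    · have h3 := hF (Real.exp w.re) (Real.exp_pos _) w.im hw.2
      have h4 : ((Real.exp w.re : ℝ) : ℂ) * dir D w.im = D * Complex.exp w := by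
        rw [dir, Complex.ofReal_exp, mul_left_comm, ← Complex.exp_add, Complex.re_add_im]
      rw [h4] at h3
      exact (h3.comp w (Complex.differentiableAt_exp.const_mul D)).differentiableWithinAt
  have side : ∀ r B : ℝ → ℝ, (∀ᶠ T in atTop, ∀ ψ ∈ Set.uIcc φ₁ φ₂,
      ‖F ((r T : ℝ) * dir D ψ)‖ ≤ B (r T)) → Tendsto (fun T => B (r T)) atTop (𝓝 0) →
      Tendsto (fun T => Complex.I • ∫ y in φ₁..φ₂, F ((r T : ℝ) * dir D y)) atTop (𝓝 0) := by
    intro r B hr hr'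
    rw [tendsto_zero_iff_norm_tendsto_zero]
    refine squeeze_zero' (Eventually.of_forall fun _ => norm_nonneg _) ?_
      (by simpa using hr'.mul_const |φ₂ - φ₁|)
    filter_upwards [hr] with T hT
    rw [norm_smul, Complex.norm_I, one_mul]
    exact intervalIntegral.norm_integral_le_of_norm_le_const fun y hy =>
      hT y (Set.uIoc_subset_uIcc hy)
  have s1 := side Real.exp B₁ (Real.tendsto_exp_atTop.eventually hB1)
    (hB1'.comp Real.tendsto_exp_atTop)
  have e2 : Tendsto (fun T : ℝ => Real.exp (-T)) atTop (𝓝[>] 0) :=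
    tendsto_nhdsWithin_iff.2 ⟨Real.tendsto_exp_neg_atTop_nhds_zero,
      Eventually.of_forall fun T => Real.exp_pos _⟩
  have s2 := side (fun T => Real.exp (-T)) B₀ (e2.eventually hB0) (hB0'.comp e2)
  have t1 := intervalIntegral_tendsto_integral i1 tendsto_neg_atTop_atBot tendsto_id
  have t2 := intervalIntegral_tendsto_integral i2 tendsto_neg_atTop_atBot tendsto_id
  have := ((t1.sub t2).add s1).sub s2
  simp only [id, key, add_zero, sub_zero] at this
  exact (sub_eq_zero.1 (tendsto_nhds_unique this tendsto_const_nhds))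

theorem tendsto_damping_zero {c : ℝ} (hc : 0 < c) (C : ℝ) :
    Tendsto (fun t => C * damping c t) (𝓝[>] 0) (𝓝 0) := by
  have : Tendsto (fun t : ℝ => -c * (t + t⁻¹)) (𝓝[>] 0) atBot := by
    refine Tendsto.const_mul_atTop_of_neg (by linarith) ?_
    refine tendsto_atTop_mono' _ ?_ tendsto_inv_nhdsGT_zero
    filter_upwards [self_mem_nhdsWithin] with t ht
    have : 0 < t := ht
    linarith
  simpa [damping] using (Real.tendsto_exp_atBot.comp this).const_mul C

theorem tendsto_damping_atTop {c : ℝ} (hc : 0 < c) (C : ℝ) :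
    Tendsto (fun t => C * damping c t) atTop (𝓝 0) := by
  have : Tendsto (fun t : ℝ => -c * (t + t⁻¹)) atTop atBot := by
    refine Tendsto.const_mul_atTop_of_neg (by linarith) ?_
    refine tendsto_atTop_mono' _ ?_ tendsto_id
    filter_upwards [eventually_gt_atTop 0] with t ht
    have : 0 < t⁻¹ := by positivity
    simp only [id]; linarith
  simpa [damping] using (Real.tendsto_exp_atBot.comp this).const_mul C

/-- The interval of angles is compact, so the real part of `ζ * conj d` attains its maximum over the
sector; it equals `‖ζ‖` only if `ζ` lies on the corresponding ray. -/
theorem exists_apart {D : ℂ} (hD : ‖D‖ = 1) {φ₁ φ₂ : ℝ} {ζ : ℂ} (hζ : ζ ≠ 0)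
    (h : ∀ ψ ∈ Set.uIcc φ₁ φ₂, ∀ t : ℝ, 0 < t → ζ ≠ t * dir D ψ) :
    ∃ k : ℝ, 0 ≤ k ∧ k < 1 ∧ ∀ ψ ∈ Set.uIcc φ₁ φ₂, Apart k ζ (dir D ψ) := by
  have hr : 0 < ‖ζ‖ := norm_pos_iff.2 hζ
  obtain ⟨ψ₀, hψ₀, hmax⟩ := (isCompact_uIcc (a := φ₁) (b := φ₂)).exists_isMaxOn
    Set.nonempty_uIcc (f := fun ψ => (ζ * (starRingEnd ℂ) (dir D ψ)).re)
    (by have := continuous_dir D; fun_prop)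
  have hn : ∀ ψ, ‖ζ * (starRingEnd ℂ) (dir D ψ)‖ = ‖ζ‖ := fun ψ => by
    rw [norm_mul, Complex.norm_conj, norm_dir, hD, mul_one]
  have hlt : (ζ * (starRingEnd ℂ) (dir D ψ₀)).re < ‖ζ‖ := by
    refine lt_of_le_of_ne ((Complex.re_le_norm _).trans (hn ψ₀).le) fun he => ?_
    have h1 : (ζ * (starRingEnd ℂ) (dir D ψ₀)) = (‖ζ‖ : ℂ) := by
      rw [← hn ψ₀]
      exact Complex.eq_coe_norm_of_nonneg (Complex.re_eq_norm.1 (he.trans (hn ψ₀).symm))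
    refine h ψ₀ hψ₀ ‖ζ‖ hr ?_
    rw [← h1, mul_assoc, mul_comm ((starRingEnd ℂ) _), Complex.mul_conj, Complex.normSq_eq_norm_sq,
      norm_dir, hD]
    simp
  set m := (ζ * (starRingEnd ℂ) (dir D ψ₀)).re
  have hm : m / ‖ζ‖ < 1 := (div_lt_one hr).2 hlt
  obtain ⟨k, hk1, hk2⟩ := exists_between (max_lt hm zero_lt_one)
  refine ⟨k, (le_max_right _ _).trans hk1.le, hk2, fun ψ hψ => ?_⟩
  have h3 : m < k * ‖ζ‖ := (div_lt_iff₀ hr).1 ((le_max_left _ _).trans_lt hk1)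
  exact (hmax hψ).trans_lt h3

/-- `g` is holomorphic near the sector `φ₁ ≤ φ ≤ φ₂` around `D`, with bound `C * damping c`. -/
structure SectorDamped (C c : ℝ) (D : ℂ) (φ₁ φ₂ : ℝ) (Ω : Set ℂ) (g : ℂ → ℂ) : Prop where
  isOpen : IsOpen Ω
  diff : DifferentiableOn ℂ g Ω
  mem : ∀ t : ℝ, 0 < t → ∀ ψ ∈ Set.uIcc φ₁ φ₂, (t : ℂ) * dir D ψ ∈ Ω
  bound : ∀ t : ℝ, 0 < t → ∀ ψ ∈ Set.uIcc φ₁ φ₂, ‖g (t * dir D ψ)‖ ≤ C * damping c t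

section

variable {C c : ℝ} {D : ℂ} {φ₁ φ₂ : ℝ} {Ω : Set ℂ} {g : ℂ → ℂ}

theorem SectorDamped.damped (h : SectorDamped C c D φ₁ φ₂ Ω g) {ψ : ℝ}
    (hψ : ψ ∈ Set.uIcc φ₁ φ₂) : Damped C c (dir D ψ) g where
  meas := (h.diff.continuousOn.comp (by fun_prop) fun t ht => h.mem t ht ψ hψ).aestronglyMeasurable
    measurableSet_Ioi
  bound t ht := h.bound t ht ψ hψ

theorem SectorDamped.mono (h : SectorDamped C c D φ₁ φ₂ Ω g) {φ₃ φ₄ : ℝ}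
    (h3 : φ₃ ∈ Set.uIcc φ₁ φ₂) (h4 : φ₄ ∈ Set.uIcc φ₁ φ₂) : SectorDamped C c D φ₃ φ₄ Ω g :=
  have hs := Set.uIcc_subset_uIcc h3 h4
  ⟨h.isOpen, h.diff, fun t ht ψ hψ => h.mem t ht ψ (hs hψ),
    fun t ht ψ hψ => h.bound t ht ψ (hs hψ)⟩

/-- The only pole of the kernel is at `ζ`, outside the closed sector, and damping kills the
integrand at `0` and `∞`. -/
theorem SectorDamped.cauchyTransform_eq (h : SectorDamped C c D φ₁ φ₂ Ω g) (hc : 0 < c)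
    (hD : ‖D‖ = 1) {ζ : ℂ} (hζ0 : ζ ≠ 0)
    (hζ : ∀ ψ ∈ Set.uIcc φ₁ φ₂, ∀ t : ℝ, 0 < t → ζ ≠ t * dir D ψ) :
    cauchyTransform (dir D φ₁) g ζ = cauchyTransform (dir D φ₂) g ζ := by
  obtain ⟨k, hk0, hk1, hk⟩ := exists_apart hD hζ0 hζ
  have hd : ∀ ψ, ‖dir D ψ‖ = 1 := fun ψ => (norm_dir D ψ).trans hD
  have hb : ∀ t : ℝ, 0 < t → ∀ ψ ∈ Set.uIcc φ₁ φ₂,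
      ‖(t * dir D ψ + ζ) / (t * dir D ψ - ζ) * g (t * dir D ψ)‖ ≤
        2 / (1 - k) * C * damping c t := by
    intro t ht ψ hψ
    have h1 := (hk ψ hψ).norm_kernel_le hk0 hk1 (hd ψ) ht
    have h2 := h.bound t ht ψ hψ
    rw [norm_mul, mul_assoc]
    have : 0 ≤ 2 / (1 - k) := div_nonneg zero_le_two (by linarith)
    gcongr
  refine integral_ray_eq_of_differentiableAt (F := fun z => (z + ζ) / (z - ζ) * g z)
    (B₀ := fun t => 2 / (1 - k) * C * damping c t)
    (B₁ := fun t => 2 / (1 - k) * C * damping c t)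
    (fun t ht ψ hψ => ?_)
    (integrableOn_integrand hc hk0 hk1 (hd _) (h.damped Set.left_mem_uIcc)
      (hk _ Set.left_mem_uIcc))
    (integrableOn_integrand hc hk0 hk1 (hd _) (h.damped Set.right_mem_uIcc)
      (hk _ Set.right_mem_uIcc)) ?_ ?_
    (tendsto_damping_zero hc _) (tendsto_damping_atTop hc _)
  · have h0 := (hk ψ hψ).sub_ne_zero hk0 hk1 (hd ψ) ht
    have := h.diff.differentiableAt (h.isOpen.mem_nhds (h.mem t ht ψ hψ))
    fun_prop (disch := assumption)
  · filter_upwards [self_mem_nhdsWithin] with t ht using hb t ht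
  · filter_upwards [eventually_gt_atTop 0] with t ht using hb t ht

end

/-! ### The jump of the Cauchy transform across a contour. -/

theorem integrableOn_div_sq_sub_sq {q : ℂ} (hq : q.im ≠ 0) :
    IntegrableOn (fun t : ℝ => q / ((t - q) * (t + q))) (Set.Ioi 0) := by
  have hq0 : q ≠ 0 := by rintro rfl; simp at hq
  have hr : 0 < ‖q‖ := norm_pos_iff.2 hq0
  obtain ⟨k, hk1, hk2⟩ := exists_between ((div_lt_one hr).2 (Complex.abs_re_lt_norm.2 hq))
  have hk0 : 0 ≤ k := le_trans (by positivity) hk1.le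
  have h3 : |q.re| < k * ‖q‖ := (div_lt_iff₀ hr).1 hk1
  have a1 : Apart k q 1 := by simp [Apart]; linarith [le_abs_self q.re]
  have a2 : Apart k (-q) 1 := by simp [Apart]; linarith [neg_le_abs q.re]
  set m := (1 - k) / 2 with hm
  have hm0 : 0 < m := by rw [hm]; linarith
  set e := min 1 (‖q‖ ^ 2)
  have he : 0 < e := by positivity
  refine Integrable.mono' ((integrable_inv_one_add_sq.const_mul (‖q‖ / (m ^ 2 * e))).restrict)
    (Measurable.aestronglyMeasurable (by fun_prop)) ?_
  filter_upwards [ae_restrict_mem measurableSet_Ioi] with t ht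
  have ht' : 0 < t := ht
  have b1 := a1.norm_sub_ge hk0 hk2 (by simp) ht'
  have b2 := a2.norm_sub_ge hk0 hk2 (by simp) ht'
  rw [mul_one] at b1 b2
  rw [sub_neg_eq_add, norm_neg] at b2
  have b3 : m ^ 2 * e * (1 + t ^ 2) ≤ ‖(t - q) * (t + q)‖ := by
    rw [norm_mul]
    calc m ^ 2 * e * (1 + t ^ 2) ≤ m ^ 2 * (t + ‖q‖) ^ 2 := by
          rw [mul_assoc]
          gcongr
          have e1 : e ≤ 1 := min_le_left _ _
          have e2 : e ≤ ‖q‖ ^ 2 := min_le_right _ _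
          nlinarith [mul_pos ht' hr, sq_nonneg t]
      _ = (m * (t + ‖q‖)) * (m * (t + ‖q‖)) := by ring
      _ ≤ _ := by gcongr
  rw [norm_div]
  calc ‖q‖ / ‖(t - q) * (t + q)‖ ≤ ‖q‖ / (m ^ 2 * e * (1 + t ^ 2)) := by gcongr
    _ = _ := by field_simp

/-- An antiderivative is `1/2 * log (i (t - q)/(t + q))`. The factor `i` places the curve in the
right half-plane for `t > 0`, running from `-i` at `t = 0` to `i` at infinity, so the principal
branch suffices and the change of argument is `π`. -/
theorem integral_div_sq_sub_sq {q : ℂ} (hq : 0 < q.im) :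
    ∫ t in Set.Ioi (0 : ℝ), q / ((t - q) * (t + q)) = Complex.I * (Real.pi / 2) := by
  have hne1 : ∀ t : ℝ, (t : ℂ) - q ≠ 0 := fun t h => by
    have := congrArg Complex.im h; simp at this; linarith
  have hne2 : ∀ t : ℝ, (t : ℂ) + q ≠ 0 := fun t h => by
    have := congrArg Complex.im h; simp at this; linarith
  have hslit : ∀ t : ℝ, 0 ≤ t → Complex.I * ((t - q) / (t + q)) ∈ Complex.slitPlane := by
    intro t ht
    have hn : 0 < Complex.normSq (t + q) := Complex.normSq_pos.2 (hne2 t)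
    rcases ht.eq_or_lt with rfl | ht
    · right
      have hq0 : q ≠ 0 := by rintro rfl; simp at hq
      simp [neg_div, div_self hq0]
    · left
      rw [Complex.I_mul_re, Complex.div_im]
      simp only [Complex.sub_im, Complex.sub_re, Complex.add_re, Complex.add_im,
        Complex.ofReal_re, Complex.ofReal_im]
      rw [neg_pos, ← sub_div]
      refine div_neg_of_neg_of_pos ?_ hn
      nlinarith [mul_pos ht hq]
  have hder : ∀ t : ℝ, 0 ≤ t → HasDerivAt
      (fun t : ℝ => 1 / 2 * Complex.log (Complex.I * ((t - q) / (t + q))))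
      (q / ((t - q) * (t + q))) t := by
    intro t ht
    have o := Complex.ofRealCLM.hasDerivAt (x := t)
    have h1 := ((((o.sub_const q).fun_div (o.add_const q) (hne2 t)).const_mul Complex.I).clog_real
      (hslit t ht)).const_mul (1 / 2 : ℂ)
    refine h1.congr_deriv ?_
    have := hne1 t
    have := hne2 t
    simp only [Complex.ofRealCLM_apply, Complex.ofReal_one]
    field_simp
    ring
  have hlim : Tendsto (fun t : ℝ => 1 / 2 * Complex.log (Complex.I * ((t - q) / (t + q)))) atTop
      (𝓝 (1 / 2 * Complex.log Complex.I)) := by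
    have h1 : Tendsto (fun t : ℝ => (t - q) / (t + q)) atTop (𝓝 1) := by
      have h2 : Tendsto (fun t : ℝ => q * (t : ℂ)⁻¹) atTop (𝓝 0) := by
        have : Tendsto (fun t : ℝ => ((t⁻¹ : ℝ) : ℂ)) atTop (𝓝 0) := by
          have := (Complex.continuous_ofReal.tendsto 0).comp tendsto_inv_atTop_zero
          simpa [Function.comp_def] using this
        simpa using this.const_mul q
      have h3 : Tendsto (fun t : ℝ => (1 - q * (t : ℂ)⁻¹) / (1 + q * (t : ℂ)⁻¹)) atTop
          (𝓝 ((1 - 0) / (1 + 0))) :=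
        (tendsto_const_nhds.sub h2).div (tendsto_const_nhds.add h2) (by simp)
      rw [sub_zero, add_zero, div_one] at h3
      refine h3.congr' ?_
      filter_upwards [eventually_gt_atTop 0] with t ht
      have : (t : ℂ) ≠ 0 := by exact_mod_cast ht.ne'
      rw [← mul_div_mul_left (1 - q * (t : ℂ)⁻¹) (1 + q * (t : ℂ)⁻¹) this]
      congr 1 <;> field_simp
    have h4 := (h1.const_mul Complex.I)
    rw [mul_one] at h4
    exact ((h4.clog (by right; simp))).const_mul _
  rw [integral_Ioi_of_hasDerivAt_of_tendsto (hder 0 le_rfl).continuousAt.continuousWithinAt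
    (fun t ht => hder t (le_of_lt ht)) (integrableOn_div_sq_sub_sq hq.ne') hlim]
  have hq0 : q ≠ 0 := by rintro rfl; simp at hq
  simp [neg_div, div_self hq0, Complex.log_I, Complex.log_neg_I]
  ring

/-- A function with value `1/4` at `ζ` whose Cauchy transform at `ζ` is explicit. -/
noncomputable def bump (ζ z : ℂ) : ℂ := ζ * z / (z + ζ) ^ 2

/-- One factor `z + ζ` cancels against the kernel, which leaves the rational integrand evaluated
above with `q = ζ / d`. The sign of the transform therefore depends only on the side of the ray on
which `ζ` lies. -/
theorem bump_integrand {ζ d : ℂ} (hd : d ≠ 0) (t : ℝ) (ht : t ≠ 0) :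
    (t : ℂ)⁻¹ * ((t * d + ζ) / (t * d - ζ) * bump ζ (t * d)) =
      ζ / d / ((t - ζ / d) * (t + ζ / d)) := by
  have ht' : (t : ℂ) ≠ 0 := by exact_mod_cast ht
  have e1 : (t : ℂ) * d - ζ = d * (t - ζ / d) := by field_simp
  have e2 : (t : ℂ) * d + ζ = d * (t + ζ / d) := by field_simp
  have e3 : ζ = d * (ζ / d) := by field_simp
  rw [bump, e1, e2]
  generalize ζ / d = q at *
  subst e3
  by_cases h1 : (t : ℂ) - q = 0
  · simp [h1]
  by_cases h2 : (t : ℂ) + q = 0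
  · simp [h2]
  field_simp

theorem integrableOn_bump {ζ d : ℂ} (hd : d ≠ 0) (h : (ζ / d).im ≠ 0) :
    IntegrableOn (fun t : ℝ => (t : ℂ)⁻¹ * ((t * d + ζ) / (t * d - ζ) * bump ζ (t * d)))
      (Set.Ioi 0) :=
  (integrableOn_div_sq_sub_sq h).congr_fun
    (fun t ht => (bump_integrand hd t (Set.mem_Ioi.1 ht).ne').symm) measurableSet_Ioi

theorem cauchyTransform_bump_of_pos {ζ d : ℂ} (hd : d ≠ 0) (h : 0 < (ζ / d).im) :
    cauchyTransform d (bump ζ) ζ = Complex.I * (Real.pi / 2) := by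
  rw [← integral_div_sq_sub_sq h]
  exact setIntegral_congr_fun measurableSet_Ioi
    fun t ht => bump_integrand hd t (Set.mem_Ioi.1 ht).ne'

theorem cauchyTransform_bump_of_neg {ζ d : ℂ} (hd : d ≠ 0) (h : (ζ / d).im < 0) :
    cauchyTransform d (bump ζ) ζ = -(Complex.I * (Real.pi / 2)) := by
  rw [← integral_div_sq_sub_sq (q := -(ζ / d)) (by simpa using h), ← integral_neg]
  refine setIntegral_congr_fun measurableSet_Ioi fun t ht => ?_
  rw [bump_integrand hd t (Set.mem_Ioi.1 ht).ne', sub_neg_eq_add, ← sub_eq_add_neg, neg_div, neg_neg,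
    mul_comm ((t : ℂ) - _)]

theorem dir_div_dir {D : ℂ} (hD : D ≠ 0) (φ ψ : ℝ) :
    dir D φ / dir D ψ = Complex.exp ((φ - ψ : ℝ) * Complex.I) := by
  rw [dir, dir, mul_div_mul_left _ _ hD, ← Complex.exp_sub]
  congr 1; push_cast; ring

theorem smul_dir_div_dir_im {D : ℂ} (hD : D ≠ 0) (τ φ ψ : ℝ) :
    ((τ : ℂ) * dir D φ / dir D ψ).im = τ * Real.sin (φ - ψ) := by
  rw [mul_div_assoc, dir_div_dir hD, Complex.im_ofReal_mul, Complex.exp_ofReal_mul_I_im]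

theorem smul_dir_ne {D : ℂ} (hD : D ≠ 0) {τ t φ ψ : ℝ} (hτ : 0 < τ) (h1 : φ ≠ ψ)
    (h2 : |φ - ψ| ≤ 1) : (τ : ℂ) * dir D φ ≠ t * dir D ψ := by
  have hψ : dir D ψ ≠ 0 := mul_ne_zero hD (Complex.exp_ne_zero _)
  intro h
  have h3 := congrArg (fun z => (z / dir D ψ).im) h
  simp only [smul_dir_div_dir_im hD, sub_self, Real.sin_zero, mul_zero] at h3
  have h4 : Real.sin (φ - ψ) = 0 := (mul_eq_zero.1 h3).resolve_left hτ.ne'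
  have := Real.pi_gt_three
  rw [abs_le] at h2
  rw [Real.sin_eq_zero_iff_of_lt_of_lt (by linarith) (by linarith)] at h4
  exact h1 (sub_eq_zero.1 h4)

theorem smul_dir_add_ne {D : ℂ} (hD : D ≠ 0) {τ t φ ψ : ℝ} (hτ : 0 < τ) (ht : 0 < t)
    (h2 : |φ - ψ| ≤ 1) : (t : ℂ) * dir D ψ + τ * dir D φ ≠ 0 := by
  have hψ : dir D ψ ≠ 0 := mul_ne_zero hD (Complex.exp_ne_zero _)
  intro h
  have h3 := congrArg (fun z => (z / dir D ψ).re) h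
  simp only [add_div, mul_div_assoc, dir_div_dir hD, Complex.add_re, Complex.re_ofReal_mul,
    Complex.exp_ofReal_mul_I_re, sub_self, Real.cos_zero, zero_div, Complex.zero_re] at h3
  rw [abs_le] at h2
  have := Real.pi_gt_three
  have := Real.cos_pos_of_mem_Ioo (x := φ - ψ) ⟨by linarith, by linarith⟩
  nlinarith [mul_pos hτ this]

variable {C c : ℝ} {D : ℂ} {φ₁ φ₂ : ℝ} {Ω : Set ℂ} {g : ℂ → ℂ}

theorem norm_bump_le {ζ z : ℂ} {m : ℝ} (hm : 0 < m) (h : m ≤ |‖z‖ - ‖ζ‖|) :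
    ‖bump ζ z‖ ≤ ‖ζ‖ * ‖z‖ / m ^ 2 := by
  have h1 : |‖z‖ - ‖ζ‖| ≤ ‖z + ζ‖ := by
    have := abs_norm_sub_norm_le z (-ζ)
    rwa [norm_neg, sub_neg_eq_add] at this
  rw [bump, norm_div, norm_mul, norm_pow]
  have := h.trans h1
  gcongr

theorem norm_kernel_le_three {ζ z : ℂ} {m : ℝ} (hm : 0 < m) (h : m ≤ |‖z‖ - ‖ζ‖|)
    (h3 : ‖z‖ + ‖ζ‖ ≤ 3 * m) : ‖(z + ζ) / (z - ζ)‖ ≤ 3 := by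
  have h1 : m ≤ ‖z - ζ‖ := h.trans (abs_norm_sub_norm_le z ζ)
  rw [norm_div, div_le_iff₀ (by linarith)]
  have := norm_add_le z ζ
  linarith

/-- The jump of the Cauchy transform: when the ray sweeps across `ζ`, the integral changes by
`4 π i g ζ`. -/
theorem SectorDamped.cauchyTransform_sub (h : SectorDamped C c D φ₁ φ₂ Ω g) (hc : 0 < c)
    (hD : ‖D‖ = 1) {τ ψ₀ : ℝ} (hτ : 0 < τ) (h₁ : φ₁ < ψ₀) (h₂ : ψ₀ < φ₂) (h₁₂ : φ₂ - φ₁ ≤ 1) :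
    cauchyTransform (dir D φ₁) g (τ * dir D ψ₀) - cauchyTransform (dir D φ₂) g (τ * dir D ψ₀) =
      4 * Real.pi * Complex.I * g (τ * dir D ψ₀) := by
  have hD0 : D ≠ 0 := by rintro rfl; simp at hD
  have hle : φ₁ ≤ φ₂ := (h₁.trans h₂).le
  have hdn : ∀ ψ, ‖dir D ψ‖ = 1 := fun ψ => (norm_dir D ψ).trans hD
  have hd0 : ∀ ψ, dir D ψ ≠ 0 := fun ψ => norm_pos_iff.1 (by rw [hdn]; norm_num)
  have hpi := Real.pi_gt_three
  set ζ : ℂ := τ * dir D ψ₀ with hζ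
  have hζn : ‖ζ‖ = τ := by rw [hζ, norm_mul, hdn, Complex.norm_of_nonneg hτ.le, mul_one]
  have hζ0 : ζ ≠ 0 := norm_pos_iff.1 (by rw [hζn]; exact hτ)
  have hζΩ : ζ ∈ Ω := h.mem τ hτ ψ₀ (by rw [Set.uIcc_of_le hle]; exact ⟨h₁.le, h₂.le⟩)
  -- Subtracting `4 g(ζ)` times the bump makes the density vanish at `ζ`, so its product with the
  -- kernel extends holomorphically across `ζ` (through `dslope`) and its integral does not change
  -- under the rotation. The whole jump is that of the bump, `4 g(ζ) (iπ/2 + iπ/2)`.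
  set P : ℂ → ℂ := fun z => g z - 4 * g ζ * bump ζ z with hP
  have hPζ : P ζ = 0 := by
    have : bump ζ ζ = 1 / 4 := by unfold bump; field_simp; norm_num
    simp only [hP, this]; ring
  set F : ℂ → ℂ := fun z => (z + ζ) * dslope P ζ z with hF
  have hFne : ∀ z, z ≠ ζ → F z = (z + ζ) / (z - ζ) * P z := fun z hz => by
    simp only [hF]
    rw [dslope_of_ne _ hz, slope_def_field, hPζ, sub_zero]
    ring
  have hΩ' : IsOpen (Ω \ {-ζ}) := h.isOpen.sdiff isClosed_singleton
  have hζ' : ζ ∈ Ω \ {-ζ} := ⟨hζΩ, fun h' => hζ0 (self_eq_neg.1 h')⟩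
  have hPd : DifferentiableOn ℂ P (Ω \ {-ζ}) := by
    intro z hz
    have h1 : z + ζ ≠ 0 := fun h' => hz.2 (eq_neg_of_add_eq_zero_left h')
    have h1' : (z + ζ) ^ 2 ≠ 0 := pow_ne_zero 2 h1
    have h2 := h.diff.differentiableAt (h.isOpen.mem_nhds hz.1)
    refine DifferentiableAt.differentiableWithinAt ?_
    simp only [hP, bump]
    fun_prop (disch := assumption)
  have hFd : DifferentiableOn ℂ F (Ω \ {-ζ}) :=
    (differentiableOn_id.add_const ζ).mul
      ((Complex.differentiableOn_dslope (hΩ'.mem_nhds hζ')).2 hPd)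
  have hab : ∀ ψ ∈ Set.uIcc φ₁ φ₂, |ψ₀ - ψ| ≤ 1 := fun ψ hψ => by
    rw [Set.uIcc_of_le hle] at hψ
    rw [abs_le]; constructor <;> linarith [hψ.1, hψ.2]
  -- The pole of the bump at `-ζ` is outside the sector because the sector contains the direction of
  -- `ζ` and has opening at most 1, less than a right angle.
  have hmemF : ∀ t : ℝ, 0 < t → ∀ ψ ∈ Set.uIcc φ₁ φ₂, (t : ℂ) * dir D ψ ∈ Ω \ {-ζ} :=
    fun t ht ψ hψ => ⟨h.mem t ht ψ hψ, fun h' => smul_dir_add_ne hD0 hτ ht (hab ψ hψ)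
      (by rw [Set.mem_singleton_iff] at h'; rw [h', ← hζ]; ring)⟩
  have hray : ∀ ψ ∈ Set.uIcc φ₁ φ₂, ψ₀ ≠ ψ → ∀ t : ℝ, (t : ℂ) * dir D ψ ≠ ζ :=
    fun ψ hψ hne t h' => smul_dir_ne hD0 hτ hne (hab ψ hψ) h'.symm
  have hnt : ∀ t : ℝ, 0 < t → ∀ ψ, ‖(t : ℂ) * dir D ψ‖ = t := fun t ht ψ => by
    rw [norm_mul, hdn, Complex.norm_of_nonneg ht.le, mul_one]
  have hsplit : ∀ ψ ∈ Set.uIcc φ₁ φ₂, ψ₀ ≠ ψ → (ζ / dir D ψ).im ≠ 0 →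
      IntegrableOn (fun t : ℝ => (t : ℂ)⁻¹ * F (t * dir D ψ)) (Set.Ioi 0) ∧
      ∫ t in Set.Ioi (0 : ℝ), (t : ℂ)⁻¹ * F (t * dir D ψ) =
        cauchyTransform (dir D ψ) g ζ - 4 * g ζ * cauchyTransform (dir D ψ) (bump ζ) ζ := by
    intro ψ hψ hne him
    obtain ⟨k, hk0, hk1, hk⟩ := exists_apart (φ₁ := ψ) (φ₂ := ψ) hD hζ0 (fun ψ' hψ' t _ => by
      rw [Set.uIcc_self, Set.mem_singleton_iff] at hψ'
      subst hψ'; exact (hray _ hψ hne t).symm)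
    have i1 := integrableOn_integrand hc hk0 hk1 (hdn ψ) (h.damped hψ) (hk ψ (by simp))
    have i2 := (integrableOn_bump (hd0 ψ) him).const_mul (4 * g ζ)
    have e : ∀ t : ℝ, (t : ℂ)⁻¹ * F (t * dir D ψ) =
        (t : ℂ)⁻¹ * ((t * dir D ψ + ζ) / (t * dir D ψ - ζ) * g (t * dir D ψ)) -
        4 * g ζ * ((t : ℂ)⁻¹ * ((t * dir D ψ + ζ) / (t * dir D ψ - ζ) *
          bump ζ (t * dir D ψ))) := fun t => by
      rw [hFne _ (hray ψ hψ hne t), hP]; ring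
    simp_rw [e]
    refine ⟨i1.sub i2, ?_⟩
    rw [integral_sub i1 i2, integral_const_mul]
    rfl
  have him1 : 0 < (ζ / dir D φ₁).im := by
    rw [hζ, smul_dir_div_dir_im hD0]
    exact mul_pos hτ (Real.sin_pos_of_pos_of_lt_pi (by linarith) (by linarith))
  have him2 : (ζ / dir D φ₂).im < 0 := by
    rw [hζ, smul_dir_div_dir_im hD0]
    exact mul_neg_of_pos_of_neg hτ (Real.sin_neg_of_neg_of_neg_pi_lt (by linarith) (by linarith))
  obtain ⟨j1, e1⟩ := hsplit φ₁ Set.left_mem_uIcc h₁.ne' him1.ne'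
  obtain ⟨j2, e2⟩ := hsplit φ₂ Set.right_mem_uIcc h₂.ne him2.ne
  -- `m` bounds the distance between the moduli of `z` and `ζ` from below. It is taken as `τ/2` near
  -- `0` and as `t/2` near infinity; in both cases `t + τ ≤ 3 m` bounds the kernel by 3.
  have hbd : ∀ m t : ℝ, 0 < m → 0 < t → m ≤ |t - τ| → t + τ ≤ 3 * m → ∀ ψ ∈ Set.uIcc φ₁ φ₂,
      ‖F (t * dir D ψ)‖ ≤ 3 * (C * damping c t + 4 * ‖g ζ‖ * (τ * t / m ^ 2)) := by
    intro m t hm ht hm1 hm2 ψ hψ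
    have hn := hnt t ht ψ
    have hm1' : m ≤ |‖(t : ℂ) * dir D ψ‖ - ‖ζ‖| := by rwa [hn, hζn]
    have hne : (t : ℂ) * dir D ψ ≠ ζ := fun h' => by
      rw [h', sub_self, abs_zero] at hm1'; linarith
    have b1 := norm_kernel_le_three hm hm1' (by rwa [hn, hζn])
    have b2 := norm_bump_le hm hm1'
    rw [hn, hζn] at b2
    have b3 := h.bound t ht ψ hψ
    rw [hFne _ hne, norm_mul]
    gcongr
    refine (norm_sub_le _ _).trans ?_
    rw [norm_mul, norm_mul, Complex.norm_ofNat]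
    gcongr
  have := integral_ray_eq_of_differentiableAt (F := F)
    (B₀ := fun t => 3 * (C * damping c t + 4 * ‖g ζ‖ * (τ * t / (τ / 2) ^ 2)))
    (B₁ := fun t => 3 * (C * damping c t + 4 * ‖g ζ‖ * (τ * t / (t / 2) ^ 2)))
    (fun t ht ψ hψ => hFd.differentiableAt (hΩ'.mem_nhds (hmemF t ht ψ hψ))) j1 j2 ?_ ?_ ?_ ?_
  · rw [e1, e2, cauchyTransform_bump_of_pos (hd0 _) him1,
      cauchyTransform_bump_of_neg (hd0 _) him2] at this
    linear_combination this
  · filter_upwards [Ioo_mem_nhdsGT (half_pos hτ)] with t ht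
    refine hbd (τ / 2) t (by linarith) ht.1 ?_ (by linarith [ht.2])
    rw [abs_sub_comm]
    exact le_trans (by linarith [ht.2]) (le_abs_self _)
  · filter_upwards [eventually_gt_atTop (2 * τ)] with t ht
    exact hbd (t / 2) t (by linarith) (by linarith) (le_trans (by linarith) (le_abs_self _))
      (by linarith)
  · have h1 : Tendsto (fun t : ℝ => 4 * ‖g ζ‖ * (τ * t / (τ / 2) ^ 2)) (𝓝[>] 0) (𝓝 0) := by
      have : Continuous fun t : ℝ => 4 * ‖g ζ‖ * (τ * t / (τ / 2) ^ 2) := by fun_prop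
      have := (this.tendsto 0).mono_left (nhdsWithin_le_nhds (s := Set.Ioi 0))
      simpa using this
    simpa using ((tendsto_damping_zero hc C).add h1).const_mul 3
  · have h1 : Tendsto (fun t : ℝ => 4 * ‖g ζ‖ * (τ * t / (t / 2) ^ 2)) atTop (𝓝 0) := by
      have h2 : Tendsto (fun t : ℝ => 4 * ‖g ζ‖ * (4 * τ) * t⁻¹) atTop (𝓝 0) := by
        simpa using tendsto_inv_atTop_zero.const_mul (4 * ‖g ζ‖ * (4 * τ))
      refine h2.congr' ?_
      filter_upwards [eventually_gt_atTop 0] with t ht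
      field_simp
      ring
    simpa using ((tendsto_damping_atTop hc C).add h1).const_mul 3

/-! ### From integrals over BPS rays to integrals over unit directions. -/

/-- The direction of the BPS ray `ℓ_γ`. -/
noncomputable def rayDir (Z : Charge →+ ℂ) (γ : Charge) : ℂ := -(Z γ / ‖Z γ‖)

theorem norm_rayDir {Z : Charge →+ ℂ} {γ : Charge} (h : Z γ ≠ 0) : ‖rayDir Z γ‖ = 1 := by
  have : ‖Z γ‖ ≠ 0 := norm_ne_zero_iff.2 h
  rw [rayDir, norm_neg, norm_div, Complex.norm_real, norm_norm, div_self this]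

theorem neg_smul_eq_rayDir {Z : Charge →+ ℂ} {γ : Charge} (h : Z γ ≠ 0) (t : ℝ) :
    -(t : ℂ) * Z γ = ((‖Z γ‖ * t : ℝ) : ℂ) * rayDir Z γ := by
  have : (‖Z γ‖ : ℂ) ≠ 0 := by exact_mod_cast norm_ne_zero_iff.2 h
  rw [rayDir]; push_cast; field_simp

theorem mem_bpsRay_iff {Z : Charge →+ ℂ} {γ : Charge} (h : Z γ ≠ 0) {ζ : ℂ} :
    ζ ∈ bpsRay Z γ ↔ ∃ t : ℝ, 0 < t ∧ ζ = t * rayDir Z γ := by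
  have hn : 0 < ‖Z γ‖ := norm_pos_iff.2 h
  constructor
  · rintro ⟨t, ht, rfl⟩
    exact ⟨_, mul_pos hn ht, neg_smul_eq_rayDir h t⟩
  · rintro ⟨t, ht, rfl⟩
    refine ⟨t / ‖Z γ‖, by positivity, ?_⟩
    rw [neg_smul_eq_rayDir h, mul_div_cancel₀ _ hn.ne']

theorem rayIntegrand_eq {Z : Charge →+ ℂ} {γ : Charge} (h : Z γ ≠ 0) (F : ℂ → ℂ) (t : ℝ) :
    (t : ℂ)⁻¹ * F (-(t : ℂ) * Z γ) =
      ‖Z γ‖ * (((‖Z γ‖ * t : ℝ) : ℂ)⁻¹ * F (((‖Z γ‖ * t : ℝ) : ℂ) * rayDir Z γ)) := by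
  have : (‖Z γ‖ : ℂ) ≠ 0 := by exact_mod_cast norm_ne_zero_iff.2 h
  rw [neg_smul_eq_rayDir h]; push_cast
  rw [mul_inv, ← mul_assoc, ← mul_assoc, mul_inv_cancel₀ this, one_mul]

/-- The measure `dζ' / ζ'` is invariant under scaling, so the modulus of `Z γ` drops out. -/
theorem rayIntegral_eq {Z : Charge →+ ℂ} {γ : Charge} (h : Z γ ≠ 0) (F : ℂ → ℂ) :
    rayIntegral Z γ F = ∫ t in Set.Ioi (0 : ℝ), (t : ℂ)⁻¹ * F (t * rayDir Z γ) := by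
  have hn : 0 < ‖Z γ‖ := norm_pos_iff.2 h
  have hn' : (‖Z γ‖ : ℂ) ≠ 0 := by exact_mod_cast hn.ne'
  unfold rayIntegral
  simp_rw [rayIntegrand_eq h]
  rw [integral_const_mul, integral_comp_mul_left_Ioi
    (fun t : ℝ => (t : ℂ)⁻¹ * F (t * rayDir Z γ)) 0 hn, mul_zero, Complex.real_smul, Complex.ofReal_inv,
    mul_inv_cancel_left₀ hn']

theorem rayIntegrable_iff {Z : Charge →+ ℂ} {γ : Charge} (h : Z γ ≠ 0) (F : ℂ → ℂ) :
    RayIntegrable Z γ F ↔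
      IntegrableOn (fun t : ℝ => (t : ℂ)⁻¹ * F (t * rayDir Z γ)) (Set.Ioi 0) := by
  have hn : 0 < ‖Z γ‖ := norm_pos_iff.2 h
  have hn' : (‖Z γ‖ : ℂ) ≠ 0 := by exact_mod_cast hn.ne'
  unfold RayIntegrable
  simp_rw [rayIntegrand_eq h]
  have := integrableOn_Ioi_comp_mul_left_iff
    (fun t : ℝ => (t : ℂ)⁻¹ * F (t * rayDir Z γ)) 0 hn
  rw [mul_zero] at this
  rw [← this]
  exact integrable_const_mul_iff (IsUnit.mk0 _ hn') _

theorem iterStep_eq_contourStep {R : ℝ} {Z : Charge →+ ℂ} {Ω : Charge → ℤ} {θ : TwistedCharacter}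
    {G : Finset Charge} (hΩ : ∀ γ, Ω γ = if γ ∈ G then 1 else 0) (hZ : ∀ γ ∈ G, Z γ ≠ 0) :
    iterStep R Z Ω θ = contourStep (semiflat R Z θ) G fun _ γ' => rayDir Z γ' := by
  funext X γ ζ
  rw [iterStep, contourStep, contourExponent]
  congr 4
  rw [finsum_eq_sum_of_support_subset (s := G)]
  · refine Finset.sum_congr rfl fun γ' hγ' => ?_
    rw [hΩ, if_pos hγ', rayIntegral_eq (hZ γ' hγ')]
    simp [kernelLog, cauchyTransform]
  · intro γ' h
    by_contra hn
    exact h (by simp [hΩ, show γ' ∉ G from hn])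

theorem iterate_eq_contourIter {R : ℝ} {Z : Charge →+ ℂ} {Ω : Charge → ℤ} {θ : TwistedCharacter}
    {G : Finset Charge} (hΩ : ∀ γ, Ω γ = if γ ∈ G then 1 else 0) (hZ : ∀ γ ∈ G, Z γ ≠ 0) (ν : ℕ) :
    iterate R Z Ω θ ν = contourIter (semiflat R Z θ) G (fun _ γ' => rayDir Z γ') ν := by
  induction ν with
  | zero => rfl
  | succ ν ih => rw [iterate, ih, iterStep_eq_contourStep hΩ hZ]; rfl

theorem SectorDamped.weaken {C C' c : ℝ} {D : ℂ} {φ₁ φ₂ : ℝ} {Ω : Set ℂ} {g : ℂ → ℂ}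
    (h : SectorDamped C c D φ₁ φ₂ Ω g) (hC : C ≤ C') : SectorDamped C' c D φ₁ φ₂ Ω g where
  isOpen := h.isOpen
  diff := h.diff
  mem := h.mem
  bound t ht ψ hψ := (h.bound t ht ψ hψ).trans
    (mul_le_mul_of_nonneg_right hC (damping_pos c t).le)

/-- Intersecting the domain with the preimage of the disc of radius 1/2 keeps `1 - g` in the slit
plane, and the damping bound shows that the sector survives the intersection. -/
theorem SectorDamped.log {c : ℝ} {D : ℂ} {φ₁ φ₂ : ℝ} {Ω : Set ℂ} {g : ℂ → ℂ} (hc : 2 ≤ c)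
    (h : SectorDamped 8 c D φ₁ φ₂ Ω g) :
    SectorDamped 12 c D φ₁ φ₂ (Ω ∩ g ⁻¹' Metric.ball 0 (1 / 2))
      fun z => Complex.log (1 - g z) where
  isOpen := h.diff.continuousOn.isOpen_inter_preimage h.isOpen Metric.isOpen_ball
  diff := ((h.diff.mono Set.inter_subset_left).const_sub 1).clog fun z hz =>
    one_sub_mem_slitPlane (le_of_lt (by simpa using hz.2))
  mem t ht ψ hψ := ⟨h.mem t ht ψ hψ, by
    have := h.bound t ht ψ hψ
    have := damping_le hc ht
    simp; linarith⟩
  bound t ht ψ hψ := by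
    have h1 := h.bound t ht ψ hψ
    have h2 := damping_le hc ht
    have := norm_log_one_sub_le (z := g (t * dir D ψ)) (by linarith)
    linarith

theorem contourExponent_congr {G : Finset Charge} {d d' : Charge → Charge → ℂ}
    {X X' : Charge → ℂ → ℂ} {γ : Charge} {ζ : ℂ}
    (h : ∀ γ' ∈ G, pairing γ γ' ≠ 0 →
      cauchyTransform (d γ γ') (fun z => Complex.log (1 - X γ' z)) ζ =
        cauchyTransform (d' γ γ') (fun z => Complex.log (1 - X' γ' z)) ζ) :
    contourExponent G d X γ ζ = contourExponent G d' X' γ ζ := by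
  unfold contourExponent
  congr 1
  refine Finset.sum_congr rfl fun γ' hγ' => ?_
  by_cases hp : pairing γ γ' = 0
  · simp [hp]
  · rw [h γ' hγ' hp]

/-! ### Darboux coordinates as solutions along rotated contours. -/

section

variable {f : Charge → ℂ → ℂ} {G : Finset Charge} {d : Charge → Charge → ℂ} {k c : ℝ}

/-- Directions in the domain of `γ` along which the source is damped. -/
def goodDirs (f : Charge → ℂ → ℂ) (G : Finset Charge) (d : Charge → Charge → ℂ) (k c : ℝ)
    (γ : Charge) : Set ℂ :=
  {z | z ∈ contourDomain G d k γ ∧ ∀ t : ℝ, 0 < t → ‖f γ (t * z)‖ ≤ damping c t}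

theorem Admissible.norm_limit_le_damping (H : Admissible f G d k c) {γ : Charge} (hγ : γ ∈ G)
    {z : ℂ} (hz : z ∈ goodDirs f G d k c γ) {t : ℝ} (ht : 0 < t) :
    ‖contourLimit f G d γ (t * z)‖ ≤ 3 * damping c t := by
  have h1 := H.norm_limit_le hγ (smul_mem_contourDomain hz.1 ht)
  have h2 := hz.2 t ht
  linarith [damping_pos c t]

theorem Admissible.norm_iter_le_damping (H : Admissible f G d k c) {γ : Charge} (hγ : γ ∈ G)
    {z : ℂ} (hz : z ∈ goodDirs f G d k c γ) (ν : ℕ) {t : ℝ} (ht : 0 < t) :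
    ‖contourIter f G d ν γ (t * z)‖ ≤ 3 * damping c t := by
  have h1 := (H.iter_spec ν).2 γ hγ _ (smul_mem_contourDomain hz.1 ht)
  have h2 := hz.2 t ht
  linarith [damping_pos c t]

theorem damped_of_goodDirs {X : Charge → ℂ → ℂ} {γ : Charge}
    (hX : ContinuousOn (X γ) (contourDomain G d k γ)) {z : ℂ} (hz : z ∈ contourDomain G d k γ)
    (hb : ∀ t : ℝ, 0 < t → ‖X γ (t * z)‖ ≤ 3 * damping c t) : Damped 8 c z (X γ) where
  meas := (hX.comp (by fun_prop) fun _ ht =>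
    smul_mem_contourDomain hz ht).aestronglyMeasurable measurableSet_Ioi
  bound t ht := (hb t ht).trans (by linarith [damping_pos c t])

theorem Admissible.damped_limit (H : Admissible f G d k c) {γ : Charge} (hγ : γ ∈ G)
    {z : ℂ} (hz : z ∈ goodDirs f G d k c γ) : Damped 8 c z (contourLimit f G d γ) :=
  damped_of_goodDirs (H.differentiableOn_limit hγ).continuousOn hz.1
    fun _ => H.norm_limit_le_damping hγ hz

theorem Admissible.damped_iter (H : Admissible f G d k c) {γ : Charge} (hγ : γ ∈ G)
    {z : ℂ} (hz : z ∈ goodDirs f G d k c γ) (ν : ℕ) : Damped 8 c z (contourIter f G d ν γ) :=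
  damped_of_goodDirs ((H.iter_spec ν).1 γ hγ).continuousOn hz.1
    fun _ => H.norm_iter_le_damping hγ hz ν

theorem sectorDamped_of_goodDirs {X : Charge → ℂ → ℂ} {γ : Charge}
    (hX : DifferentiableOn ℂ (X γ) (contourDomain G d k γ)) {D : ℂ} {φ₁ φ₂ : ℝ}
    (hz : ∀ ψ ∈ Set.uIcc φ₁ φ₂, dir D ψ ∈ contourDomain G d k γ)
    (hb : ∀ ψ ∈ Set.uIcc φ₁ φ₂, ∀ t : ℝ, 0 < t → ‖X γ (t * dir D ψ)‖ ≤ 3 * damping c t) :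
    SectorDamped 3 c D φ₁ φ₂ (contourDomain G d k γ) (X γ) where
  isOpen := isOpen_contourDomain G d k γ
  diff := hX
  mem _ ht ψ hψ := smul_mem_contourDomain (hz ψ hψ) ht
  bound t ht ψ hψ := hb ψ hψ t ht

end

/-- The contours `d` of the charges in `G` are obtained from the BPS rays by rotations through
sectors in which the iterates are holomorphic and damped, and which do not meet the rays where the
iterates are evaluated. -/
structure Rotates (R : ℝ) (Z : Charge →+ ℂ) (θ : TwistedCharacter) (G : Finset Charge)
    (d : Charge → Charge → ℂ) (k c : ℝ) : Prop where
  ne_zero : ∀ γ ∈ G, Z γ ≠ 0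
  good : ∀ γ ∈ G, rayDir Z γ ∈ goodDirs (semiflat R Z θ) G d k c γ
  sweep : ∀ γ ∈ G, ∀ γ' ∈ G, pairing γ γ' ≠ 0 → ∃ (D : ℂ) (η φ : ℝ), ‖D‖ = 1 ∧
    rayDir Z γ' = dir D η ∧ d γ γ' = dir D φ ∧ ∀ ψ ∈ Set.uIcc η φ,
      dir D ψ ∈ goodDirs (semiflat R Z θ) G d k c γ' ∧ dir D ψ ≠ rayDir Z γ

section

variable {R : ℝ} {Z : Charge →+ ℂ} {Ω : Charge → ℤ} {θ : TwistedCharacter} {G : Finset Charge}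
  {d : Charge → Charge → ℂ} {k c : ℝ}

theorem eq_of_smul_eq_smul {z w : ℂ} (hz : ‖z‖ = 1) (hw : ‖w‖ = 1) {s t : ℝ} (hs : 0 < s)
    (ht : 0 < t) (h : (s : ℂ) * z = t * w) : z = w := by
  have h1 := congrArg norm h
  rw [norm_mul, norm_mul, hz, hw, Complex.norm_of_nonneg hs.le, Complex.norm_of_nonneg ht.le,
    mul_one, mul_one] at h1
  subst h1
  exact mul_left_cancel₀ (by exact_mod_cast hs.ne') h

/-- The integral over `ℓ_γ'` uses only values of `X_γ'` on its own ray, so by induction the rotated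
iterate can be put there. That iterate is holomorphic in the swept sector, and the evaluation point
on `ℓ_γ` is outside the sector, so the contour can be rotated. Only own-ray values are compared:
beyond the swept sectors the two families may differ by jumps. -/
theorem Rotates.iter_eq (S : Rotates R Z θ G d k c)
    (H : Admissible (semiflat R Z θ) G d k c) (ν : ℕ) :
    ∀ γ ∈ G, ∀ t : ℝ, 0 < t →
      contourIter (semiflat R Z θ) G (fun _ γ' => rayDir Z γ') ν γ (t * rayDir Z γ) =
        contourIter (semiflat R Z θ) G d ν γ (t * rayDir Z γ) := by
  induction ν with
  | zero => intros; rfl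
  | succ ν ih =>
    intro γ hγ t ht
    simp only [contourIter, contourStep]
    congr 2
    refine contourExponent_congr fun γ' hγ' hp => ?_
    rw [cauchyTransform_congr (h := fun z =>
      Complex.log (1 - contourIter (semiflat R Z θ) G d ν γ' z))
      (fun s hs => by simp only [ih γ' hγ' s hs])]
    obtain ⟨D, η, φ, hD, h1, h2, h3⟩ := S.sweep γ hγ γ' hγ' hp
    rw [h1, h2]
    refine (((sectorDamped_of_goodDirs ((H.iter_spec ν).1 γ' hγ') (fun ψ hψ => (h3 ψ hψ).1.1)
      fun ψ hψ t ht => H.norm_iter_le_damping hγ' (h3 ψ hψ).1 ν ht).weaken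
        (by norm_num : (3 : ℝ) ≤ 8)).log H.two_le).cauchyTransform_eq (by linarith [H.two_le]) hD ?_ ?_
    · exact (smul_mem_contourDomain (S.good γ hγ).1 ht).1
    · intro ψ hψ s hs h
      refine (h3 ψ hψ).2 (eq_of_smul_eq_smul ((norm_dir D ψ).trans hD)
        (norm_rayDir (S.ne_zero γ hγ)) hs ht h.symm)

/-- Dominated convergence with direction, density and evaluation point all varying. It serves both
the limit `ν → ∞` and the limit `u → u₀`. -/
theorem tendsto_cauchyTransform_log {ι : Type*} {l : Filter ι} [l.IsCountablyGenerated] {c K : ℝ}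
    (hc : 2 ≤ c) (hK : 0 ≤ K) {d : ι → ℂ} {d₀ : ℂ} {X : ι → ℂ → ℂ} {X₀ : ℂ → ℂ} {ζ : ι → ℂ} {ζ₀ : ℂ}
    (hX : ∀ᶠ i in l, Damped 8 c (d i) (X i)) (hX₀ : Damped 8 c d₀ X₀)
    (hker : ∀ᶠ i in l, ∀ t : ℝ, 0 < t → ‖(t * d i + ζ i) / (t * d i - ζ i)‖ ≤ K)
    (hne : ∀ t : ℝ, 0 < t → (t : ℂ) * d₀ - ζ₀ ≠ 0)
    (hd : Tendsto d l (𝓝 d₀)) (hζ : Tendsto ζ l (𝓝 ζ₀))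
    (hlim : ∀ t : ℝ, 0 < t → Tendsto (fun i => X i (t * d i)) l (𝓝 (X₀ (t * d₀)))) :
    Tendsto (fun i => cauchyTransform (d i) (fun z => Complex.log (1 - X i z)) (ζ i)) l
      (𝓝 (cauchyTransform d₀ (fun z => Complex.log (1 - X₀ z)) ζ₀)) := by
  have hI := (integrableOn_inv_mul_damping (by linarith : 0 < c)).const_mul (K * 12)
  unfold cauchyTransform
  refine tendsto_integral_filter_of_dominated_convergence
    (F := fun i (t : ℝ) => (t : ℂ)⁻¹ *
      ((t * d i + ζ i) / (t * d i - ζ i) * Complex.log (1 - X i (t * d i))))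
    (fun t => (K * 12) * (t⁻¹ * damping c t)) ?_ ?_ hI ?_
  · filter_upwards [hX] with i hi
    exact aestronglyMeasurable_integrand (g := fun z => Complex.log (1 - X i z)) (ζ i)
      (hi.log hc).meas
  · filter_upwards [hX, hker] with i hi hki
    filter_upwards [ae_restrict_mem measurableSet_Ioi] with t ht
    refine (norm_integrand_le (g := fun z => Complex.log (1 - X i z)) ht hK (hki t ht)
      ((hi.log hc).bound t ht)).trans (le_of_eq ?_)
    ring
  · filter_upwards [ae_restrict_mem measurableSet_Ioi] with t ht
    have h1 : Tendsto (fun i => (t : ℂ) * d i) l (𝓝 (t * d₀)) := hd.const_mul (t : ℂ)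
    have h2 : Tendsto (fun i => Complex.log (1 - X i (t * d i))) l
        (𝓝 (Complex.log (1 - X₀ (t * d₀)))) :=
      ((hlim t ht).const_sub 1).clog (one_sub_mem_slitPlane (hX₀.le_half hc ht))
    exact (((h1.add hζ).div (h1.sub hζ) (hne t ht)).mul h2).const_mul _

theorem OffJumps.ne (S : Rotates R Z θ G d k c) (hΩ : ∀ γ, Ω γ = if γ ∈ G then 1 else 0)
    {γ : Charge} {ζ : ℂ} (h : OffJumps Z Ω γ ζ) {γ' : Charge} (hγ' : γ' ∈ G)
    (hp : pairing γ γ' ≠ 0) : ∀ t : ℝ, 0 < t → ζ ≠ t * rayDir Z γ' := fun t ht h' =>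
  h.2 γ' (by simp [hΩ, hγ']) hp ((mem_bpsRay_iff (S.ne_zero γ' hγ')).2 ⟨t, ht, h'⟩)

theorem exists_apart_dir {d ζ : ℂ} (hd : ‖d‖ = 1) (hζ : ζ ≠ 0)
    (h : ∀ t : ℝ, 0 < t → ζ ≠ t * d) : ∃ k : ℝ, 0 ≤ k ∧ k < 1 ∧ Apart k ζ d := by
  obtain ⟨k, h0, h1, h2⟩ := exists_apart (φ₁ := 0) (φ₂ := 0) hd hζ (fun ψ hψ t ht => by
    rw [Set.uIcc_self, Set.mem_singleton_iff] at hψ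
    subst hψ; rw [dir_zero]; exact h t ht)
  have h3 := h2 0 Set.left_mem_uIcc
  rw [dir_zero] at h3
  exact ⟨k, h0, h1, h3⟩

/-- For arbitrary `γ` and `ζ` off the jumps, each iterate after the initial one is one integral step
from own-ray values of the preceding one. Those values converge by the contraction, hence so does
the iterate, to one step applied to the rotated solution. -/
theorem Rotates.tendsto_iter (S : Rotates R Z θ G d k c)
    (H : Admissible (semiflat R Z θ) G d k c) (hΩ : ∀ γ, Ω γ = if γ ∈ G then 1 else 0)
    {γ : Charge} {ζ : ℂ} (h : OffJumps Z Ω γ ζ) :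
    Tendsto (fun ν => contourIter (semiflat R Z θ) G (fun _ γ' => rayDir Z γ') ν γ ζ) atTop
      (𝓝 (contourStep (semiflat R Z θ) G (fun _ γ' => rayDir Z γ')
        (contourLimit (semiflat R Z θ) G d) γ ζ)) := by
  refine (tendsto_add_atTop_iff_nat 1).1 ?_
  simp only [contourIter, contourStep, contourExponent]
  refine ((Complex.continuous_exp.tendsto _).comp ((tendsto_finsetSum _ fun γ' hγ' => ?_).const_mul
    _)).const_mul _
  by_cases hp : pairing γ γ' = 0
  · simp [hp]
  refine Tendsto.const_mul _ ?_
  have hne := h.ne S hΩ hγ' hp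
  obtain ⟨k', hk0, hk1, hk⟩ := exists_apart_dir (norm_rayDir (S.ne_zero γ' hγ')) h.1 hne
  have e : ∀ ν, cauchyTransform (rayDir Z γ') (fun z => Complex.log (1 -
      contourIter (semiflat R Z θ) G (fun _ γ' => rayDir Z γ') ν γ' z)) ζ =
      cauchyTransform (rayDir Z γ') (fun z => Complex.log (1 -
      contourIter (semiflat R Z θ) G d ν γ' z)) ζ := fun ν =>
    cauchyTransform_congr (fun t ht => by simp only [S.iter_eq H ν γ' hγ' t ht]) ζ
  simp_rw [e]
  exact tendsto_cauchyTransform_log (K := 2 / (1 - k')) H.two_le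
    (div_nonneg zero_le_two (by linarith))
    (Eventually.of_forall fun ν => H.damped_iter hγ' (S.good γ' hγ') ν)
    (H.damped_limit hγ' (S.good γ' hγ'))
    (Eventually.of_forall fun ν t ht =>
      hk.norm_kernel_le hk0 hk1 (norm_rayDir (S.ne_zero γ' hγ')) ht)
    (fun t ht => sub_ne_zero.2 (hne t ht).symm) tendsto_const_nhds tendsto_const_nhds
    fun t ht => H.tendsto_iter hγ' (smul_mem_contourDomain (S.good γ' hγ').1 ht)

theorem Rotates.darboux_eq_step (S : Rotates R Z θ G d k c)
    (H : Admissible (semiflat R Z θ) G d k c) (hΩ : ∀ γ, Ω γ = if γ ∈ G then 1 else 0)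
    {γ : Charge} {ζ : ℂ} (h : OffJumps Z Ω γ ζ) :
    darboux R Z Ω θ γ ζ = contourStep (semiflat R Z θ) G (fun _ γ' => rayDir Z γ')
        (contourLimit (semiflat R Z θ) G d) γ ζ := by
  have := (S.tendsto_iter H hΩ h).limUnder_eq
  rw [← this]
  unfold darboux
  simp_rw [iterate_eq_contourIter hΩ S.ne_zero]

/-- On its own ray the Darboux coordinate is the solution along the rotated contours. -/
theorem Rotates.darboux_eq_limit (S : Rotates R Z θ G d k c)
    (H : Admissible (semiflat R Z θ) G d k c) (hΩ : ∀ γ, Ω γ = if γ ∈ G then 1 else 0)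
    {γ : Charge} (hγ : γ ∈ G) {t : ℝ} (ht : 0 < t) :
    darboux R Z Ω θ γ (t * rayDir Z γ) =
      contourLimit (semiflat R Z θ) G d γ (t * rayDir Z γ) := by
  unfold darboux contourLimit
  simp_rw [iterate_eq_contourIter hΩ S.ne_zero, S.iter_eq H _ γ hγ t ht]

theorem Rotates.darbouxExists (S : Rotates R Z θ G d k c)
    (H : Admissible (semiflat R Z θ) G d k c) (hΩ : ∀ γ, Ω γ = if γ ∈ G then 1 else 0) :
    DarbouxExists R Z Ω θ := by
  have hmem : ∀ γ, Ω γ ≠ 0 → γ ∈ G := fun γ h => by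
    by_contra hn; exact h (by simp [hΩ, hn])
  refine ⟨fun γ ζ h => ?_, fun γ' h' ζ hζ0 hζ => ?_, fun γ' h' ζ hζ => ?_, fun γ ζ h => ?_⟩
  · rw [S.darboux_eq_step H hΩ h]
    simp_rw [iterate_eq_contourIter hΩ S.ne_zero]
    exact S.tendsto_iter H hΩ h
  · have hγ' := hmem γ' h'
    have hZ := S.ne_zero γ' hγ'
    obtain ⟨k', hk0, hk1, hk⟩ := exists_apart_dir (norm_rayDir hZ) hζ0 (fun t ht he =>
      hζ ((mem_bpsRay_iff hZ).2 ⟨t, ht, he⟩))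
    rw [rayIntegrable_iff hZ]
    refine (integrableOn_integrand (by linarith [H.two_le]) hk0 hk1 (norm_rayDir hZ)
      ((H.damped_limit hγ' (S.good γ' hγ')).log H.two_le) hk).congr_fun (fun t ht => ?_)
      measurableSet_Ioi
    simp only [kernelLog, S.darboux_eq_limit H hΩ hγ' ht]
  · have hγ' := hmem γ' h'
    obtain ⟨t, ht, rfl⟩ := (mem_bpsRay_iff (S.ne_zero γ' hγ')).1 hζ
    rw [S.darboux_eq_limit H hΩ hγ' ht]
    have := H.norm_limit_le_damping hγ' (S.good γ' hγ') ht
    have := damping_le H.two_le ht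
    linarith
  · rw [S.darboux_eq_step H hΩ h, iterStep_eq_contourStep hΩ S.ne_zero, contourStep, contourStep]
    congr 2
    exact contourExponent_congr fun γ' hγ' _ =>
      cauchyTransform_congr (fun t ht => by simp only [S.darboux_eq_limit H hΩ hγ' ht]) ζ

end

/-! ### Continuity of the contour solution in the data. -/

section

variable {ι : Type*} {l : Filter ι} {f : ι → Charge → ℂ → ℂ} {f₀ : Charge → ℂ → ℂ}
  {G : Finset Charge} {d : ι → Charge → Charge → ℂ} {d₀ : Charge → Charge → ℂ} {k c : ℝ}

/-- The data `f i`, `d i` of admissible integral equations converge to `f₀`, `d₀`. -/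
structure ConvergesTo (l : Filter ι) (f : ι → Charge → ℂ → ℂ) (f₀ : Charge → ℂ → ℂ)
    (G : Finset Charge) (d : ι → Charge → Charge → ℂ) (d₀ : Charge → Charge → ℂ) (k c : ℝ) :
    Prop where
  admissible : ∀ᶠ i in l, Admissible (f i) G (d i) k c
  admissible₀ : Admissible f₀ G d₀ k c
  dirs : ∀ γ ∈ G, ∀ γ' ∈ G, pairing γ γ' ≠ 0 → Tendsto (fun i => d i γ γ') l (𝓝 (d₀ γ γ'))
  source : ∀ γ ∈ G, ∀ (ζ : ι → ℂ) (ζ₀ : ℂ), Tendsto ζ l (𝓝 ζ₀) → ζ₀ ≠ 0 →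
    Tendsto (fun i => f i γ (ζ i)) l (𝓝 (f₀ γ ζ₀))

theorem Apart.eventually {k : ℝ} {ζ d : ι → ℂ} {ζ₀ d₀ : ℂ} (h : Apart k ζ₀ d₀)
    (hζ : Tendsto ζ l (𝓝 ζ₀)) (hd : Tendsto d l (𝓝 d₀)) : ∀ᶠ i in l, Apart k (ζ i) (d i) := by
  unfold Apart at *
  refine Tendsto.eventually_lt ?_ (hζ.norm.const_mul k) h
  exact (Complex.continuous_re.tendsto _).comp
    (hζ.mul ((Complex.continuous_conj.tendsto _).comp hd))

theorem ConvergesTo.eventually_mem (T : ConvergesTo l f f₀ G d d₀ k c) {γ : Charge} (hγ : γ ∈ G)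
    {ζ : ι → ℂ} {ζ₀ : ℂ} (hζ : Tendsto ζ l (𝓝 ζ₀)) (h : ζ₀ ∈ contourDomain G d₀ k γ) :
    ∀ᶠ i in l, ζ i ∈ contourDomain G (d i) k γ := by
  have h1 : ∀ᶠ i in l, ∀ γ' ∈ G, pairing γ γ' ≠ 0 → Apart k (ζ i) (d i γ γ') := by
    refine (Finset.eventually_all G).2 fun γ' hγ' => ?_
    by_cases hp : pairing γ γ' = 0
    · simp [hp]
    · filter_upwards [(h.2 γ' hγ' hp).eventually hζ (T.dirs γ hγ γ' hγ' hp)] with i hi _ using hi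
  filter_upwards [h1, hζ.eventually_ne h.1] with i h2 h3 using ⟨h3, h2⟩

/-- The evaluation point must be allowed to vary with the parameter, because the induction evaluates
the preceding iterate on contours that move. -/
theorem ConvergesTo.tendsto_iter [l.IsCountablyGenerated] (T : ConvergesTo l f f₀ G d d₀ k c)
    (ν : ℕ) : ∀ γ ∈ G, ∀ (ζ : ι → ℂ) (ζ₀ : ℂ), Tendsto ζ l (𝓝 ζ₀) → ζ₀ ∈ contourDomain G d₀ k γ →
    Tendsto (fun i => contourIter (f i) G (d i) ν γ (ζ i)) l
      (𝓝 (contourIter f₀ G d₀ ν γ ζ₀)) := by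
  induction ν with
  | zero => exact fun γ hγ ζ ζ₀ hζ h => T.source γ hγ ζ ζ₀ hζ h.1
  | succ ν ih =>
    intro γ hγ ζ ζ₀ hζ h
    have H₀ := T.admissible₀
    simp only [contourIter, contourStep, contourExponent]
    refine (T.source γ hγ ζ ζ₀ hζ h.1).mul ((Complex.continuous_exp.tendsto _).comp
      ((tendsto_finsetSum _ fun γ' hγ' => ?_).const_mul _))
    by_cases hp : pairing γ γ' = 0
    · simpa [hp] using tendsto_const_nhds
    refine Tendsto.const_mul _ ?_
    have hd := T.dirs γ hγ γ' hγ' hp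
    have hu := H₀.unit γ hγ γ' hγ' hp
    refine tendsto_cauchyTransform_log (K := 2 / (1 - k)) (X := fun i => contourIter (f i) G (d i) ν γ')
      H₀.two_le (div_nonneg zero_le_two (by linarith [H₀.lt_one]))
      (T.admissible.mono fun i hi => hi.tame_iter ν γ hγ γ' hγ' hp)
      (H₀.tame_iter ν γ hγ γ' hγ' hp) ?_
      (fun t ht => (h.2 γ' hγ' hp).sub_ne_zero H₀.nonneg H₀.lt_one hu ht) hd hζ
      fun t ht => ih γ' hγ' _ _ (hd.const_mul _) (smul_mem_contourDomain (H₀.mem γ hγ γ' hγ' hp) ht)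
    filter_upwards [T.admissible, T.eventually_mem hγ hζ h] with i hi hm t ht
    exact (hm.2 γ' hγ' hp).norm_kernel_le hi.nonneg hi.lt_one (hi.unit γ hγ γ' hγ' hp) ht

/-- An `ε/3` argument: the geometric tail is uniform in the parameter because the admissibility
constants `k`, `c` are fixed. -/
theorem ConvergesTo.tendsto_limit [l.IsCountablyGenerated] (T : ConvergesTo l f f₀ G d d₀ k c)
    {γ : Charge} (hγ : γ ∈ G) {ζ : ι → ℂ} {ζ₀ : ℂ} (hζ : Tendsto ζ l (𝓝 ζ₀))
    (h : ζ₀ ∈ contourDomain G d₀ k γ) :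
    Tendsto (fun i => contourLimit (f i) G (d i) γ (ζ i)) l (𝓝 (contourLimit f₀ G d₀ γ ζ₀)) := by
  have hs := T.source γ hγ ζ ζ₀ hζ h.1
  set B := ‖f₀ γ ζ₀‖ + 1
  have hB : ∀ᶠ i in l, ‖f i γ (ζ i)‖ ≤ B :=
    (hs.norm.eventually_lt_const (lt_add_one _)).mono fun _ hi => hi.le
  rw [Metric.tendsto_nhds]
  intro ε hε
  obtain ⟨ν, hν⟩ := ((tendsto_half_pow_mul (12 * B)).eventually_lt_const
    (by positivity : 0 < ε / 3)).exists
  have h3 := Metric.tendsto_nhds.1 (T.tendsto_iter ν γ hγ ζ ζ₀ hζ h) (ε / 3) (by positivity)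
  have h1 := T.admissible₀.norm_iter_sub_limit_le ν hγ h
  filter_upwards [h3, hB, T.admissible, T.eventually_mem hγ hζ h] with i e1 e2 e3 e4
  have h2 := e3.norm_iter_sub_limit_le ν hγ e4
  rw [← dist_eq_norm] at h1 h2
  have b1 : 12 * (1 / 2 : ℝ) ^ ν * ‖f₀ γ ζ₀‖ < ε / 3 := by
    refine lt_of_le_of_lt ?_ hν
    have : ‖f₀ γ ζ₀‖ ≤ B := (lt_add_one _).le
    calc 12 * (1 / 2 : ℝ) ^ ν * ‖f₀ γ ζ₀‖ ≤ 12 * (1 / 2 : ℝ) ^ ν * B := by gcongr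
      _ = _ := by ring
  have b2 : 12 * (1 / 2 : ℝ) ^ ν * ‖f i γ (ζ i)‖ < ε / 3 := by
    refine lt_of_le_of_lt ?_ hν
    calc 12 * (1 / 2 : ℝ) ^ ν * ‖f i γ (ζ i)‖ ≤ 12 * (1 / 2 : ℝ) ^ ν * B := by gcongr
      _ = _ := by ring
  calc dist (contourLimit (f i) G (d i) γ (ζ i)) (contourLimit f₀ G d₀ γ ζ₀)
      ≤ dist (contourLimit (f i) G (d i) γ (ζ i)) (contourIter (f i) G (d i) ν γ (ζ i)) +
        dist (contourIter (f i) G (d i) ν γ (ζ i)) (contourIter f₀ G d₀ ν γ ζ₀) +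
        dist (contourIter f₀ G d₀ ν γ ζ₀) (contourLimit f₀ G d₀ γ ζ₀) := dist_triangle4 _ _ _ _
    _ < ε := by rw [dist_comm (contourLimit (f i) G (d i) γ (ζ i))]; linarith

end

/-! ### Contours and sectors near a wall of type I. -/

/-- The half of the charge lattice basis directions to which a charge belongs. -/
noncomputable def chargeSign (γ : Charge) : ℂ := if 0 ≤ γ.1 ∧ 0 ≤ γ.2 then 1 else -1

/-- The charges with nonzero BPS invariant on the inner side. -/
def chargesIn : Finset Charge := {(1, 0), (-1, 0), (0, 1), (0, -1)}

/-- The charges with nonzero BPS invariant on the outer side of a wall of type I. -/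
def chargesOut : Finset Charge := {(1, 0), (-1, 0), (0, 1), (0, -1), (1, 1), (-1, -1)}

/-- The angles of the rotated contours on the inner side. -/
noncomputable def angleIn (γ' : Charge) : ℝ := if γ'.2 = 0 then 1 / 2 else -(1 / 2)

/-- The angles of the rotated contours on the outer side; the contour of the bound state depends
on the charge `γ` in whose equation it appears. -/
noncomputable def angleOut (γ γ' : Charge) : ℝ :=
  if γ'.2 = 0 then -(1 / 4) else if γ'.1 = 0 then 1 / 4 else if γ.2 = 0 then 1 / 8 else -(1 / 8)

/-- The rotated contours on the inner side. -/
noncomputable def contourIn (D : ℂ) (_ γ' : Charge) : ℂ := dir (chargeSign γ' * D) (angleIn γ')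

/-- The rotated contours on the outer side. -/
noncomputable def contourOut (D : ℂ) (γ γ' : Charge) : ℂ :=
  dir (chargeSign γ' * D) (angleOut γ γ')

/-- The sector of angles in which `X_γ` is controlled on the inner side. -/
noncomputable def sectorIn (γ : Charge) : Set ℝ :=
  if γ.2 = 0 then Set.Icc (-(1 / 4)) (1 / 2) else Set.Icc (-(1 / 2)) (1 / 4)

/-- The sector of angles in which `X_γ` is controlled on the outer side. -/
noncomputable def sectorOut (γ : Charge) : Set ℝ :=
  if γ.2 = 0 then Set.Icc (-(1 / 4)) 0 else if γ.1 = 0 then Set.Icc 0 (1 / 4)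
  else Set.Icc (-(1 / 8)) (1 / 8)

/-- The cosine of the angle by which contours are kept apart. -/
noncomputable def apartCos : ℝ := Real.cos (1 / 16)

theorem apartCos_lt_one : apartCos < 1 := by
  have := Real.cos_lt_cos_of_nonneg_of_le_pi (x := 0) (y := 1 / 16) le_rfl
    (by linarith [Real.pi_gt_three]) (by norm_num)
  rwa [Real.cos_zero] at this

theorem apartCos_pos : 0 < apartCos :=
  Real.cos_pos_of_mem_Ioo ⟨by linarith [Real.pi_gt_three], by linarith [Real.pi_gt_three]⟩

/-- Contours and sectors are at least 1/8 apart; `apartCos` uses 1/16 to make the inequality strict.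
-/
theorem cos_le_of_abs {x : ℝ} (h1 : 1 / 8 ≤ |x|) (h2 : |x| ≤ 1) : Real.cos x < apartCos := by
  rw [← Real.cos_abs]
  exact Real.cos_lt_cos_of_nonneg_of_le_pi (by norm_num) (by linarith [Real.pi_gt_three])
    (by linarith)

theorem chargeSign_cases (γ : Charge) : chargeSign γ = 1 ∨ chargeSign γ = -1 := by
  unfold chargeSign; split_ifs <;> simp

theorem norm_chargeSign_mul (γ : Charge) (D : ℂ) : ‖chargeSign γ * D‖ = ‖D‖ := by
  rcases chargeSign_cases γ with h | h <;> simp [h]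

theorem dir_mul_conj_dir {D : ℂ} (hD : ‖D‖ = 1) (s s' : ℂ) (φ ψ : ℝ) :
    dir (s * D) φ * (starRingEnd ℂ) (dir (s' * D) ψ) =
      s * (starRingEnd ℂ) s' * Complex.exp ((φ - ψ : ℝ) * Complex.I) := by
  have h1 : D * (starRingEnd ℂ) D = 1 := by
    rw [Complex.mul_conj, Complex.normSq_eq_norm_sq, hD]; simp
  have h2 : (starRingEnd ℂ) (Complex.exp (ψ * Complex.I)) = Complex.exp (-(ψ * Complex.I)) := by
    rw [← Complex.exp_conj]; simp
  have h3 : Complex.exp ((φ - ψ : ℝ) * Complex.I) =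
      Complex.exp (φ * Complex.I) * Complex.exp (-(ψ * Complex.I)) := by
    rw [← Complex.exp_add]; congr 1; push_cast; ring
  rw [dir, dir, map_mul, map_mul, h2, h3]
  linear_combination (s * (starRingEnd ℂ) s' * Complex.exp (φ * Complex.I) *
    Complex.exp (-(ψ * Complex.I))) * h1

/-- For equal signs the relevant cosine is `cos (φ - ψ)`, below `apartCos`; for opposite signs it is
`-cos (φ - ψ)`, which is negative because the angle is less than a right angle. -/
theorem apart_dir {D : ℂ} (hD : ‖D‖ = 1) (γ γ' : Charge) {φ ψ : ℝ} (h1 : 1 / 8 ≤ |φ - ψ|)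
    (h2 : |φ - ψ| ≤ 1) : Apart apartCos (dir (chargeSign γ * D) φ) (dir (chargeSign γ' * D) ψ) := by
  have h3 := cos_le_of_abs h1 h2
  have h4 : 0 < Real.cos (φ - ψ) := by
    rw [abs_le] at h2
    exact Real.cos_pos_of_mem_Ioo ⟨by linarith [Real.pi_gt_three], by linarith [Real.pi_gt_three]⟩
  have h5 := apartCos_pos
  rw [Apart, dir_mul_conj_dir hD, norm_dir, norm_chargeSign_mul, hD, mul_one]
  rcases chargeSign_cases γ with h | h <;> rcases chargeSign_cases γ' with h' | h' <;>
    simp only [h, h', map_one, map_neg, one_mul, mul_one, mul_neg, neg_mul, neg_neg,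
      Complex.neg_re, Complex.exp_ofReal_mul_I_re] <;> linarith

theorem sectorIn_apart {γ γ' : Charge} (hγ : γ ∈ chargesIn) (hγ' : γ' ∈ chargesIn)
    (hp : pairing γ γ' ≠ 0) {ψ : ℝ} (hψ : ψ ∈ sectorIn γ) :
    1 / 8 ≤ |ψ - angleIn γ'| ∧ |ψ - angleIn γ'| ≤ 1 := by
  simp only [chargesIn, Finset.mem_insert, Finset.mem_singleton] at hγ hγ'
  rcases hγ with rfl | rfl | rfl | rfl <;> rcases hγ' with rfl | rfl | rfl | rfl <;>
    first
    | exact absurd (by decide) hp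
    | (simp [sectorIn] at hψ
       rw [le_abs, abs_le]
       norm_num [angleIn]
       first
       | exact ⟨Or.inl (by linarith), by constructor <;> linarith⟩
       | exact ⟨Or.inr (by linarith), by constructor <;> linarith⟩)

theorem angleIn_mem {γ : Charge} : angleIn γ ∈ sectorIn γ := by
  unfold angleIn sectorIn
  split_ifs <;> norm_num

theorem sectorOut_apart {γ γ' : Charge} (hγ : γ ∈ chargesOut) (hγ' : γ' ∈ chargesOut)
    (hp : pairing γ γ' ≠ 0) {ψ : ℝ} (hψ : ψ ∈ sectorOut γ) :
    1 / 8 ≤ |ψ - angleOut γ γ'| ∧ |ψ - angleOut γ γ'| ≤ 1 := by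
  simp only [chargesOut, Finset.mem_insert, Finset.mem_singleton] at hγ hγ'
  rcases hγ with rfl | rfl | rfl | rfl | rfl | rfl <;>
    rcases hγ' with rfl | rfl | rfl | rfl | rfl | rfl <;>
    first
    | exact absurd (by decide) hp
    | (simp [sectorOut] at hψ
       rw [le_abs, abs_le]
       norm_num [angleOut]
       first
       | exact ⟨Or.inl (by linarith), by constructor <;> linarith⟩
       | exact ⟨Or.inr (by linarith), by constructor <;> linarith⟩)

theorem angleOut_mem (γ γ' : Charge) : angleOut γ γ' ∈ sectorOut γ' := by
  unfold angleOut sectorOut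
  split_ifs <;> norm_num

theorem sectorIn_subset (γ : Charge) : sectorIn γ ⊆ Set.Icc (-(1 / 2)) (1 / 2) := by
  unfold sectorIn
  split_ifs <;> exact Set.Icc_subset_Icc (by norm_num) (by norm_num)

theorem sectorOut_subset (γ : Charge) : sectorOut γ ⊆ Set.Icc (-(1 / 4)) (1 / 4) := by
  unfold sectorOut
  split_ifs <;> exact Set.Icc_subset_Icc (by norm_num) (by norm_num)

theorem norm_semiflat (R : ℝ) (Z : Charge →+ ℂ) (θ : TwistedCharacter) (γ : Charge) (ζ : ℂ) :
    ‖semiflat R Z θ γ ζ‖ =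
      Real.exp (Real.pi * R * (Z γ / ζ + ζ * (starRingEnd ℂ) (Z γ)).re) := by
  rw [semiflat, norm_mul, norm_mul, Complex.norm_exp, Complex.norm_exp, Circle.norm_coe, mul_one,
    ← Real.exp_add]
  congr 1
  rw [mul_div_assoc, mul_assoc, Complex.re_ofReal_mul, Complex.re_ofReal_mul, Complex.add_re]
  ring

/-- At angle `ψ - η` from `ℓ_γ` the modulus is `exp (-π R ‖Z γ‖ cos (ψ - η) (t + 1/t))`, and the
cosine is at least 1/2 for angles up to 1. This accounts for the 2 in `2 * c`. -/
theorem norm_semiflat_le {R : ℝ} {Z : Charge →+ ℂ} (θ : TwistedCharacter) {γ : Charge}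
    (hZ : Z γ ≠ 0) {D : ℂ} (hD : ‖D‖ = 1) {η ψ c : ℝ} (h : rayDir Z γ = dir D η)
    (hψ : |ψ - η| ≤ 1) (hc : 2 * c ≤ Real.pi * R * ‖Z γ‖) (hc0 : 0 ≤ c) {t : ℝ} (ht : 0 < t) :
    ‖semiflat R Z θ γ (t * dir D ψ)‖ ≤ damping c t := by
  have hn : (‖Z γ‖ : ℂ) ≠ 0 := by exact_mod_cast norm_ne_zero_iff.2 hZ
  have hz : Z γ = -(‖Z γ‖ * dir D η) := by
    rw [← h, rayDir]; field_simp
  have hcos : 1 / 2 ≤ Real.cos (ψ - η) := by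
    have h1 := Real.one_sub_sq_div_two_le_cos (x := ψ - η)
    have h2 : (ψ - η) ^ 2 ≤ 1 := by rw [← sq_abs]; nlinarith [abs_nonneg (ψ - η)]
    linarith
  have hdn : ‖dir D ψ‖ = 1 := (norm_dir D ψ).trans hD
  have key := dir_mul_conj_dir hD 1 1 ψ η
  simp only [one_mul, map_one] at key
  have hinv : (dir D ψ)⁻¹ = (starRingEnd ℂ) (dir D ψ) := by
    rw [Complex.inv_def, Complex.normSq_eq_norm_sq, hdn]; simp
  have e1 : (Z γ / (t * dir D ψ)).re = -(‖Z γ‖ * t⁻¹ * Real.cos (ψ - η)) := by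
    have : Z γ / (t * dir D ψ) =
        -((‖Z γ‖ * t⁻¹ : ℝ) * (starRingEnd ℂ) (dir D ψ * (starRingEnd ℂ) (dir D η))) := by
      rw [map_mul, Complex.conj_conj, ← hinv, div_eq_mul_inv, mul_inv]
      conv_lhs => rw [hz]
      push_cast; ring
    rw [this, key, Complex.neg_re, Complex.re_ofReal_mul, Complex.conj_re,
      Complex.exp_ofReal_mul_I_re]
  have e2 : ((t * dir D ψ) * (starRingEnd ℂ) (Z γ)).re = -(‖Z γ‖ * t * Real.cos (ψ - η)) := by
    have : (t * dir D ψ) * (starRingEnd ℂ) (Z γ) =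
        -((‖Z γ‖ * t : ℝ) * (dir D ψ * (starRingEnd ℂ) (dir D η))) := by
      conv_lhs => rw [hz]
      simp only [map_neg, map_mul, Complex.conj_ofReal]
      push_cast; ring
    rw [this, key, Complex.neg_re, Complex.re_ofReal_mul, Complex.exp_ofReal_mul_I_re]
  rw [norm_semiflat, Complex.add_re, e1, e2, damping]
  refine Real.exp_le_exp.2 ?_
  have ht2 : 0 < t + t⁻¹ := by positivity
  have : c ≤ Real.pi * R * ‖Z γ‖ * Real.cos (ψ - η) := by nlinarith
  nlinarith

/-- The angle of `ℓ_γ` relative to `±D`, in terms of the angles of `ℓ_e` and `ℓ_m`. -/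
noncomputable def rayAngle (ηe ηm : ℝ) (γ : Charge) : ℝ :=
  if γ.2 = 0 then ηe else if γ.1 = 0 then ηm else 0

/-- The value `Z` of the central charge is close to a wall of type I, with `D` the direction of
`ℓ_{γ_e + γ_m}` and `ηe`, `ηm` the angles of `ℓ_e` and `ℓ_m` relative to `D`. -/
structure NearWall (R : ℝ) (Z : Charge →+ ℂ) (D : ℂ) (ηe ηm c : ℝ) : Prop where
  two_le : 2 ≤ c
  small : 100 ≤ (1 - apartCos) * c ^ 2
  norm_D : ‖D‖ = 1
  abs_ηe : |ηe| ≤ 1 / 8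
  abs_ηm : |ηm| ≤ 1 / 8
  ne_zero : ∀ γ ∈ chargesOut, Z γ ≠ 0
  size : ∀ γ ∈ chargesOut, 2 * c ≤ Real.pi * R * ‖Z γ‖
  ray : ∀ γ ∈ chargesOut, rayDir Z γ = dir (chargeSign γ * D) (rayAngle ηe ηm γ)

theorem chargesIn_subset : chargesIn ⊆ chargesOut := by decide

theorem sum_pairing_le_out : ∀ γ ∈ chargesOut, ∑ γ' ∈ chargesOut, |pairing γ γ'| ≤ 6 := by decide

theorem sum_pairing_le_in : ∀ γ ∈ chargesIn, ∑ γ' ∈ chargesIn, |pairing γ γ'| ≤ 6 := by decide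

theorem differentiableOn_semiflat (R : ℝ) (Z : Charge →+ ℂ) (θ : TwistedCharacter) (γ : Charge) :
    DifferentiableOn ℂ (semiflat R Z θ γ) {0}ᶜ := by
  intro ζ hζ
  have : ζ ≠ 0 := hζ
  unfold semiflat
  refine DifferentiableAt.differentiableWithinAt ?_
  fun_prop (disch := assumption)

section

variable {R : ℝ} {Z : Charge →+ ℂ} {D : ℂ} {ηe ηm c : ℝ}

theorem NearWall.norm_semiflat_le (N : NearWall R Z D ηe ηm c) (θ : TwistedCharacter)
    {γ : Charge} (hγ : γ ∈ chargesOut) {ψ : ℝ} (hψ : ψ ∈ Set.Icc (-(1 / 2) : ℝ) (1 / 2)) {t : ℝ}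
    (ht : 0 < t) : ‖semiflat R Z θ γ (t * dir (chargeSign γ * D) ψ)‖ ≤ damping c t := by
  refine Pentagon.norm_semiflat_le θ (N.ne_zero γ hγ) ((norm_chargeSign_mul γ D).trans N.norm_D)
    (N.ray γ hγ) ?_ (N.size γ hγ) (by linarith [N.two_le]) ht
  have h1 := abs_le.1 N.abs_ηe
  have h2 := abs_le.1 N.abs_ηm
  rw [abs_le, rayAngle]
  split_ifs <;> constructor <;> linarith [hψ.1, hψ.2]

theorem dir_chargeSign_ne_zero (hD : ‖D‖ = 1) (γ : Charge) (ψ : ℝ) :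
    dir (chargeSign γ * D) ψ ≠ 0 :=
  norm_pos_iff.1 (by rw [norm_dir, norm_chargeSign_mul, hD]; norm_num)

theorem NearWall.goodDirs_in (N : NearWall R Z D ηe ηm c) (θ : TwistedCharacter)
    {γ : Charge} (hγ : γ ∈ chargesIn) {ψ : ℝ} (hψ : ψ ∈ sectorIn γ) :
    dir (chargeSign γ * D) ψ ∈ goodDirs (semiflat R Z θ) chargesIn (contourIn D) apartCos c γ := by
  refine ⟨⟨dir_chargeSign_ne_zero N.norm_D γ ψ, fun γ' hγ' hp => ?_⟩, fun t ht => ?_⟩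
  · obtain ⟨h1, h2⟩ := sectorIn_apart hγ hγ' hp hψ
    exact apart_dir N.norm_D γ γ' h1 h2
  · exact N.norm_semiflat_le θ (chargesIn_subset hγ) (sectorIn_subset γ hψ) ht

theorem NearWall.goodDirs_out (N : NearWall R Z D ηe ηm c) (θ : TwistedCharacter)
    {γ : Charge} (hγ : γ ∈ chargesOut) {ψ : ℝ} (hψ : ψ ∈ sectorOut γ) :
    dir (chargeSign γ * D) ψ ∈
      goodDirs (semiflat R Z θ) chargesOut (contourOut D) apartCos c γ := by
  refine ⟨⟨dir_chargeSign_ne_zero N.norm_D γ ψ, fun γ' hγ' hp => ?_⟩, fun t ht => ?_⟩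
  · obtain ⟨h1, h2⟩ := sectorOut_apart hγ hγ' hp hψ
    exact apart_dir N.norm_D γ γ' h1 h2
  · have h := sectorOut_subset γ hψ
    exact N.norm_semiflat_le θ hγ ⟨by linarith [h.1], by linarith [h.2]⟩ ht

theorem NearWall.admissible_in (N : NearWall R Z D ηe ηm c) (θ : TwistedCharacter) :
    Admissible (semiflat R Z θ) chargesIn (contourIn D) apartCos c where
  nonneg := apartCos_pos.le
  lt_one := apartCos_lt_one
  two_le := N.two_le
  small := N.small
  sum_le γ hγ := by exact_mod_cast sum_pairing_le_in γ hγ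
  diff γ _ := differentiableOn_semiflat R Z θ γ
  unit γ _ γ' _ _ := by rw [contourIn, norm_dir, norm_chargeSign_mul, N.norm_D]
  mem _ _ _ hγ' _ := (N.goodDirs_in θ hγ' angleIn_mem).1
  decay _ _ _ hγ' _ := (N.goodDirs_in θ hγ' angleIn_mem).2

theorem NearWall.admissible_out (N : NearWall R Z D ηe ηm c) (θ : TwistedCharacter) :
    Admissible (semiflat R Z θ) chargesOut (contourOut D) apartCos c where
  nonneg := apartCos_pos.le
  lt_one := apartCos_lt_one
  two_le := N.two_le
  small := N.small
  sum_le γ hγ := by exact_mod_cast sum_pairing_le_out γ hγ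
  diff γ _ := differentiableOn_semiflat R Z θ γ
  unit γ _ γ' _ _ := by rw [contourOut, norm_dir, norm_chargeSign_mul, N.norm_D]
  mem γ _ γ' hγ' _ := (N.goodDirs_out θ hγ' (angleOut_mem γ γ')).1
  decay γ _ γ' hγ' _ := (N.goodDirs_out θ hγ' (angleOut_mem γ γ')).2

theorem dir_ne_dir (hD : ‖D‖ = 1) (γ γ' : Charge) {φ ψ : ℝ} (h : φ ≠ ψ) (h1 : |φ - ψ| ≤ 1) :
    dir (chargeSign γ * D) φ ≠ dir (chargeSign γ' * D) ψ := by
  have hD0 : D ≠ 0 := by rintro rfl; simp at hD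
  have n1 := smul_dir_ne hD0 (t := 1) one_pos h h1
  have n2 := smul_dir_add_ne hD0 (φ := φ) (ψ := ψ) one_pos one_pos h1
  simp only [Complex.ofReal_one, one_mul] at n1 n2
  rcases chargeSign_cases γ with h | h <;> rcases chargeSign_cases γ' with h' | h' <;>
    simp only [h, h', dir, one_mul, neg_mul] at * <;> intro he
  · exact n1 he
  · exact n2 (by rw [he]; ring)
  · exact n2 (by rw [← he]; ring)
  · exact n1 (neg_injective he)

end

variable {R : ℝ} {Z : Charge →+ ℂ} {D : ℂ} {ηe ηm c : ℝ}

/-- Here `ηm < 0 < ηe`: the electric contours turn up to `1/2` and the magnetic ones down to `-1/2`.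
They move apart, so neither sweep meets the other ray. -/
theorem sweep_in {γ γ' : Charge} (hγ : γ ∈ chargesIn) (hγ' : γ' ∈ chargesIn)
    (hp : pairing γ γ' ≠ 0) (he : 0 < ηe) (he' : ηe ≤ 1 / 8) (hm : ηm < 0) (hm' : -(1 / 8) ≤ ηm)
    {ψ : ℝ} (hψ : ψ ∈ Set.uIcc (rayAngle ηe ηm γ') (angleIn γ')) :
    ψ ∈ sectorIn γ' ∧ ψ ≠ rayAngle ηe ηm γ ∧ |ψ - rayAngle ηe ηm γ| ≤ 1 := by
  simp only [chargesIn, Finset.mem_insert, Finset.mem_singleton] at hγ hγ'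
  rcases hγ with rfl | rfl | rfl | rfl <;> rcases hγ' with rfl | rfl | rfl | rfl <;>
    first
    | exact absurd (by decide) hp
    | (norm_num [sectorIn, angleIn, rayAngle] at hψ ⊢
       rw [abs_le]
       first
       | (rw [Set.uIcc_of_le (by linarith)] at hψ
          exact ⟨by constructor <;> linarith [hψ.1, hψ.2], fun h => by linarith [hψ.1, hψ.2],
            by constructor <;> linarith [hψ.1, hψ.2]⟩)
       | (rw [Set.uIcc_of_ge (by linarith)] at hψ
          exact ⟨by constructor <;> linarith [hψ.1, hψ.2], fun h => by linarith [hψ.1, hψ.2],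
            by constructor <;> linarith [hψ.1, hψ.2]⟩))

/-- Here `ηe < 0 < ηm` with the bound state at angle 0: the electric contours turn down to `-1/4`
and the magnetic ones up to `1/4`. The bound-state contour moves away from the ray of the equation
in which it appears, to `1/8` for an electric charge and to `-1/8` for a magnetic one. -/
theorem sweep_out {γ γ' : Charge} (hγ : γ ∈ chargesOut) (hγ' : γ' ∈ chargesOut)
    (hp : pairing γ γ' ≠ 0) (he : ηe < 0) (he' : -(1 / 8) ≤ ηe) (hm : 0 < ηm) (hm' : ηm ≤ 1 / 8)
    {ψ : ℝ} (hψ : ψ ∈ Set.uIcc (rayAngle ηe ηm γ') (angleOut γ γ')) :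
    ψ ∈ sectorOut γ' ∧ ψ ≠ rayAngle ηe ηm γ ∧ |ψ - rayAngle ηe ηm γ| ≤ 1 := by
  simp only [chargesOut, Finset.mem_insert, Finset.mem_singleton] at hγ hγ'
  rcases hγ with rfl | rfl | rfl | rfl | rfl | rfl <;>
    rcases hγ' with rfl | rfl | rfl | rfl | rfl | rfl <;>
    first
    | exact absurd (by decide) hp
    | (norm_num [sectorOut, angleOut, rayAngle] at hψ ⊢
       rw [abs_le]
       first
       | exact ⟨by constructor <;> linarith [hψ.1, hψ.2], fun h => by linarith [hψ.1, hψ.2],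
            by constructor <;> linarith [hψ.1, hψ.2]⟩
       | (rw [Set.uIcc_of_le (by linarith)] at hψ
          exact ⟨by constructor <;> linarith [hψ.1, hψ.2], fun h => by linarith [hψ.1, hψ.2],
            by constructor <;> linarith [hψ.1, hψ.2]⟩)
       | (rw [Set.uIcc_of_ge (by linarith)] at hψ
          exact ⟨by constructor <;> linarith [hψ.1, hψ.2], fun h => by linarith [hψ.1, hψ.2],
            by constructor <;> linarith [hψ.1, hψ.2]⟩))

theorem rayAngle_mem_sectorIn (he : 0 ≤ ηe) (he' : ηe ≤ 1 / 8) (hm : ηm ≤ 0)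
    (hm' : -(1 / 8) ≤ ηm) (γ : Charge) : rayAngle ηe ηm γ ∈ sectorIn γ := by
  unfold rayAngle sectorIn
  split_ifs <;> constructor <;> linarith

theorem rayAngle_mem_sectorOut (he : ηe ≤ 0) (he' : -(1 / 8) ≤ ηe) (hm : 0 ≤ ηm)
    (hm' : ηm ≤ 1 / 8) (γ : Charge) : rayAngle ηe ηm γ ∈ sectorOut γ := by
  unfold rayAngle sectorOut
  split_ifs <;> constructor <;> linarith

theorem NearWall.rotates_in (N : NearWall R Z D ηe ηm c) (θ : TwistedCharacter) (he : 0 < ηe)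
    (hm : ηm < 0) : Rotates R Z θ chargesIn (contourIn D) apartCos c where
  ne_zero γ hγ := N.ne_zero γ (chargesIn_subset hγ)
  good γ hγ := by
    rw [N.ray γ (chargesIn_subset hγ)]
    exact N.goodDirs_in θ hγ (rayAngle_mem_sectorIn he.le (abs_le.1 N.abs_ηe).2 hm.le
      (abs_le.1 N.abs_ηm).1 γ)
  sweep γ hγ γ' hγ' hp := by
    refine ⟨chargeSign γ' * D, rayAngle ηe ηm γ', angleIn γ',
      (norm_chargeSign_mul γ' D).trans N.norm_D, N.ray γ' (chargesIn_subset hγ'), rfl,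
      fun ψ hψ => ?_⟩
    obtain ⟨h1, h2, h3⟩ := sweep_in hγ hγ' hp he (abs_le.1 N.abs_ηe).2 hm (abs_le.1 N.abs_ηm).1 hψ
    refine ⟨N.goodDirs_in θ hγ' h1, ?_⟩
    rw [N.ray γ (chargesIn_subset hγ)]
    exact dir_ne_dir N.norm_D _ _ h2 h3

theorem NearWall.rotates_out (N : NearWall R Z D ηe ηm c) (θ : TwistedCharacter) (he : ηe < 0)
    (hm : 0 < ηm) : Rotates R Z θ chargesOut (contourOut D) apartCos c where
  ne_zero γ hγ := N.ne_zero γ hγ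
  good γ hγ := by
    rw [N.ray γ hγ]
    exact N.goodDirs_out θ hγ (rayAngle_mem_sectorOut he.le (abs_le.1 N.abs_ηe).1 hm.le
      (abs_le.1 N.abs_ηm).2 γ)
  sweep γ hγ γ' hγ' hp := by
    refine ⟨chargeSign γ' * D, rayAngle ηe ηm γ', angleOut γ γ',
      (norm_chargeSign_mul γ' D).trans N.norm_D, N.ray γ' hγ', rfl, fun ψ hψ => ?_⟩
    obtain ⟨h1, h2, h3⟩ :=
      sweep_out hγ hγ' hp he (abs_le.1 N.abs_ηe).1 hm (abs_le.1 N.abs_ηm).2 hψ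
    refine ⟨N.goodDirs_out θ hγ' h1, ?_⟩
    rw [N.ray γ hγ]
    exact dir_ne_dir N.norm_D _ _ h2 h3

/-! ### The pentagon identity for small functions. -/

theorem log_add_log {u v : ℂ} (hu : 0 < u.re) (hv : 0 < v.re) :
    Complex.log u + Complex.log v = Complex.log (u * v) := by
  have hu0 : u ≠ 0 := by rintro rfl; simp at hu
  have hv0 : v ≠ 0 := by rintro rfl; simp at hv
  have h1 := abs_lt.1 (Complex.abs_arg_lt_pi_div_two_iff.2 (Or.inl hu))
  have h2 := abs_lt.1 (Complex.abs_arg_lt_pi_div_two_iff.2 (Or.inl hv))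
  exact (Complex.log_mul hu0 hv0 ⟨by linarith [h1.1, h2.1], by linarith [h1.2, h2.2]⟩).symm

theorem one_sub_re_pos {z : ℂ} (hz : ‖z‖ ≤ 1 / 2) : 0 < (1 - z).re := by
  have := (abs_le.1 (Complex.abs_re_le_norm z)).2
  simp; linarith

/-- Both functions have modulus less than `1/8`. -/
def Tiny (x y : ℂ) : Prop := ‖x‖ < 1 / 8 ∧ ‖y‖ < 1 / 8

namespace Tiny

variable {x y : ℂ}

theorem norm_one_sub_ge (h : ‖y‖ < 1 / 8) : 7 / 8 ≤ ‖1 - y‖ := by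
  have := norm_sub_norm_le 1 y
  rw [norm_one] at this; linarith

theorem symm (h : Tiny x y) : Tiny y x := ⟨h.2, h.1⟩

theorem norm_one_sub_sub_ge (h : Tiny x y) : 3 / 4 ≤ ‖1 - x - y‖ := by
  have h1 := norm_sub_norm_le (1 - x) y
  have h2 := norm_one_sub_ge h.1
  linarith [h.2]

theorem one_sub_ne (h : Tiny x y) : 1 - y ≠ 0 :=
  norm_pos_iff.1 (by linarith [norm_one_sub_ge h.2])

theorem one_sub_sub_ne (h : Tiny x y) : 1 - x - y ≠ 0 :=
  norm_pos_iff.1 (by linarith [h.norm_one_sub_sub_ge])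

theorem norm_div_le (h : Tiny x y) : ‖x / (1 - y)‖ ≤ 2 * ‖x‖ := by
  have := norm_one_sub_ge h.2
  rw [norm_div, div_le_iff₀ (by linarith)]
  nlinarith [norm_nonneg x]

theorem norm_bound_le (h : Tiny x y) : ‖-(x * y) / (1 - x - y)‖ ≤ ‖x‖ := by
  have h1 := h.norm_one_sub_sub_ge
  rw [norm_div, norm_neg, norm_mul, div_le_iff₀ (by linarith)]
  exact mul_le_mul_of_nonneg_left (by linarith [h.2]) (norm_nonneg x)

/-- With principal logarithms this is `(1 - x/(1 - y)) (1 + x y/(1 - x - y)) = 1 - x`; both factors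
have positive real part, so no multiple of `2πi` appears. -/
theorem log_bound_right (h : Tiny x y) :
    Complex.log (1 - x / (1 - y)) + Complex.log (1 - -(x * y) / (1 - x - y)) =
      Complex.log (1 - x) := by
  have h1 := h.norm_div_le
  have h2 := h.norm_bound_le
  rw [log_add_log (one_sub_re_pos (by linarith [h.1])) (one_sub_re_pos (by linarith [h.1]))]
  congr 1
  have := h.one_sub_ne
  have := h.one_sub_sub_ne
  field_simp
  ring

theorem log_sum (h : Tiny x y) :
    Complex.log (1 - x / (1 - y)) + Complex.log (1 - y) = Complex.log (1 - (x + y)) := by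
  have h1 := h.norm_div_le
  rw [log_add_log (one_sub_re_pos (by linarith [h.1])) (one_sub_re_pos (by linarith [h.2]))]
  congr 1
  have := h.one_sub_ne
  field_simp
  ring

theorem bound_comm (x y : ℂ) : -(x * y) / (1 - x - y) = -(y * x) / (1 - y - x) := by
  rw [mul_comm x, sub_right_comm]

theorem pentagon_mul (h : Tiny x y) :
    (1 - x / (1 - y)) * (1 - -(x * y) / (1 - x - y)) = 1 - x := by
  have := h.one_sub_ne
  have := h.one_sub_sub_ne
  field_simp
  ring

end Tiny

section

variable {c : ℝ} {D : ℂ} {φ₁ φ₂ : ℝ} {Ωx Ωy : Set ℂ} {x y : ℂ → ℂ}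

theorem SectorDamped.tiny (hc : 2 ≤ c) (hx : SectorDamped 3 c D φ₁ φ₂ Ωx x)
    (hy : SectorDamped 3 c D φ₁ φ₂ Ωy y) {t : ℝ} (ht : 0 < t) {ψ : ℝ} (hψ : ψ ∈ Set.uIcc φ₁ φ₂) :
    Tiny (x (t * dir D ψ)) (y (t * dir D ψ)) := by
  have h1 := hx.bound t ht ψ hψ
  have h2 := hy.bound t ht ψ hψ
  have h3 := damping_le hc ht
  exact ⟨by linarith, by linarith⟩

/-- The constant 8 was chosen for this: a quotient by `1 - y` at most doubles the bound 3, and a sum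
of two such functions is bounded by 6. -/
theorem SectorDamped.combine (hc : 2 ≤ c) (hx : SectorDamped 3 c D φ₁ φ₂ Ωx x)
    (hy : SectorDamped 3 c D φ₁ φ₂ Ωy y) :
    ∃ Ω, SectorDamped 8 c D φ₁ φ₂ Ω (fun z => x z / (1 - y z)) ∧
      SectorDamped 8 c D φ₁ φ₂ Ω (fun z => -(x z * y z) / (1 - x z - y z)) ∧
      SectorDamped 8 c D φ₁ φ₂ Ω (fun z => x z + y z) := by
  set Ω := (Ωx ∩ x ⁻¹' Metric.ball 0 (1 / 8)) ∩ (Ωy ∩ y ⁻¹' Metric.ball 0 (1 / 8)) with hΩ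
  have ho : IsOpen Ω := (hx.diff.continuousOn.isOpen_inter_preimage hx.isOpen Metric.isOpen_ball).inter
    (hy.diff.continuousOn.isOpen_inter_preimage hy.isOpen Metric.isOpen_ball)
  have hdx : DifferentiableOn ℂ x Ω := hx.diff.mono fun z hz => hz.1.1
  have hdy : DifferentiableOn ℂ y Ω := hy.diff.mono fun z hz => hz.2.1
  have htiny : ∀ z ∈ Ω, Tiny (x z) (y z) := fun z hz => by
    have h1 := hz.1.2
    have h2 := hz.2.2
    simp only [Set.mem_preimage, mem_ball_zero_iff] at h1 h2
    exact ⟨h1, h2⟩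
  have hm : ∀ t : ℝ, 0 < t → ∀ ψ ∈ Set.uIcc φ₁ φ₂, (t : ℂ) * dir D ψ ∈ Ω := fun t ht ψ hψ => by
    have := hx.tiny hc hy ht hψ
    exact ⟨⟨hx.mem t ht ψ hψ, by simpa using this.1⟩, ⟨hy.mem t ht ψ hψ, by simpa using this.2⟩⟩
  refine ⟨Ω, ⟨ho, ?_, hm, ?_⟩, ⟨ho, ?_, hm, ?_⟩, ⟨ho, hdx.add hdy, hm, ?_⟩⟩
  · exact hdx.div (hdy.const_sub 1) fun z hz => (htiny z hz).one_sub_ne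
  · intro t ht ψ hψ
    have := (hx.tiny hc hy ht hψ).norm_div_le
    linarith [hx.bound t ht ψ hψ, damping_pos c t]
  · exact (hdx.mul hdy).neg.div ((hdx.const_sub 1).sub hdy) fun z hz => (htiny z hz).one_sub_sub_ne
  · intro t ht ψ hψ
    have := (hx.tiny hc hy ht hψ).norm_bound_le
    linarith [hx.bound t ht ψ hψ, damping_pos c t]
  · intro t ht ψ hψ
    linarith [norm_add_le (x (t * dir D ψ)) (y (t * dir D ψ)), hx.bound t ht ψ hψ,
      hy.bound t ht ψ hψ, damping_pos c t]

end

/-! ### The exponents written out for each charge. -/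

/-- The contribution of the contour at the angle `φ` from `s D`. -/
noncomputable def sideTransform (D : ℂ) (s : ℤ) (φ : ℝ) (X : ℂ → ℂ) (ζ : ℂ) : ℂ :=
  cauchyTransform (dir ((s : ℂ) * D) φ) (fun z => Complex.log (1 - X z)) ζ

section

variable {D : ℂ} {s : ℤ}

theorem exponent_in_e (hs : s = 1 ∨ s = -1) (X : Charge → ℂ → ℂ) (ζ : ℂ) :
    contourExponent chargesIn (contourIn D) X (s, 0) ζ = -(1 / (4 * Real.pi * Complex.I)) *
      (-sideTransform D s (-(1 / 2)) (X (0, s)) ζ +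
        sideTransform D (-s) (-(1 / 2)) (X (0, -s)) ζ) := by
  unfold contourExponent
  congr 1
  rcases hs with rfl | rfl <;>
    simp [chargesIn, contourIn, pairing, chargeSign, angleIn, sideTransform]
  all_goals ring

theorem exponent_in_m (hs : s = 1 ∨ s = -1) (X : Charge → ℂ → ℂ) (ζ : ℂ) :
    contourExponent chargesIn (contourIn D) X (0, s) ζ = -(1 / (4 * Real.pi * Complex.I)) *
      (sideTransform D s (1 / 2) (X (s, 0)) ζ - sideTransform D (-s) (1 / 2) (X (-s, 0)) ζ) := by
  unfold contourExponent
  congr 1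
  rcases hs with rfl | rfl <;>
    simp [chargesIn, contourIn, pairing, chargeSign, angleIn, sideTransform]
  all_goals ring

theorem exponent_out_e (hs : s = 1 ∨ s = -1) (X : Charge → ℂ → ℂ) (ζ : ℂ) :
    contourExponent chargesOut (contourOut D) X (s, 0) ζ = -(1 / (4 * Real.pi * Complex.I)) *
      (-(sideTransform D s (1 / 4) (X (0, s)) ζ + sideTransform D s (1 / 8) (X (s, s)) ζ) +
        (sideTransform D (-s) (1 / 4) (X (0, -s)) ζ +
          sideTransform D (-s) (1 / 8) (X (-s, -s)) ζ)) := by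
  unfold contourExponent
  congr 1
  rcases hs with rfl | rfl <;>
    simp [chargesOut, contourOut, pairing, chargeSign, angleOut, sideTransform]
  all_goals ring

theorem exponent_out_m (hs : s = 1 ∨ s = -1) (X : Charge → ℂ → ℂ) (ζ : ℂ) :
    contourExponent chargesOut (contourOut D) X (0, s) ζ = -(1 / (4 * Real.pi * Complex.I)) *
      ((sideTransform D s (-(1 / 4)) (X (s, 0)) ζ + sideTransform D s (-(1 / 8)) (X (s, s)) ζ) -
        (sideTransform D (-s) (-(1 / 4)) (X (-s, 0)) ζ +
          sideTransform D (-s) (-(1 / 8)) (X (-s, -s)) ζ)) := by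
  unfold contourExponent
  congr 1
  rcases hs with rfl | rfl <;>
    simp [chargesOut, contourOut, pairing, chargeSign, angleOut, sideTransform]
  all_goals ring

theorem exponent_out_b (hs : s = 1 ∨ s = -1) (X : Charge → ℂ → ℂ) (ζ : ℂ) :
    contourExponent chargesOut (contourOut D) X (s, s) ζ = -(1 / (4 * Real.pi * Complex.I)) *
      (sideTransform D s (-(1 / 4)) (X (s, 0)) ζ - sideTransform D s (1 / 4) (X (0, s)) ζ -
        (sideTransform D (-s) (-(1 / 4)) (X (-s, 0)) ζ -
          sideTransform D (-s) (1 / 4) (X (0, -s)) ζ)) := by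
  unfold contourExponent
  congr 1
  rcases hs with rfl | rfl <;>
    simp [chargesOut, contourOut, pairing, chargeSign, angleOut, sideTransform]
  all_goals ring

end

/-- The minus sign is the twist `exp (iπ)` of the character, as `γ_e` and `γ_m` pair to `±1`; it
becomes the sign of the bound-state coordinate. -/
theorem semiflat_bound (R : ℝ) (Z : Charge →+ ℂ) (θ : TwistedCharacter) {s : ℤ}
    (hs : s = 1 ∨ s = -1) (ζ : ℂ) :
    semiflat R Z θ (s, s) ζ = -(semiflat R Z θ (s, 0) ζ * semiflat R Z θ (0, s) ζ) := by
  have hZ : Z (s, s) = Z (s, 0) + Z (0, s) := by rw [← map_add]; simp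
  have hθ : (((θ.toFun (s, 0)).toCircle : ℂ) * ((θ.toFun (0, s)).toCircle : ℂ)) =
      -((θ.toFun (s, s)).toCircle : ℂ) := by
    have h := θ.twist (s, 0) (0, s)
    have hp : ((pairing (s, 0) (0, s) : ℤ) : ℝ) = -1 := by
      rcases hs with rfl | rfl <;> simp [pairing]
    rw [hp, mul_neg, mul_one, Real.Angle.coe_neg, Real.Angle.neg_coe_pi] at h
    simp only [Prod.mk_add_mk, add_zero, zero_add] at h
    rw [← Circle.coe_mul, ← Real.Angle.toCircle_add, h, Real.Angle.toCircle_add, Circle.coe_mul,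
      Real.Angle.toCircle_coe, Circle.coe_exp, Complex.exp_pi_mul_I]
    ring
  unfold semiflat
  have e1 : Complex.exp ((Real.pi * R : ℝ) * Z (s, s) / ζ) =
      Complex.exp ((Real.pi * R : ℝ) * Z (s, 0) / ζ) *
        Complex.exp ((Real.pi * R : ℝ) * Z (0, s) / ζ) := by
    rw [← Complex.exp_add, hZ]; congr 1; ring
  have e2 : Complex.exp ((Real.pi * R : ℝ) * ζ * (starRingEnd ℂ) (Z (s, s))) =
      Complex.exp ((Real.pi * R : ℝ) * ζ * (starRingEnd ℂ) (Z (s, 0))) *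
        Complex.exp ((Real.pi * R : ℝ) * ζ * (starRingEnd ℂ) (Z (0, s))) := by
    rw [← Complex.exp_add, hZ, map_add]; congr 1; ring
  rw [e1, e2]
  linear_combination (-1) * (Complex.exp ((Real.pi * R : ℝ) * Z (s, 0) / ζ) *
        Complex.exp ((Real.pi * R : ℝ) * Z (0, s) / ζ)) *
        (Complex.exp ((Real.pi * R : ℝ) * ζ * (starRingEnd ℂ) (Z (s, 0))) *
        Complex.exp ((Real.pi * R : ℝ) * ζ * (starRingEnd ℂ) (Z (0, s)))) * -hθ

section

variable {c : ℝ} {D : ℂ} {s s' : ℤ}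

theorem smul_dir_ne_of_sign (hD : ‖D‖ = 1) (hs : s = 1 ∨ s = -1) (hs' : s' = s ∨ s' = -s)
    {t r ψ φ : ℝ} (ht : 0 < t) (hr : 0 < r) (h1 : |ψ - φ| ≤ 1) (h2 : s' = s → ψ ≠ φ) :
    (t : ℂ) * dir (s * D) ψ ≠ r * dir (s' * D) φ := by
  have hD0 : D ≠ 0 := by rintro rfl; simp at hD
  have hsD : (s : ℂ) * D ≠ 0 := by rcases hs with rfl | rfl <;> simpa using hD0
  rcases hs' with rfl | rfl
  · exact smul_dir_ne hsD ht (h2 rfl) h1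
  · have h := smul_dir_add_ne hsD (φ := ψ) (ψ := φ) ht hr h1
    intro he
    refine h ?_
    rw [he]; simp only [dir, Int.cast_neg]; ring

theorem norm_sign_mul (hD : ‖D‖ = 1) (hs : s = 1 ∨ s = -1) : ‖(s : ℂ) * D‖ = 1 := by
  rcases hs with rfl | rfl <;> simpa using hD

theorem sign_of_or (hs : s = 1 ∨ s = -1) (hs' : s' = s ∨ s' = -s) : s' = 1 ∨ s' = -1 := by
  omega

theorem sideTransform_rotate (hc : 2 ≤ c) (hD : ‖D‖ = 1) (hs : s = 1 ∨ s = -1)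
    (hs' : s' = s ∨ s' = -s) {φ₁ φ₂ : ℝ} {Ω : Set ℂ} {X : ℂ → ℂ}
    (hX : SectorDamped 8 c (s' * D) φ₁ φ₂ Ω X) {t ψ : ℝ} (ht : 0 < t)
    (h1 : ∀ φ ∈ Set.uIcc φ₁ φ₂, |ψ - φ| ≤ 1) (h2 : s' = s → ψ ∉ Set.uIcc φ₁ φ₂) :
    sideTransform D s' φ₁ X (t * dir (s * D) ψ) = sideTransform D s' φ₂ X (t * dir (s * D) ψ) := by
  refine (hX.log hc).cauchyTransform_eq (by linarith) (norm_sign_mul hD (sign_of_or hs hs')) ?_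
    fun φ hφ r hr => smul_dir_ne_of_sign hD hs hs' ht hr (h1 φ hφ) fun h => ?_
  · refine mul_ne_zero (by exact_mod_cast ht.ne') (norm_pos_iff.1 ?_)
    rw [norm_dir, norm_sign_mul hD hs]; norm_num
  · rintro rfl; exact h2 h hφ

theorem sideTransform_add (hc : 2 ≤ c) (hD : ‖D‖ = 1) (hs : s = 1 ∨ s = -1)
    (hs' : s' = s ∨ s' = -s) {φ : ℝ} {X X' X'' : ℂ → ℂ}
    (hX : Damped 8 c (dir (s' * D) φ) X) (hX' : Damped 8 c (dir (s' * D) φ) X')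
    (hlog : ∀ r : ℝ, 0 < r → Complex.log (1 - X (r * dir (s' * D) φ)) +
      Complex.log (1 - X' (r * dir (s' * D) φ)) = Complex.log (1 - X'' (r * dir (s' * D) φ)))
    {t ψ : ℝ} (ht : 0 < t) (h1 : |ψ - φ| ≤ 1) (h2 : s' = s → ψ ≠ φ) :
    sideTransform D s' φ X (t * dir (s * D) ψ) + sideTransform D s' φ X' (t * dir (s * D) ψ) =
      sideTransform D s' φ X'' (t * dir (s * D) ψ) := by
  have hd : ‖dir ((s' : ℂ) * D) φ‖ = 1 :=
    (norm_dir _ _).trans (norm_sign_mul hD (sign_of_or hs hs'))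
  have h0 : (t : ℂ) * dir (s * D) ψ ≠ 0 := by
    refine mul_ne_zero (by exact_mod_cast ht.ne') (norm_pos_iff.1 ?_)
    rw [norm_dir, norm_sign_mul hD hs]; norm_num
  obtain ⟨k, hk0, hk1, hk⟩ := exists_apart_dir hd h0
    fun r hr => smul_dir_ne_of_sign hD hs hs' ht hr h1 h2
  unfold sideTransform
  rw [← cauchyTransform_add (by linarith) hk0 hk1 hd (hX.log hc) (hX'.log hc) hk]
  exact cauchyTransform_congr hlog _

theorem sideTransform_jump (hc : 2 ≤ c) (hD : ‖D‖ = 1) (hs : s = 1 ∨ s = -1) {φ₁ φ₂ : ℝ}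
    {Ω : Set ℂ} {X : ℂ → ℂ} (hX : SectorDamped 8 c (s * D) φ₁ φ₂ Ω X) {t ψ : ℝ} (ht : 0 < t)
    (h1 : φ₁ < ψ) (h2 : ψ < φ₂) (h12 : φ₂ - φ₁ ≤ 1) :
    -(1 / (4 * Real.pi * Complex.I)) * (sideTransform D s φ₁ X (t * dir (s * D) ψ) -
      sideTransform D s φ₂ X (t * dir (s * D) ψ)) =
      -Complex.log (1 - X (t * dir (s * D) ψ)) := by
  unfold sideTransform
  rw [(hX.log hc).cauchyTransform_sub (by linarith) (norm_sign_mul hD hs) ht h1 h2 h12]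
  have hpi : (Real.pi : ℂ) ≠ 0 := by exact_mod_cast Real.pi_ne_zero
  field_simp [Complex.I_ne_zero]

end

/-! ### The crossed functions solve the outer equations. -/

/-- The solution on the outer side, in terms of the solution `Y` on the inner side. -/
noncomputable def crossed (Y : Charge → ℂ → ℂ) (γ : Charge) (z : ℂ) : ℂ :=
  if γ.2 = 0 then Y γ z / (1 - Y (0, γ.1) z)
  else if γ.1 = 0 then Y γ z / (1 - Y (γ.2, 0) z)
  else -(Y (γ.1, 0) z * Y (0, γ.2) z) / (1 - Y (γ.1, 0) z - Y (0, γ.2) z)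

theorem crossed_e (Y : Charge → ℂ → ℂ) (s : ℤ) :
    crossed Y (s, 0) = fun z => Y (s, 0) z / (1 - Y (0, s) z) := by
  ext z; simp [crossed]

theorem crossed_m (Y : Charge → ℂ → ℂ) {s : ℤ} (hs : s = 1 ∨ s = -1) :
    crossed Y (0, s) = fun z => Y (0, s) z / (1 - Y (s, 0) z) := by
  ext z; rcases hs with rfl | rfl <;> simp [crossed]

theorem crossed_b (Y : Charge → ℂ → ℂ) {s : ℤ} (hs : s = 1 ∨ s = -1) :
    crossed Y (s, s) = fun z => -(Y (s, 0) z * Y (0, s) z) / (1 - Y (s, 0) z - Y (0, s) z) := by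
  ext z; rcases hs with rfl | rfl <;> simp [crossed]

/-- The solutions `x`, `y` for the charges `s γ_e`, `s γ_m` on the inner side are holomorphic and
damped in the sectors around `s D`. -/
structure InnerPair (c : ℝ) (D : ℂ) (Y : Charge → ℂ → ℂ) (s : ℤ) : Prop where
  sector_e : ∃ Ω, SectorDamped 3 c (s * D) (-(1 / 4)) (1 / 2) Ω (Y (s, 0))
  sector_m : ∃ Ω, SectorDamped 3 c (s * D) (-(1 / 2)) (1 / 4) Ω (Y (0, s))

section

variable {c : ℝ} {D : ℂ} {Y : Charge → ℂ → ℂ} {s : ℤ}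

theorem uIcc_quarter : Set.uIcc (-(1 / 4) : ℝ) (1 / 4) = Set.Icc (-(1 / 4)) (1 / 4) :=
  Set.uIcc_of_le (by norm_num)

theorem InnerPair.middle_e (P : InnerPair c D Y s) :
    ∃ Ω, SectorDamped 3 c (s * D) (-(1 / 4)) (1 / 4) Ω (Y (s, 0)) := by
  obtain ⟨Ω, h⟩ := P.sector_e
  refine ⟨Ω, h.mono ?_ ?_⟩ <;> rw [Set.uIcc_of_le (by norm_num)] <;> constructor <;> norm_num

theorem InnerPair.middle_m (P : InnerPair c D Y s) :
    ∃ Ω, SectorDamped 3 c (s * D) (-(1 / 4)) (1 / 4) Ω (Y (0, s)) := by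
  obtain ⟨Ω, h⟩ := P.sector_m
  refine ⟨Ω, h.mono ?_ ?_⟩ <;> rw [Set.uIcc_of_le (by norm_num)] <;> constructor <;> norm_num

theorem InnerPair.tiny (P : InnerPair c D Y s) (hc : 2 ≤ c) {t ψ : ℝ} (ht : 0 < t)
    (hψ : ψ ∈ Set.Icc (-(1 / 4) : ℝ) (1 / 4)) :
    Tiny (Y (s, 0) (t * dir (s * D) ψ)) (Y (0, s) (t * dir (s * D) ψ)) := by
  obtain ⟨_, h1⟩ := P.middle_e
  obtain ⟨_, h2⟩ := P.middle_m
  exact h1.tiny hc h2 ht (by rwa [uIcc_quarter])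

theorem InnerPair.crossed_e (P : InnerPair c D Y s) (hc : 2 ≤ c) :
    ∃ Ω, SectorDamped 8 c (s * D) (-(1 / 4)) (1 / 4) Ω (crossed Y (s, 0)) := by
  obtain ⟨_, h1⟩ := P.middle_e
  obtain ⟨_, h2⟩ := P.middle_m
  obtain ⟨Ω, h, -, -⟩ := h1.combine hc h2
  exact ⟨Ω, by rwa [Pentagon.crossed_e]⟩

theorem InnerPair.crossed_m (P : InnerPair c D Y s) (hc : 2 ≤ c) (hs : s = 1 ∨ s = -1) :
    ∃ Ω, SectorDamped 8 c (s * D) (-(1 / 4)) (1 / 4) Ω (crossed Y (0, s)) := by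
  obtain ⟨_, h1⟩ := P.middle_e
  obtain ⟨_, h2⟩ := P.middle_m
  obtain ⟨Ω, h, -, -⟩ := h2.combine hc h1
  exact ⟨Ω, by rwa [Pentagon.crossed_m Y hs]⟩

theorem InnerPair.crossed_b (P : InnerPair c D Y s) (hc : 2 ≤ c) (hs : s = 1 ∨ s = -1) :
    ∃ Ω, SectorDamped 8 c (s * D) (-(1 / 4)) (1 / 4) Ω (crossed Y (s, s)) := by
  obtain ⟨_, h1⟩ := P.middle_e
  obtain ⟨_, h2⟩ := P.middle_m
  obtain ⟨Ω, -, h, -⟩ := h1.combine hc h2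
  exact ⟨Ω, by rwa [Pentagon.crossed_b Y hs]⟩

theorem InnerPair.sum (P : InnerPair c D Y s) (hc : 2 ≤ c) :
    ∃ Ω, SectorDamped 8 c (s * D) (-(1 / 4)) (1 / 4) Ω (fun z => Y (s, 0) z + Y (0, s) z) := by
  obtain ⟨_, h1⟩ := P.middle_e
  obtain ⟨_, h2⟩ := P.middle_m
  obtain ⟨Ω, -, -, h⟩ := h1.combine hc h2
  exact ⟨Ω, h⟩

/-- For evaluation angles in `[-1/4, 0]`, the bound-state contour can be moved from `1/8` to `1/4`
without crossing the evaluation point. There it meets the magnetic contour, and the two logarithms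
merge into that of the inner magnetic coordinate. -/
theorem InnerPair.transform_e {s' : ℤ} (P : InnerPair c D Y s') (hc : 2 ≤ c) (hD : ‖D‖ = 1)
    (hs : s = 1 ∨ s = -1) (hs' : s' = s ∨ s' = -s) {t ψ : ℝ} (ht : 0 < t)
    (hψ : ψ ∈ Set.Icc (-(1 / 4) : ℝ) 0) :
    sideTransform D s' (1 / 4) (crossed Y (0, s')) (t * dir (s * D) ψ) +
      sideTransform D s' (1 / 8) (crossed Y (s', s')) (t * dir (s * D) ψ) =
      sideTransform D s' (1 / 4) (Y (0, s')) (t * dir (s * D) ψ) := by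
  have hs1 := sign_of_or hs hs'
  obtain ⟨_, hm⟩ := P.crossed_m hc hs1
  obtain ⟨_, hb⟩ := P.crossed_b hc hs1
  have hmem : (1 / 8 : ℝ) ∈ Set.uIcc (-(1 / 4) : ℝ) (1 / 4) := by
    rw [uIcc_quarter]; constructor <;> norm_num
  rw [sideTransform_rotate hc hD hs hs' (hb.mono hmem Set.right_mem_uIcc) ht (φ₂ := 1 / 4)]
  · refine sideTransform_add hc hD hs hs' (hm.damped Set.right_mem_uIcc)
      (hb.damped Set.right_mem_uIcc) (fun r hr => ?_) ht ?_ fun _ => ?_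
    · rw [Pentagon.crossed_m Y hs1, Pentagon.crossed_b Y hs1]
      simp only
      rw [Tiny.bound_comm]
      exact (P.tiny hc hr (by constructor <;> norm_num)).symm.log_bound_right
    · rw [abs_le]; constructor <;> linarith [hψ.1, hψ.2]
    · linarith [hψ.2]
  · intro φ hφ
    rw [Set.uIcc_of_le (by norm_num)] at hφ
    rw [abs_le]; constructor <;> linarith [hψ.1, hψ.2, hφ.1, hφ.2]
  · intro _ h
    rw [Set.uIcc_of_le (by norm_num)] at h
    linarith [h.1, hψ.2]

theorem InnerPair.transform_m {s' : ℤ} (P : InnerPair c D Y s') (hc : 2 ≤ c) (hD : ‖D‖ = 1)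
    (hs : s = 1 ∨ s = -1) (hs' : s' = s ∨ s' = -s) {t ψ : ℝ} (ht : 0 < t)
    (hψ : ψ ∈ Set.Icc (0 : ℝ) (1 / 4)) :
    sideTransform D s' (-(1 / 4)) (crossed Y (s', 0)) (t * dir (s * D) ψ) +
      sideTransform D s' (-(1 / 8)) (crossed Y (s', s')) (t * dir (s * D) ψ) =
      sideTransform D s' (-(1 / 4)) (Y (s', 0)) (t * dir (s * D) ψ) := by
  have hs1 := sign_of_or hs hs'
  obtain ⟨_, he⟩ := P.crossed_e hc
  obtain ⟨_, hb⟩ := P.crossed_b hc hs1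
  have hmem : (-(1 / 8) : ℝ) ∈ Set.uIcc (-(1 / 4) : ℝ) (1 / 4) := by
    rw [uIcc_quarter]; constructor <;> norm_num
  rw [sideTransform_rotate hc hD hs hs' (hb.mono hmem Set.left_mem_uIcc) ht (φ₂ := -(1 / 4))]
  · refine sideTransform_add hc hD hs hs' (he.damped Set.left_mem_uIcc)
      (hb.damped Set.left_mem_uIcc) (fun r hr => ?_) ht ?_ fun _ => ?_
    · rw [Pentagon.crossed_e Y, Pentagon.crossed_b Y hs1]
      exact (P.tiny hc hr (by constructor <;> norm_num)).log_bound_right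
    · rw [abs_le]; constructor <;> linarith [hψ.1, hψ.2]
    · linarith [hψ.1]
  · intro φ hφ
    rw [Set.uIcc_of_ge (by norm_num)] at hφ
    rw [abs_le]; constructor <;> linarith [hψ.1, hψ.2, hφ.1, hφ.2]
  · intro _ h
    rw [Set.uIcc_of_ge (by norm_num)] at h
    linarith [h.2, hψ.1]

theorem InnerPair.rotate_e {s' : ℤ} (P : InnerPair c D Y s') (hc : 2 ≤ c) (hD : ‖D‖ = 1)
    (hs : s = 1 ∨ s = -1) (hs' : s' = s ∨ s' = -s) {t ψ φ : ℝ} (ht : 0 < t)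
    (hψ : ψ ∈ Set.Icc (-(1 / 4) : ℝ) (1 / 4)) (hφ : φ ∈ Set.Icc (-(1 / 4) : ℝ) (1 / 4))
    (hne : s' = s → ψ < φ) :
    sideTransform D s' (1 / 2) (Y (s', 0)) (t * dir (s * D) ψ) =
      sideTransform D s' φ (Y (s', 0)) (t * dir (s * D) ψ) := by
  obtain ⟨_, h⟩ := P.sector_e
  have hmem : φ ∈ Set.uIcc (-(1 / 4) : ℝ) (1 / 2) := by
    rw [Set.uIcc_of_le (by norm_num)]; constructor <;> linarith [hφ.1, hφ.2]
  refine sideTransform_rotate hc hD hs hs'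
    ((h.weaken (by norm_num)).mono Set.right_mem_uIcc hmem) ht (fun φ' hφ' => ?_) fun hs h' => ?_
  · rw [Set.uIcc_of_ge (by linarith [hφ.2])] at hφ'
    rw [abs_le]; constructor <;> linarith [hψ.1, hψ.2, hφ'.1, hφ'.2, hφ.1]
  · rw [Set.uIcc_of_ge (by linarith [hφ.2])] at h'
    linarith [h'.1, hne hs]

theorem InnerPair.rotate_m {s' : ℤ} (P : InnerPair c D Y s') (hc : 2 ≤ c) (hD : ‖D‖ = 1)
    (hs : s = 1 ∨ s = -1) (hs' : s' = s ∨ s' = -s) {t ψ φ : ℝ} (ht : 0 < t)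
    (hψ : ψ ∈ Set.Icc (-(1 / 4) : ℝ) (1 / 4)) (hφ : φ ∈ Set.Icc (-(1 / 4) : ℝ) (1 / 4))
    (hne : s' = s → φ < ψ) :
    sideTransform D s' (-(1 / 2)) (Y (0, s')) (t * dir (s * D) ψ) =
      sideTransform D s' φ (Y (0, s')) (t * dir (s * D) ψ) := by
  obtain ⟨_, h⟩ := P.sector_m
  have hmem : φ ∈ Set.uIcc (-(1 / 2) : ℝ) (1 / 4) := by
    rw [Set.uIcc_of_le (by norm_num)]; constructor <;> linarith [hφ.1, hφ.2]
  refine sideTransform_rotate hc hD hs hs'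
    ((h.weaken (by norm_num)).mono Set.left_mem_uIcc hmem) ht (fun φ' hφ' => ?_) fun hs h' => ?_
  · rw [Set.uIcc_of_le (by linarith [hφ.1])] at hφ'
    rw [abs_le]; constructor <;> linarith [hψ.1, hψ.2, hφ'.1, hφ'.2, hφ.2]
  · rw [Set.uIcc_of_le (by linarith [hφ.1])] at h'
    linarith [h'.2, hne hs]

theorem int_neg_ne (hs : s = 1 ∨ s = -1) : -s ≠ s := by omega

/-- After the merger, the two sides differ only in the position of the magnetic contour, `1/4`
against `-1/2`. For the same sign the evaluation point lies between them, and the residue is `-log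
(1 - Y_m)`; for the opposite sign nothing is crossed. Exponentiating gives the denominator `1 -
Y_m`. -/
theorem InnerPair.exponent_e (P : InnerPair c D Y s) (P' : InnerPair c D Y (-s)) (hc : 2 ≤ c)
    (hD : ‖D‖ = 1) (hs : s = 1 ∨ s = -1) {t ψ : ℝ} (ht : 0 < t)
    (hψ : ψ ∈ Set.Icc (-(1 / 4) : ℝ) 0) :
    contourExponent chargesOut (contourOut D) (crossed Y) (s, 0) (t * dir (s * D) ψ) =
      contourExponent chargesIn (contourIn D) Y (s, 0) (t * dir (s * D) ψ) -
        Complex.log (1 - Y (0, s) (t * dir (s * D) ψ)) := by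
  have hψ' : ψ ∈ Set.Icc (-(1 / 4) : ℝ) (1 / 4) := ⟨hψ.1, by linarith [hψ.2]⟩
  obtain ⟨_, hm⟩ := P.sector_m
  have hj := sideTransform_jump (ψ := ψ) hc hD hs (hm.weaken (by norm_num : (3 : ℝ) ≤ 8)) ht
    (by linarith [hψ.1]) (by linarith [hψ.2]) (by norm_num)
  rw [exponent_out_e hs, exponent_in_e hs, P.transform_e hc hD hs (Or.inl rfl) ht hψ,
    P'.transform_e hc hD hs (Or.inr rfl) ht hψ,
    ← P'.rotate_m hc hD hs (Or.inr rfl) ht hψ' (φ := 1 / 4) (by constructor <;> norm_num)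
      fun h => absurd h (int_neg_ne hs)]
  linear_combination hj

theorem InnerPair.exponent_m (P : InnerPair c D Y s) (P' : InnerPair c D Y (-s)) (hc : 2 ≤ c)
    (hD : ‖D‖ = 1) (hs : s = 1 ∨ s = -1) {t ψ : ℝ} (ht : 0 < t)
    (hψ : ψ ∈ Set.Icc (0 : ℝ) (1 / 4)) :
    contourExponent chargesOut (contourOut D) (crossed Y) (0, s) (t * dir (s * D) ψ) =
      contourExponent chargesIn (contourIn D) Y (0, s) (t * dir (s * D) ψ) -
        Complex.log (1 - Y (s, 0) (t * dir (s * D) ψ)) := by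
  have hψ' : ψ ∈ Set.Icc (-(1 / 4) : ℝ) (1 / 4) := ⟨by linarith [hψ.1], hψ.2⟩
  obtain ⟨_, he⟩ := P.sector_e
  have hj := sideTransform_jump (ψ := ψ) hc hD hs (he.weaken (by norm_num : (3 : ℝ) ≤ 8)) ht
    (by linarith [hψ.1]) (by linarith [hψ.2]) (by norm_num)
  rw [exponent_out_m hs, exponent_in_m hs, P.transform_m hc hD hs (Or.inl rfl) ht hψ,
    P'.transform_m hc hD hs (Or.inr rfl) ht hψ,
    ← P'.rotate_e hc hD hs (Or.inr rfl) ht hψ' (φ := -(1 / 4)) (by constructor <;> norm_num)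
      fun h => absurd h (int_neg_ne hs)]
  linear_combination hj

/-- The inner magnetic contour moves from `-1/2` to `-1/4`, onto the outer electric one, where `(1 -
x/(1 - y)) (1 - y) = 1 - (x + y)`. -/
theorem InnerPair.sum_left {s' : ℤ} (P : InnerPair c D Y s') (hc : 2 ≤ c) (hD : ‖D‖ = 1)
    (hs : s = 1 ∨ s = -1) (hs' : s' = s ∨ s' = -s) {t ψ : ℝ} (ht : 0 < t)
    (hψ : ψ ∈ Set.Icc (-(1 / 8) : ℝ) (1 / 8)) :
    sideTransform D s' (-(1 / 4)) (crossed Y (s', 0)) (t * dir (s * D) ψ) +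
      sideTransform D s' (-(1 / 2)) (Y (0, s')) (t * dir (s * D) ψ) =
      sideTransform D s' (-(1 / 4)) (fun z => Y (s', 0) z + Y (0, s') z) (t * dir (s * D) ψ) := by
  have hψ' : ψ ∈ Set.Icc (-(1 / 4) : ℝ) (1 / 4) := ⟨by linarith [hψ.1], by linarith [hψ.2]⟩
  obtain ⟨_, he⟩ := P.crossed_e hc
  obtain ⟨_, hm⟩ := P.middle_m
  rw [P.rotate_m hc hD hs hs' ht hψ' (φ := -(1 / 4)) (by constructor <;> norm_num)
    fun _ => by linarith [hψ.1]]
  refine sideTransform_add hc hD hs hs' (he.damped Set.left_mem_uIcc)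
    ((hm.weaken (by norm_num)).damped Set.left_mem_uIcc) (fun r hr => ?_) ht ?_ fun _ => ?_
  · rw [Pentagon.crossed_e Y]
    exact (P.tiny hc hr (by constructor <;> norm_num)).log_sum
  · rw [abs_le]; constructor <;> linarith [hψ.1, hψ.2]
  · linarith [hψ.1]

theorem InnerPair.sum_right {s' : ℤ} (P : InnerPair c D Y s') (hc : 2 ≤ c) (hD : ‖D‖ = 1)
    (hs : s = 1 ∨ s = -1) (hs' : s' = s ∨ s' = -s) {t ψ : ℝ} (ht : 0 < t)
    (hψ : ψ ∈ Set.Icc (-(1 / 8) : ℝ) (1 / 8)) :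
    sideTransform D s' (1 / 4) (crossed Y (0, s')) (t * dir (s * D) ψ) +
      sideTransform D s' (1 / 2) (Y (s', 0)) (t * dir (s * D) ψ) =
      sideTransform D s' (1 / 4) (fun z => Y (s', 0) z + Y (0, s') z) (t * dir (s * D) ψ) := by
  have hψ' : ψ ∈ Set.Icc (-(1 / 4) : ℝ) (1 / 4) := ⟨by linarith [hψ.1], by linarith [hψ.2]⟩
  obtain ⟨_, hm⟩ := P.crossed_m hc (sign_of_or hs hs')
  obtain ⟨_, he⟩ := P.middle_e
  rw [P.rotate_e hc hD hs hs' ht hψ' (φ := 1 / 4) (by constructor <;> norm_num)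
    fun _ => by linarith [hψ.2]]
  refine sideTransform_add hc hD hs hs' (hm.damped Set.right_mem_uIcc)
    ((he.weaken (by norm_num)).damped Set.right_mem_uIcc) (fun r hr => ?_) ht ?_ fun _ => ?_
  · rw [Pentagon.crossed_m Y (sign_of_or hs hs')]
    simp only
    rw [add_comm (Y (s', 0) _)]
    exact (P.tiny hc hr (by constructor <;> norm_num)).symm.log_sum
  · rw [abs_le]; constructor <;> linarith [hψ.1, hψ.2]
  · linarith [hψ.2]

/-- Moving the two inner exponents to the outer side of the equation completes both outer integrals
to transforms of `log (1 - (x + y))`, one at `-1/4` and one at `1/4`. Their difference is the jump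
at the evaluation point for the same sign, and vanishes for the opposite sign. -/
theorem InnerPair.exponent_b (P : InnerPair c D Y s) (P' : InnerPair c D Y (-s)) (hc : 2 ≤ c)
    (hD : ‖D‖ = 1) (hs : s = 1 ∨ s = -1) {t ψ : ℝ} (ht : 0 < t)
    (hψ : ψ ∈ Set.Icc (-(1 / 8) : ℝ) (1 / 8)) :
    contourExponent chargesOut (contourOut D) (crossed Y) (s, s) (t * dir (s * D) ψ) =
      contourExponent chargesIn (contourIn D) Y (s, 0) (t * dir (s * D) ψ) +
      contourExponent chargesIn (contourIn D) Y (0, s) (t * dir (s * D) ψ) -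
        Complex.log (1 - (Y (s, 0) (t * dir (s * D) ψ) + Y (0, s) (t * dir (s * D) ψ))) := by
  obtain ⟨_, hsum⟩ := P.sum hc
  have hj := sideTransform_jump (ψ := ψ) hc hD hs hsum ht
    (by linarith [hψ.1]) (by linarith [hψ.2]) (by norm_num)
  have hsum' := (P'.sum hc).choose_spec
  have hrot : sideTransform D (-s) (-(1 / 4)) (fun z => Y (-s, 0) z + Y (0, -s) z)
      (t * dir (s * D) ψ) = sideTransform D (-s) (1 / 4) (fun z => Y (-s, 0) z + Y (0, -s) z)
      (t * dir (s * D) ψ) := by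
    refine sideTransform_rotate hc hD hs (Or.inr rfl) hsum' ht (fun φ hφ => ?_)
      fun h => absurd h (int_neg_ne hs)
    rw [uIcc_quarter] at hφ
    rw [abs_le]; constructor <;> linarith [hψ.1, hψ.2, hφ.1, hφ.2]
  have a1 := P.sum_left hc hD hs (Or.inl rfl) ht hψ
  have a2 := P.sum_right hc hD hs (Or.inl rfl) ht hψ
  have a3 := P'.sum_left hc hD hs (Or.inr rfl) ht hψ
  have a4 := P'.sum_right hc hD hs (Or.inr rfl) ht hψ
  rw [exponent_out_b hs, exponent_in_e hs, exponent_in_m hs]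
  linear_combination hj + (-(1 / (4 * Real.pi * Complex.I))) * (a1 - a2 - a3 + a4 - hrot)

end

/-! ### Identification of the outer solution with the crossed inner solution. -/

section

variable {R : ℝ} {Z : Charge →+ ℂ} {D : ℂ} {ηe ηm c : ℝ}

/-- The solution along the rotated contours on the inner side. -/
noncomputable def solutionIn (R : ℝ) (Z : Charge →+ ℂ) (θ : TwistedCharacter) (D : ℂ) :
    Charge → ℂ → ℂ :=
  contourLimit (semiflat R Z θ) chargesIn (contourIn D)

/-- The solution along the rotated contours on the outer side. -/
noncomputable def solutionOut (R : ℝ) (Z : Charge →+ ℂ) (θ : TwistedCharacter) (D : ℂ) :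
    Charge → ℂ → ℂ :=
  contourLimit (semiflat R Z θ) chargesOut (contourOut D)

theorem chargeSign_of_sign {s : ℤ} (hs : s = 1 ∨ s = -1) :
    chargeSign (s, 0) = s ∧ chargeSign (0, s) = s ∧ chargeSign (s, s) = s := by
  rcases hs with rfl | rfl <;> simp [chargeSign]

theorem mem_charges {s : ℤ} (hs : s = 1 ∨ s = -1) :
    (s, 0) ∈ chargesIn ∧ (0, s) ∈ chargesIn ∧ (s, s) ∈ chargesOut := by
  rcases hs with rfl | rfl <;> decide

theorem NearWall.innerPair (N : NearWall R Z D ηe ηm c) (θ : TwistedCharacter) {s : ℤ}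
    (hs : s = 1 ∨ s = -1) : InnerPair c D (solutionIn R Z θ D) s := by
  have H := N.admissible_in θ
  obtain ⟨h1, h2, -⟩ := chargeSign_of_sign hs
  obtain ⟨m1, m2, -⟩ := mem_charges hs
  have hs0 : s ≠ 0 := by omega
  constructor
  · rw [← h1]
    refine ⟨_, sectorDamped_of_goodDirs (H.differentiableOn_limit m1) (fun ψ hψ => ?_)
      fun ψ hψ t ht => ?_⟩
    · exact (N.goodDirs_in θ m1 (by rwa [Set.uIcc_of_le (by norm_num)] at hψ)).1
    · exact H.norm_limit_le_damping m1
        (N.goodDirs_in θ m1 (by rwa [Set.uIcc_of_le (by norm_num)] at hψ)) ht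
  · have e : sectorIn (0, s) = Set.Icc (-(1 / 2)) (1 / 4) := by simp [sectorIn, hs0]
    rw [← h2]
    refine ⟨_, sectorDamped_of_goodDirs (H.differentiableOn_limit m2) (fun ψ hψ => ?_)
      fun ψ hψ t ht => ?_⟩
    · exact (N.goodDirs_in θ m2 (by rwa [Set.uIcc_of_le (by norm_num), ← e] at hψ)).1
    · exact H.norm_limit_le_damping m2
        (N.goodDirs_in θ m2 (by rwa [Set.uIcc_of_le (by norm_num), ← e] at hψ)) ht

theorem neg_sign {s : ℤ} (hs : s = 1 ∨ s = -1) : -s = 1 ∨ -s = -1 := by omega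

theorem exp_sub_log {a u : ℂ} (hu : u ≠ 0) :
    Complex.exp (a - Complex.log u) = Complex.exp a / u := by
  rw [Complex.exp_sub, Complex.exp_log hu]

theorem NearWall.solutionIn_eq (N : NearWall R Z D ηe ηm c) (θ : TwistedCharacter) {γ : Charge}
    (hγ : γ ∈ chargesIn) {t ψ : ℝ} (ht : 0 < t) (hψ : ψ ∈ Set.Icc (-(1 / 4) : ℝ) (1 / 4)) :
    solutionIn R Z θ D γ (t * dir (chargeSign γ * D) ψ) =
      semiflat R Z θ γ (t * dir (chargeSign γ * D) ψ) * Complex.exp (contourExponent chargesIn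
        (contourIn D) (solutionIn R Z θ D) γ (t * dir (chargeSign γ * D) ψ)) := by
  refine (N.admissible_in θ).limit_eq hγ (smul_mem_contourDomain (N.goodDirs_in θ hγ ?_).1 ht)
  unfold sectorIn
  split_ifs <;> constructor <;> linarith [hψ.1, hψ.2]

/-- Exponentiating the three exponent identities turns each logarithm into a denominator. For the
bound state, `semiflat_bound` and the inner equations for `γ_e`, `γ_m` assemble the numerator `-x
y`. -/
theorem NearWall.crossed_eq_step (N : NearWall R Z D ηe ηm c) (θ : TwistedCharacter)
    {γ : Charge} (hγ : γ ∈ chargesOut) {t ψ : ℝ} (ht : 0 < t) (hψ : ψ ∈ sectorOut γ) :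
    crossed (solutionIn R Z θ D) γ (t * dir (chargeSign γ * D) ψ) =
      contourStep (semiflat R Z θ) chargesOut (contourOut D) (crossed (solutionIn R Z θ D)) γ
        (t * dir (chargeSign γ * D) ψ) := by
  have hψ' := sectorOut_subset γ hψ
  have key : ∀ s : ℤ, s = 1 ∨ s = -1 → γ = (s, 0) ∨ γ = (0, s) ∨ γ = (s, s) →
      crossed (solutionIn R Z θ D) γ (t * dir (chargeSign γ * D) ψ) =
      contourStep (semiflat R Z θ) chargesOut (contourOut D) (crossed (solutionIn R Z θ D)) γ
        (t * dir (chargeSign γ * D) ψ) := by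
    intro s hs hγs
    have hs0 : s ≠ 0 := by omega
    have P := N.innerPair θ hs
    have P' := N.innerPair θ (neg_sign hs)
    obtain ⟨h1, h2, h3⟩ := chargeSign_of_sign hs
    obtain ⟨m1, m2, -⟩ := mem_charges hs
    have ht' := P.tiny N.two_le ht hψ'
    have e1 := N.solutionIn_eq θ m1 ht hψ'
    have e2 := N.solutionIn_eq θ m2 ht hψ'
    rw [h1] at e1
    rw [h2] at e2
    rcases hγs with rfl | rfl | rfl
    · rw [h1, crossed_e, contourStep, P.exponent_e P' N.two_le N.norm_D hs ht
        (by simpa [sectorOut] using hψ), exp_sub_log ht'.one_sub_ne]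
      simp only
      rw [mul_div_assoc', ← e1]
    · rw [h2, contourStep, P.exponent_m P' N.two_le N.norm_D hs ht
        (by simpa [sectorOut, hs0] using hψ), exp_sub_log ht'.symm.one_sub_ne, crossed_m _ hs]
      simp only
      rw [mul_div_assoc', ← e2]
    · rw [h3, contourStep, P.exponent_b P' N.two_le N.norm_D hs ht
        (by simpa [sectorOut, hs0] using hψ), exp_sub_log, crossed_b _ hs, semiflat_bound R Z θ hs]
      · simp only
        rw [Complex.exp_add, mul_div_assoc', sub_sub]
        congr 1
        conv_lhs => rw [e1, e2]
        ring
      · rw [← sub_sub]; exact ht'.one_sub_sub_ne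
  simp only [chargesOut, Finset.mem_insert, Finset.mem_singleton] at hγ
  rcases hγ with h | h | h | h | h | h
  · exact key 1 (Or.inl rfl) (Or.inl h)
  · exact key (-1) (Or.inr rfl) (Or.inl h)
  · exact key 1 (Or.inl rfl) (Or.inr (Or.inl h))
  · exact key (-1) (Or.inr rfl) (Or.inr (Or.inl h))
  · exact key 1 (Or.inl rfl) (Or.inr (Or.inr h))
  · exact key (-1) (Or.inr rfl) (Or.inr (Or.inr h))

theorem NearWall.tame_crossed (N : NearWall R Z D ηe ηm c) (θ : TwistedCharacter) :
    Tame chargesOut (contourOut D) c (crossed (solutionIn R Z θ D)) := by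
  intro γ hγ γ' hγ' _
  have hψ := angleOut_mem γ γ'
  have hψ' : angleOut γ γ' ∈ Set.uIcc (-(1 / 4) : ℝ) (1 / 4) := by
    rw [uIcc_quarter]; exact sectorOut_subset γ' hψ
  have key : ∀ s : ℤ, s = 1 ∨ s = -1 → γ' = (s, 0) ∨ γ' = (0, s) ∨ γ' = (s, s) →
      Damped 8 c (contourOut D γ γ') (crossed (solutionIn R Z θ D) γ') := by
    intro s hs hγs
    have P := N.innerPair θ hs
    obtain ⟨h1, h2, h3⟩ := chargeSign_of_sign hs
    unfold contourOut
    rcases hγs with rfl | rfl | rfl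
    · rw [h1]
      exact (P.crossed_e N.two_le).choose_spec.damped hψ'
    · rw [h2]
      exact (P.crossed_m N.two_le hs).choose_spec.damped hψ'
    · rw [h3]
      exact (P.crossed_b N.two_le hs).choose_spec.damped hψ'
  simp only [chargesOut, Finset.mem_insert, Finset.mem_singleton] at hγ'
  rcases hγ' with h | h | h | h | h | h
  · exact key 1 (Or.inl rfl) (Or.inl h)
  · exact key (-1) (Or.inr rfl) (Or.inl h)
  · exact key 1 (Or.inl rfl) (Or.inr (Or.inl h))
  · exact key (-1) (Or.inr rfl) (Or.inr (Or.inl h))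
  · exact key 1 (Or.inl rfl) (Or.inr (Or.inr h))
  · exact key (-1) (Or.inr rfl) (Or.inr (Or.inr h))

/-- The solutions on the two sides of the wall are related by the pentagon identity. -/
theorem NearWall.solutionOut_eq_crossed (N : NearWall R Z D ηe ηm c) (θ : TwistedCharacter)
    {γ : Charge} (hγ : γ ∈ chargesOut) {t ψ : ℝ} (ht : 0 < t) (hψ : ψ ∈ sectorOut γ) :
    solutionOut R Z θ D γ (t * dir (chargeSign γ * D) ψ) =
      crossed (solutionIn R Z θ D) γ (t * dir (chargeSign γ * D) ψ) := by
  rw [N.crossed_eq_step θ hγ ht hψ]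
  exact ((N.admissible_out θ).eq_limit_of_eq_step (N.tame_crossed θ)
    (fun γ₁ _ γ₂ h₂ _ r hr => N.crossed_eq_step θ h₂ hr (angleOut_mem γ₁ γ₂)) hγ
    (smul_mem_contourDomain (N.goodDirs_out θ hγ hψ).1 ht)).symm

theorem zero_mem_sectorOut (γ : Charge) : (0 : ℝ) ∈ sectorOut γ := by
  unfold sectorOut; split_ifs <;> norm_num

/-- Angle 0 belongs to every outer sector, so all three crossed formulas hold along the reference
direction, where the rays lie when the central charge is on the wall. -/
theorem NearWall.pentagon_e (N : NearWall R Z D ηe ηm c) (θ : TwistedCharacter) {s : ℤ}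
    (hs : s = 1 ∨ s = -1) {t : ℝ} (ht : 0 < t) :
    (1 - solutionOut R Z θ D (s, 0) (t * (s * D))) * (1 - solutionOut R Z θ D (s, s) (t * (s * D)))
      = 1 - solutionIn R Z θ D (s, 0) (t * (s * D)) := by
  obtain ⟨h1, h2, h3⟩ := chargeSign_of_sign hs
  obtain ⟨m1, m2, m3⟩ := mem_charges hs
  have e1 := N.solutionOut_eq_crossed θ (chargesIn_subset m1) ht (zero_mem_sectorOut _)
  have e3 := N.solutionOut_eq_crossed θ m3 ht (zero_mem_sectorOut _)
  have htiny := (N.innerPair θ hs).tiny N.two_le ht (ψ := 0) (by constructor <;> norm_num)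
  rw [h1, crossed_e] at e1
  rw [h3, crossed_b _ hs] at e3
  rw [dir_zero] at e1 e3 htiny
  rw [e1, e3]
  exact htiny.pentagon_mul

theorem NearWall.pentagon_m (N : NearWall R Z D ηe ηm c) (θ : TwistedCharacter) {s : ℤ}
    (hs : s = 1 ∨ s = -1) {t : ℝ} (ht : 0 < t) :
    (1 - solutionOut R Z θ D (0, s) (t * (s * D))) * (1 - solutionOut R Z θ D (s, s) (t * (s * D)))
      = 1 - solutionIn R Z θ D (0, s) (t * (s * D)) := by
  obtain ⟨h1, h2, h3⟩ := chargeSign_of_sign hs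
  obtain ⟨m1, m2, m3⟩ := mem_charges hs
  have e1 := N.solutionOut_eq_crossed θ (chargesIn_subset m2) ht (zero_mem_sectorOut _)
  have e3 := N.solutionOut_eq_crossed θ m3 ht (zero_mem_sectorOut _)
  have htiny := (N.innerPair θ hs).tiny N.two_le ht (ψ := 0) (by constructor <;> norm_num)
  rw [h2, crossed_m _ hs] at e1
  rw [h3, crossed_b _ hs] at e3
  rw [dir_zero] at e1 e3 htiny
  rw [e1, e3]
  simp only
  rw [Tiny.bound_comm]
  exact htiny.symm.pentagon_mul

end

/-! ### The gauge integrands and their limits. -/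

section

variable {R : ℝ} {Z : Charge →+ ℂ} {Ω : Charge → ℤ} {θ : TwistedCharacter} {G : Finset Charge}
  {d : Charge → Charge → ℂ} {k c : ℝ}

theorem rayDir_neg (Z : Charge →+ ℂ) (γ : Charge) : rayDir Z (-γ) = -rayDir Z γ := by
  simp [rayDir, neg_div]

theorem exp_arg_eq {Z : Charge →+ ℂ} {γ : Charge} (h : Z γ ≠ 0) :
    Complex.exp (Complex.I * (Z γ).arg) = -rayDir Z γ := by
  have hn : (‖Z γ‖ : ℂ) ≠ 0 := by exact_mod_cast norm_ne_zero_iff.2 h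
  rw [rayDir, neg_neg, eq_div_iff hn, mul_comm, mul_comm Complex.I]
  exact Complex.norm_mul_exp_arg_mul_I (Z γ)

/-- The integrand of the gauge function, for functions given on the rays. -/
noncomputable def rayGauge (Y : Charge → ℂ → ℂ) (Z : Charge →+ ℂ) (γ : Charge) (t : ℝ) : ℝ :=
  t⁻¹ * ((Complex.log (1 - Y γ (t * rayDir Z γ))).re -
    (Complex.log (1 - Y (-γ) (t * rayDir Z (-γ)))).re)

theorem log_norm_div {u v : ℂ} (hu : u ≠ 0) (hv : v ≠ 0) :
    Real.log ‖u / v‖ = (Complex.log u).re - (Complex.log v).re := by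
  rw [norm_div, Real.log_div (norm_ne_zero_iff.2 hu) (norm_ne_zero_iff.2 hv), Complex.log_re,
    Complex.log_re]

theorem one_sub_ne_zero {z : ℂ} (hz : ‖z‖ ≤ 1 / 2) : 1 - z ≠ 0 := by
  intro h
  have := one_sub_re_pos hz
  rw [h] at this; simp at this

/-- The points `-t e^{iφ}` and `t e^{iφ}` with `φ = arg Z_γ` lie on `ℓ_γ` and `ℓ_{-γ}`. Thus the
gauge functions see own-ray values only, which are those of the rotated solution. -/
theorem Rotates.gaugeIntegrand_eq (S : Rotates R Z θ G d k c)
    (H : Admissible (semiflat R Z θ) G d k c) (hΩ : ∀ γ, Ω γ = if γ ∈ G then 1 else 0)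
    {γ : Charge} (hγ : γ ∈ G) (hγ' : -γ ∈ G) {t : ℝ} (ht : 0 < t) :
    gaugeIntegrand Z (darboux R Z Ω θ) γ t =
      rayGauge (contourLimit (semiflat R Z θ) G d) Z γ t := by
  have e1 : -(t : ℂ) * Complex.exp (Complex.I * (Z γ).arg) = t * rayDir Z γ := by
    rw [exp_arg_eq (S.ne_zero γ hγ)]; ring
  have e2 : (t : ℂ) * Complex.exp (Complex.I * (Z γ).arg) = t * rayDir Z (-γ) := by
    rw [exp_arg_eq (S.ne_zero γ hγ), rayDir_neg]
  rw [gaugeIntegrand, rayGauge, e1, e2, S.darboux_eq_limit H hΩ hγ ht,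
    S.darboux_eq_limit H hΩ hγ' ht]
  rw [log_norm_div
    (one_sub_ne_zero ((H.damped_limit hγ (S.good γ hγ)).le_half H.two_le ht))
    (one_sub_ne_zero ((H.damped_limit hγ' (S.good _ hγ')).le_half H.two_le ht))]

theorem norm_rayGauge_le {Y : Charge → ℂ → ℂ} {γ : Charge} (hc : 2 ≤ c)
    (h1 : Damped 8 c (rayDir Z γ) (Y γ)) (h2 : Damped 8 c (rayDir Z (-γ)) (Y (-γ))) {t : ℝ}
    (ht : 0 < t) : ‖rayGauge Y Z γ t‖ ≤ 24 * (t⁻¹ * damping c t) := by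
  have b1 := (h1.log hc).bound t ht
  have b2 := (h2.log hc).bound t ht
  have r1 := Complex.abs_re_le_norm (Complex.log (1 - Y γ (t * rayDir Z γ)))
  have r2 := Complex.abs_re_le_norm (Complex.log (1 - Y (-γ) (t * rayDir Z (-γ))))
  rw [rayGauge, norm_mul, norm_inv, Real.norm_of_nonneg ht.le, Real.norm_eq_abs]
  have := abs_sub (Complex.log (1 - Y γ (t * rayDir Z γ))).re
    (Complex.log (1 - Y (-γ) (t * rayDir Z (-γ)))).re
  calc t⁻¹ * _ ≤ t⁻¹ * (24 * damping c t) := by gcongr; linarith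
    _ = _ := by ring

theorem intervalIntegrable_bound (hc : 0 < c) :
    IntervalIntegrable (fun t => 24 * (t⁻¹ * damping c t)) volume 0 1 := by
  rw [intervalIntegrable_iff_integrableOn_Ioc_of_le zero_le_one]
  exact IntegrableOn.mono_set ((integrableOn_inv_mul_damping hc).const_mul 24)
    Set.Ioc_subset_Ioi_self

theorem aestronglyMeasurable_rayGauge {Y : Charge → ℂ → ℂ} {γ : Charge} (hc : 2 ≤ c)
    (h1 : Damped 8 c (rayDir Z γ) (Y γ)) (h2 : Damped 8 c (rayDir Z (-γ)) (Y (-γ))) :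
    AEStronglyMeasurable (rayGauge Y Z γ) (volume.restrict (Set.uIoc 0 1)) := by
  have hs : Set.uIoc (0 : ℝ) 1 ⊆ Set.Ioi 0 := by
    rw [Set.uIoc_of_le zero_le_one]; exact Set.Ioc_subset_Ioi_self
  have m0 : Measurable fun t : ℝ => t⁻¹ := measurable_inv
  have m1 := Complex.continuous_re.comp_aestronglyMeasurable (h1.log hc).meas
  have m2 := Complex.continuous_re.comp_aestronglyMeasurable (h2.log hc).meas
  exact (m0.aestronglyMeasurable.mul (m1.sub m2)).mono_measure (Measure.restrict_mono hs le_rfl)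

theorem intervalIntegrable_rayGauge {Y : Charge → ℂ → ℂ} {γ : Charge} (hc : 2 ≤ c)
    (h1 : Damped 8 c (rayDir Z γ) (Y γ)) (h2 : Damped 8 c (rayDir Z (-γ)) (Y (-γ))) :
    IntervalIntegrable (rayGauge Y Z γ) volume 0 1 := by
  refine (intervalIntegrable_bound (by linarith : 0 < c)).mono_fun'
    (aestronglyMeasurable_rayGauge hc h1 h2) ?_
  filter_upwards [ae_restrict_mem measurableSet_uIoc] with t ht
  rw [Set.uIoc_of_le zero_le_one] at ht
  exact norm_rayGauge_le hc h1 h2 ht.1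

theorem Rotates.intervalIntegrable_gaugeIntegrand (S : Rotates R Z θ G d k c)
    (H : Admissible (semiflat R Z θ) G d k c) (hΩ : ∀ γ, Ω γ = if γ ∈ G then 1 else 0)
    {γ : Charge} (hγ : γ ∈ G) (hγ' : -γ ∈ G) :
    IntervalIntegrable (gaugeIntegrand Z (darboux R Z Ω θ) γ) volume 0 1 := by
  refine (intervalIntegrable_rayGauge H.two_le (H.damped_limit hγ (S.good γ hγ))
    (H.damped_limit hγ' (S.good _ hγ'))).congr fun t ht => ?_
  rw [Set.uIoc_of_le zero_le_one] at ht
  exact (S.gaugeIntegrand_eq H hΩ hγ hγ' ht.1).symm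

theorem Rotates.integral_gaugeIntegrand (S : Rotates R Z θ G d k c)
    (H : Admissible (semiflat R Z θ) G d k c) (hΩ : ∀ γ, Ω γ = if γ ∈ G then 1 else 0)
    {γ : Charge} (hγ : γ ∈ G) (hγ' : -γ ∈ G) :
    ∫ t in (0 : ℝ)..1, gaugeIntegrand Z (darboux R Z Ω θ) γ t =
      ∫ t in (0 : ℝ)..1, rayGauge (contourLimit (semiflat R Z θ) G d) Z γ t := by
  refine intervalIntegral.integral_congr_ae (Eventually.of_forall fun t ht => ?_)
  rw [Set.uIoc_of_le zero_le_one] at ht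
  exact S.gaugeIntegrand_eq H hΩ hγ hγ' ht.1

end

section

variable {ι : Type*} {l : Filter ι} {R : ℝ} {Z : ι → Charge →+ ℂ} {Z₀ : Charge →+ ℂ}
  {θ : TwistedCharacter} {G : Finset Charge} {d : ι → Charge → Charge → ℂ}
  {d₀ : Charge → Charge → ℂ} {k c : ℝ}

theorem tendsto_rayDir {γ : Charge} (hZ : Tendsto (fun i => Z i γ) l (𝓝 (Z₀ γ)))
    (h0 : Z₀ γ ≠ 0) : Tendsto (fun i => rayDir (Z i) γ) l (𝓝 (rayDir Z₀ γ)) := by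
  have hn : (‖Z₀ γ‖ : ℂ) ≠ 0 := by exact_mod_cast norm_ne_zero_iff.2 h0
  exact (hZ.div ((Complex.continuous_ofReal.tendsto _).comp hZ.norm) hn).neg

theorem tendsto_semiflat {γ : Charge} (hZ : Tendsto (fun i => Z i γ) l (𝓝 (Z₀ γ)))
    {ζ : ι → ℂ} {ζ₀ : ℂ} (hζ : Tendsto ζ l (𝓝 ζ₀)) (h0 : ζ₀ ≠ 0) :
    Tendsto (fun i => semiflat R (Z i) θ γ (ζ i)) l (𝓝 (semiflat R Z₀ θ γ ζ₀)) := by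
  unfold semiflat
  refine Tendsto.mul (Tendsto.mul ?_ tendsto_const_nhds) ?_
  · exact (Complex.continuous_exp.tendsto _).comp ((hZ.const_mul _).div hζ h0)
  · exact (Complex.continuous_exp.tendsto _).comp
      ((hζ.const_mul _).mul ((Complex.continuous_conj.tendsto _).comp hZ))

/-- Dominated convergence with majorant `24 t⁻¹ damping c t`. `Rotates` is required along the filter
only: at the wall itself rays of charges with nonzero pairing coincide, and the limit is expressed
by the rotated contours, which stay apart. -/
theorem ConvergesTo.tendsto_integral_gauge [l.IsCountablyGenerated] {Ω : Charge → ℤ}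
    (T : ConvergesTo l (fun i => semiflat R (Z i) θ) (semiflat R Z₀ θ) G d d₀ k c)
    (hΩ : ∀ γ, Ω γ = if γ ∈ G then 1 else 0)
    (hS : ∀ᶠ i in l, Rotates R (Z i) θ G (d i) k c)
    (hZ : ∀ γ, Tendsto (fun i => Z i γ) l (𝓝 (Z₀ γ)))
    (h0 : ∀ γ ∈ G, Z₀ γ ≠ 0)
    (hgood : ∀ γ ∈ G, rayDir Z₀ γ ∈ goodDirs (semiflat R Z₀ θ) G d₀ k c γ)
    {γ : Charge} (hγ : γ ∈ G) (hγ' : -γ ∈ G) :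
    Tendsto (fun i => ∫ t in (0 : ℝ)..1, gaugeIntegrand (Z i) (darboux R (Z i) Ω θ) γ t) l
      (𝓝 (∫ t in (0 : ℝ)..1, rayGauge (contourLimit (semiflat R Z₀ θ) G d₀) Z₀ γ t)) := by
  have H₀ := T.admissible₀
  have hc : 0 < c := by linarith [H₀.two_le]
  have key : Tendsto (fun i => ∫ t in (0 : ℝ)..1,
      rayGauge (contourLimit (semiflat R (Z i) θ) G (d i)) (Z i) γ t) l
      (𝓝 (∫ t in (0 : ℝ)..1, rayGauge (contourLimit (semiflat R Z₀ θ) G d₀) Z₀ γ t)) := by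
    refine intervalIntegral.tendsto_integral_filter_of_dominated_convergence
      (fun t => 24 * (t⁻¹ * damping c t)) ?_ ?_ (intervalIntegrable_bound hc) ?_
    · filter_upwards [T.admissible, hS] with i H S
      exact aestronglyMeasurable_rayGauge H.two_le (H.damped_limit hγ (S.good γ hγ))
        (H.damped_limit hγ' (S.good _ hγ'))
    · filter_upwards [T.admissible, hS] with i H S
      refine Eventually.of_forall fun t ht => ?_
      rw [Set.uIoc_of_le zero_le_one] at ht
      exact norm_rayGauge_le H.two_le (H.damped_limit hγ (S.good γ hγ))
        (H.damped_limit hγ' (S.good _ hγ')) ht.1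
    · refine Eventually.of_forall fun t ht => ?_
      rw [Set.uIoc_of_le zero_le_one] at ht
      have hlim : ∀ γ ∈ G, Tendsto (fun i => (Complex.log (1 -
          contourLimit (semiflat R (Z i) θ) G (d i) γ (t * rayDir (Z i) γ))).re) l
          (𝓝 (Complex.log (1 - contourLimit (semiflat R Z₀ θ) G d₀ γ (t * rayDir Z₀ γ))).re) := by
        intro γ hγ
        have h1 := T.tendsto_limit hγ ((tendsto_rayDir (hZ γ) (h0 γ hγ)).const_mul (t : ℂ))
          (smul_mem_contourDomain (hgood γ hγ).1 ht.1)
        have h2 := (h1.const_sub 1).clog (one_sub_mem_slitPlane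
          ((H₀.damped_limit hγ (hgood γ hγ)).le_half H₀.two_le ht.1))
        exact (Complex.continuous_re.tendsto _).comp h2
      exact ((hlim γ hγ).sub (hlim (-γ) hγ')).const_mul _
  refine key.congr' ?_
  filter_upwards [T.admissible, hS] with i H S
  exact (S.integral_gaugeIntegrand H hΩ hγ hγ').symm

end

/-! ### Central charges near a wall of type I. -/

theorem ΩIn_eq (γ : Charge) : ΩIn γ = if γ ∈ chargesIn then 1 else 0 := by
  simp [ΩIn, chargesIn, γe, γm]

theorem ΩOut_eq (γ : Charge) : ΩOut .typeI γ = if γ ∈ chargesOut then 1 else 0 := by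
  simp [ΩOut, chargesOut, γe, γm, WallType.bound, WallType.partner]

theorem neg_mem_chargesIn : ∀ γ ∈ chargesIn, -γ ∈ chargesIn := by decide

theorem neg_mem_chargesOut : ∀ γ ∈ chargesOut, -γ ∈ chargesOut := by decide

theorem chargesOut_cases {p : Charge → Prop} (he : p (1, 0)) (hm : p (0, 1)) (hb : p (1, 1))
    (hneg : ∀ γ, p γ → p (-γ)) : ∀ γ ∈ chargesOut, p γ := by
  intro γ hγ
  simp only [chargesOut, Finset.mem_insert, Finset.mem_singleton] at hγ
  rcases hγ with rfl | rfl | rfl | rfl | rfl | rfl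
  · exact he
  · exact hneg _ he
  · exact hm
  · exact hneg _ hm
  · exact hb
  · exact hneg _ hb

/-- The reference direction: that of the ray of the bound state. -/
noncomputable def refDir (Z : Charge →+ ℂ) : ℂ := rayDir Z (1, 1)

/-- The angle of `ℓ_γ` relative to the ray of the bound state. -/
noncomputable def relAngle (Z : Charge →+ ℂ) (γ : Charge) : ℝ := (Z γ / Z (1, 1)).arg

theorem rayDir_eq_dir {Z : Charge →+ ℂ} {γ γ' : Charge} (h : Z γ ≠ 0) (h' : Z γ' ≠ 0) :
    rayDir Z γ = dir (rayDir Z γ') (Z γ / Z γ').arg := by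
  have hn : (‖Z γ‖ : ℂ) ≠ 0 := by exact_mod_cast norm_ne_zero_iff.2 h
  have hn' : (‖Z γ'‖ : ℂ) ≠ 0 := by exact_mod_cast norm_ne_zero_iff.2 h'
  have e := Complex.norm_mul_exp_arg_mul_I (Z γ / Z γ')
  rw [norm_div] at e
  push_cast at e
  have e2 : Complex.exp ((Z γ / Z γ').arg * Complex.I) = Z γ / Z γ' * (‖Z γ'‖ / ‖Z γ‖) := by
    generalize Complex.exp ((Z γ / Z γ').arg * Complex.I) = E at e ⊢
    rw [← e]; field_simp
  rw [dir, e2, rayDir, rayDir]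
  field_simp

theorem bound_eq_add (Z : Charge →+ ℂ) : Z (1, 1) = Z (1, 0) + Z (0, 1) := by
  rw [← map_add]; rfl

/-- The central charge is on a wall of type I, and its values on `γ_e`, `γ_m` have modulus at
least `δ`. -/
structure OnWall (Z : Charge →+ ℂ) (δ : ℝ) : Prop where
  pos : 0 < δ
  parallel : ∃ r : ℝ, 0 < r ∧ Z (1, 0) = r * Z (0, 1)
  le_e : δ ≤ ‖Z (1, 0)‖
  le_m : δ ≤ ‖Z (0, 1)‖

theorem OnWall.le_norm {Z : Charge →+ ℂ} {δ : ℝ} (W : OnWall Z δ) :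
    ∀ γ ∈ chargesOut, δ ≤ ‖Z γ‖ := by
  refine chargesOut_cases W.le_e W.le_m ?_ fun γ h => by rwa [map_neg, norm_neg]
  obtain ⟨r, hr, h⟩ := W.parallel
  have : Z (1, 1) = ((r + 1 : ℝ) : ℂ) * Z (0, 1) := by
    rw [bound_eq_add, h]; push_cast; ring
  rw [this, norm_mul, Complex.norm_of_nonneg (by linarith)]
  nlinarith [W.le_m, norm_nonneg (Z (0, 1))]

theorem OnWall.ne_zero {Z : Charge →+ ℂ} {δ : ℝ} (W : OnWall Z δ) :
    ∀ γ ∈ chargesOut, Z γ ≠ 0 := fun γ hγ =>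
  norm_pos_iff.1 (W.pos.trans_le (W.le_norm γ hγ))

theorem OnWall.ratio {Z : Charge →+ ℂ} {δ : ℝ} (W : OnWall Z δ) {γ : Charge}
    (hγ : γ = (1, 0) ∨ γ = (0, 1)) : ∃ q : ℝ, 0 < q ∧ Z γ / Z (1, 1) = q := by
  obtain ⟨r, hr, h⟩ := W.parallel
  have hm : Z (0, 1) ≠ 0 := W.ne_zero _ (by decide)
  have hr1 : ((r : ℂ) + 1) ≠ 0 := by
    have : (r + 1 : ℝ) ≠ 0 := by linarith
    exact_mod_cast this
  have hb : Z (1, 1) = ((r : ℂ) + 1) * Z (0, 1) := by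
    rw [bound_eq_add, h]; ring
  rcases hγ with rfl | rfl
  · refine ⟨r / (r + 1), by positivity, ?_⟩
    rw [hb, h]; push_cast; field_simp
  · refine ⟨1 / (r + 1), by positivity, ?_⟩
    rw [hb]; push_cast; field_simp

theorem OnWall.relAngle_eq_zero {Z : Charge →+ ℂ} {δ : ℝ} (W : OnWall Z δ) {γ : Charge}
    (hγ : γ = (1, 0) ∨ γ = (0, 1)) : relAngle Z γ = 0 := by
  obtain ⟨q, hq, h⟩ := W.ratio hγ
  rw [relAngle, h]
  exact Complex.arg_ofReal_of_nonneg hq.le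

section

variable {R δ : ℝ} {Z : ℂ → Charge →+ ℂ} {u₀ : ℂ}

/-- On the wall the ratios of `Z_e` and `Z_m` to the bound-state charge are positive reals, where
the argument is continuous and zero; the relative angles are therefore small nearby. -/
theorem OnWall.eventually_nearWall (W : OnWall (Z u₀) δ)
    (hZ : ∀ γ, ContinuousAt (fun u => Z u γ) u₀) (hR : 0 < R) (h2 : 2 ≤ R * δ / 2)
    (hs : 100 ≤ (1 - apartCos) * (R * δ / 2) ^ 2) :
    ∀ᶠ u in 𝓝 u₀, NearWall R (Z u) (refDir (Z u)) (relAngle (Z u) (1, 0)) (relAngle (Z u) (0, 1))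
      (R * δ / 2) := by
  have hδ := W.pos
  -- Losing a third of `δ` is harmless: with `π > 3`, `π R ‖Z γ‖` exceeds `2 R δ`, more than the
  -- needed `2 c = R δ`.
  have hnorm : ∀ᶠ u in 𝓝 u₀, ∀ γ ∈ chargesOut, δ * (2 / 3) < ‖Z u γ‖ :=
    (Finset.eventually_all chargesOut).2 fun γ hγ =>
      (hZ γ).norm.eventually_const_lt (lt_of_lt_of_le (by linarith) (W.le_norm γ hγ))
  have hang : ∀ γ : Charge, γ = (1, 0) ∨ γ = (0, 1) → ∀ᶠ u in 𝓝 u₀, |relAngle (Z u) γ| < 1 / 8 := by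
    intro γ hγ
    obtain ⟨q, hq, h⟩ := W.ratio hγ
    have h1 : ContinuousAt (fun u => relAngle (Z u) γ) u₀ := by
      refine ContinuousAt.comp (f := fun u => Z u γ / Z u (1, 1)) (x := u₀)
        (Complex.continuousAt_arg ?_) ((hZ γ).div (hZ _) (W.ne_zero _ (by decide)))
      rw [h]; left; simpa using hq
    refine h1.abs.eventually_lt_const ?_
    change |relAngle (Z u₀) γ| < 1 / 8
    rw [W.relAngle_eq_zero hγ]; norm_num
  filter_upwards [hnorm, hang _ (Or.inl rfl), hang _ (Or.inr rfl)] with u hu he hm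
  have hne : ∀ γ ∈ chargesOut, Z u γ ≠ 0 := fun γ hγ =>
    norm_pos_iff.1 (lt_trans (by positivity) (hu γ hγ))
  have hb : Z u (1, 1) ≠ 0 := hne _ (by decide)
  refine ⟨h2, hs, norm_rayDir hb, he.le, hm.le, hne, fun γ hγ => ?_, ?_⟩
  · have h1 := hu γ hγ
    have h3 := Real.pi_gt_three
    have h4 : R * (δ * (2 / 3)) ≤ R * ‖Z u γ‖ := by gcongr
    have h5 : 3 * (R * ‖Z u γ‖) ≤ Real.pi * (R * ‖Z u γ‖) := by gcongr
    nlinarith [mul_pos hR hδ]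
  · have e1 : rayDir (Z u) (1, 0) = dir (refDir (Z u)) (relAngle (Z u) (1, 0)) :=
      rayDir_eq_dir (hne _ (by decide)) hb
    have e2 : rayDir (Z u) (0, 1) = dir (refDir (Z u)) (relAngle (Z u) (0, 1)) :=
      rayDir_eq_dir (hne _ (by decide)) hb
    have e3 : rayDir (Z u) (1, 1) = dir (refDir (Z u)) 0 := by rw [dir_zero, refDir]
    have hneg : ∀ D φ, dir (-D) φ = -dir D φ := fun D φ => by simp [dir]
    have n1 : ((-1, 0) : Charge) = -(1, 0) := by decide
    have n2 : ((0, -1) : Charge) = -(0, 1) := by decide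
    have n3 : ((-1, -1) : Charge) = -(1, 1) := by decide
    intro γ hγ
    simp only [chargesOut, Finset.mem_insert, Finset.mem_singleton] at hγ
    rcases hγ with rfl | rfl | rfl | rfl | rfl | rfl
    · rw [e1]; simp [chargeSign, rayAngle]
    · rw [n1, rayDir_neg, e1]; simp [chargeSign, rayAngle, hneg]
    · rw [e2]; simp [chargeSign, rayAngle]
    · rw [n2, rayDir_neg, e2]; simp [chargeSign, rayAngle, hneg]
    · rw [e3]; simp [chargeSign, rayAngle]
    · rw [n3, rayDir_neg, e3]; simp [chargeSign, rayAngle, hneg]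

theorem relAngle_pos {Z : Charge →+ ℂ} {γ : Charge} (h : Z (1, 1) ≠ 0)
    (him : 0 < (Z γ * (starRingEnd ℂ) (Z (1, 1))).im) : 0 < relAngle Z γ := by
  have h1 : 0 < (Z γ / Z (1, 1)).im := by
    rw [div_eq_mul_inv, Complex.inv_def, ← mul_assoc, mul_comm, Complex.im_ofReal_mul]
    exact mul_pos (inv_pos.2 (Complex.normSq_pos.2 h)) him
  refine lt_of_le_of_ne (Complex.arg_nonneg_iff.2 h1.le) fun h0 => ?_
  rw [relAngle, eq_comm, Complex.arg_eq_zero_iff] at h0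
  linarith [h0.2]

theorem relAngle_neg {Z : Charge →+ ℂ} {γ : Charge} (h : Z (1, 1) ≠ 0)
    (him : (Z γ * (starRingEnd ℂ) (Z (1, 1))).im < 0) : relAngle Z γ < 0 := by
  refine Complex.arg_neg_iff.2 ?_
  rw [div_eq_mul_inv, Complex.inv_def, ← mul_assoc, mul_comm, Complex.im_ofReal_mul]
  exact mul_neg_of_pos_of_neg (inv_pos.2 (Complex.normSq_pos.2 h)) him

/-- Since the bound-state central charge is the sum of the other two, `ℓ_e` and `ℓ_m` lie on
opposite sides of its ray, and the sign that separates the two regions decides which is where. -/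
theorem im_mul_conj_bound (Z : Charge →+ ℂ) :
    (Z (1, 0) * (starRingEnd ℂ) (Z (1, 1))).im = (Z (1, 0) * (starRingEnd ℂ) (Z (0, 1))).im ∧
    (Z (0, 1) * (starRingEnd ℂ) (Z (1, 1))).im = -(Z (1, 0) * (starRingEnd ℂ) (Z (0, 1))).im := by
  rw [bound_eq_add]
  constructor <;> simp <;> ring

theorem NearWall.rotates_in_of_pos {Z : Charge →+ ℂ} {c : ℝ}
    (N : NearWall R Z (refDir Z) (relAngle Z (1, 0)) (relAngle Z (0, 1)) c) (θ : TwistedCharacter)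
    (h : 0 < (Z (1, 0) * (starRingEnd ℂ) (Z (0, 1))).im) :
    Rotates R Z θ chargesIn (contourIn (refDir Z)) apartCos c :=
  N.rotates_in θ (relAngle_pos (N.ne_zero _ (by decide)) (by rwa [(im_mul_conj_bound Z).1]))
    (relAngle_neg (N.ne_zero _ (by decide)) (by rw [(im_mul_conj_bound Z).2]; linarith))

theorem NearWall.rotates_out_of_neg {Z : Charge →+ ℂ} {c : ℝ}
    (N : NearWall R Z (refDir Z) (relAngle Z (1, 0)) (relAngle Z (0, 1)) c) (θ : TwistedCharacter)
    (h : (Z (1, 0) * (starRingEnd ℂ) (Z (0, 1))).im < 0) :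
    Rotates R Z θ chargesOut (contourOut (refDir Z)) apartCos c :=
  N.rotates_out θ (relAngle_neg (N.ne_zero _ (by decide)) (by rwa [(im_mul_conj_bound Z).1]))
    (relAngle_pos (N.ne_zero _ (by decide)) (by rw [(im_mul_conj_bound Z).2]; linarith))

theorem tendsto_dir_sign (W : OnWall (Z u₀) δ) (hZ : ∀ γ, ContinuousAt (fun u => Z u γ) u₀)
    (s : ℂ) (φ : ℝ) :
    Tendsto (fun u => dir (s * refDir (Z u)) φ) (𝓝 u₀) (𝓝 (dir (s * refDir (Z u₀)) φ)) := by
  unfold dir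
  exact ((tendsto_rayDir (hZ _) (W.ne_zero _ (by decide))).const_mul s).mul_const _

/-- The integral of the gauge function on the inner side, and its limit. -/
theorem OnWall.tendsto_in (W : OnWall (Z u₀) δ) (hZ : ∀ γ, ContinuousAt (fun u => Z u γ) u₀)
    (hR : 0 < R) (h2 : 2 ≤ R * δ / 2) (hs : 100 ≤ (1 - apartCos) * (R * δ / 2) ^ 2)
    (θ : TwistedCharacter) {γ : Charge} (hγ : γ ∈ chargesIn) :
    Tendsto (fun u => ∫ t in (0 : ℝ)..1, gaugeIntegrand (Z u) (darboux R (Z u) ΩIn θ) γ t)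
      (𝓝[{u | 0 < (Z u (1, 0) * (starRingEnd ℂ) (Z u (0, 1))).im}] u₀)
      (𝓝 (∫ t in (0 : ℝ)..1, rayGauge (solutionIn R (Z u₀) θ (refDir (Z u₀))) (Z u₀) γ t)) := by
  have hN := W.eventually_nearWall hZ hR h2 hs
  have N₀ := hN.self_of_nhds
  -- At `u₀` both relative angles are 0. The strict inequalities behind `Rotates` fail there, while
  -- admissibility and good directions include this boundary case.
  rw [W.relAngle_eq_zero (Or.inl rfl), W.relAngle_eq_zero (Or.inr rfl)] at N₀
  have hle := nhdsWithin_le_nhds (a := u₀)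
    (s := {u | 0 < (Z u (1, 0) * (starRingEnd ℂ) (Z u (0, 1))).im})
  refine ConvergesTo.tendsto_integral_gauge (d := fun u => contourIn (refDir (Z u)))
    (k := apartCos) (c := R * δ / 2) ⟨?_, N₀.admissible_in θ, ?_, ?_⟩ ΩIn_eq ?_
    (fun γ => (hZ γ).tendsto.mono_left hle) (fun γ h => W.ne_zero γ (chargesIn_subset h))
    (fun γ h => ?_) hγ (neg_mem_chargesIn γ hγ)
  · filter_upwards [hle hN] with u N using N.admissible_in θ
  · exact fun γ _ γ' _ _ => (tendsto_dir_sign W hZ _ _).mono_left hle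
  · exact fun γ _ ζ ζ₀ hζ h0 => tendsto_semiflat ((hZ γ).tendsto.mono_left hle) hζ h0
  · filter_upwards [hle hN, self_mem_nhdsWithin] with u N hu using N.rotates_in_of_pos θ hu
  · rw [N₀.ray γ (chargesIn_subset h)]
    exact N₀.goodDirs_in θ h (rayAngle_mem_sectorIn le_rfl (by norm_num) le_rfl (by norm_num) γ)

/-- The integral of a term of the gauge function on the outer side, and its limit. -/
theorem OnWall.tendsto_out (W : OnWall (Z u₀) δ) (hZ : ∀ γ, ContinuousAt (fun u => Z u γ) u₀)
    (hR : 0 < R) (h2 : 2 ≤ R * δ / 2) (hs : 100 ≤ (1 - apartCos) * (R * δ / 2) ^ 2)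
    (θ : TwistedCharacter) {γ : Charge} (hγ : γ ∈ chargesOut) :
    Tendsto (fun u => ∫ t in (0 : ℝ)..1,
        gaugeIntegrand (Z u) (darboux R (Z u) (ΩOut .typeI) θ) γ t)
      (𝓝[{u | (Z u (1, 0) * (starRingEnd ℂ) (Z u (0, 1))).im < 0}] u₀)
      (𝓝 (∫ t in (0 : ℝ)..1, rayGauge (solutionOut R (Z u₀) θ (refDir (Z u₀))) (Z u₀) γ t)) := by
  have hN := W.eventually_nearWall hZ hR h2 hs
  have N₀ := hN.self_of_nhds
  rw [W.relAngle_eq_zero (Or.inl rfl), W.relAngle_eq_zero (Or.inr rfl)] at N₀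
  have hle := nhdsWithin_le_nhds (a := u₀)
    (s := {u | (Z u (1, 0) * (starRingEnd ℂ) (Z u (0, 1))).im < 0})
  refine ConvergesTo.tendsto_integral_gauge (d := fun u => contourOut (refDir (Z u)))
    (k := apartCos) (c := R * δ / 2) ⟨?_, N₀.admissible_out θ, ?_, ?_⟩ ΩOut_eq ?_
    (fun γ => (hZ γ).tendsto.mono_left hle) W.ne_zero
    (fun γ h => ?_) hγ (neg_mem_chargesOut γ hγ)
  · filter_upwards [hle hN] with u N using N.admissible_out θ
  · exact fun γ _ γ' _ _ => (tendsto_dir_sign W hZ _ _).mono_left hle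
  · exact fun γ _ ζ ζ₀ hζ h0 => tendsto_semiflat ((hZ γ).tendsto.mono_left hle) hζ h0
  · filter_upwards [hle hN, self_mem_nhdsWithin] with u N hu using N.rotates_out_of_neg θ hu
  · rw [N₀.ray γ h]
    exact N₀.goodDirs_out θ h (rayAngle_mem_sectorOut le_rfl (by norm_num) le_rfl (by norm_num) γ)

/-- With both angles 0 every ray is `D` or `-D`, so the pentagon product applies pointwise in `t`,
once for each sign of the charge, and the logarithms add. -/
theorem NearWall.rayGauge_eq {Z : Charge →+ ℂ} {D : ℂ} {c : ℝ} (N : NearWall R Z D 0 0 c)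
    (θ : TwistedCharacter) {γ : Charge} (hγ : γ = (1, 0) ∨ γ = (0, 1)) :
    ∫ t in (0 : ℝ)..1, rayGauge (solutionIn R Z θ D) Z γ t =
      (∫ t in (0 : ℝ)..1, rayGauge (solutionOut R Z θ D) Z γ t) +
        ∫ t in (0 : ℝ)..1, rayGauge (solutionOut R Z θ D) Z (1, 1) t := by
  have Ho := N.admissible_out θ
  have hray : ∀ γ ∈ chargesOut, rayDir Z γ = chargeSign γ * D := fun γ h => by
    rw [N.ray γ h, rayAngle, ite_self, ite_self, dir_zero]
  have hgo : ∀ γ ∈ chargesOut,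
      rayDir Z γ ∈ goodDirs (semiflat R Z θ) chargesOut (contourOut D) apartCos c γ :=
    fun γ h => by
      rw [N.ray γ h]
      exact N.goodDirs_out θ h (rayAngle_mem_sectorOut le_rfl (by norm_num) le_rfl (by norm_num) γ)
  have hdo : ∀ γ ∈ chargesOut, Damped 8 c (rayDir Z γ) (solutionOut R Z θ D γ) :=
    fun γ h => Ho.damped_limit h (hgo γ h)
  have hi : ∀ γ ∈ chargesOut, IntervalIntegrable (rayGauge (solutionOut R Z θ D) Z γ) volume 0 1 :=
    fun γ h => intervalIntegrable_rayGauge N.two_le (hdo γ h) (hdo _ (neg_mem_chargesOut γ h))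
  have hγo : γ ∈ chargesOut := by rcases hγ with rfl | rfl <;> decide
  rw [← intervalIntegral.integral_add (hi γ hγo) (hi _ (by decide))]
  refine intervalIntegral.integral_congr_ae (Eventually.of_forall fun t ht => ?_)
  rw [Set.uIoc_of_le zero_le_one] at ht
  have hpent : ∀ s : ℤ, s = 1 ∨ s = -1 → ∀ γ ∈ chargesOut, γ = (s, 0) ∨ γ = (0, s) →
      (Complex.log (1 - solutionIn R Z θ D γ (t * rayDir Z γ))).re =
      (Complex.log (1 - solutionOut R Z θ D γ (t * rayDir Z γ))).re +
        (Complex.log (1 - solutionOut R Z θ D (s, s) (t * rayDir Z (s, s)))).re := by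
    intro s hs γ hγ hγs
    obtain ⟨h1, h2, h3⟩ := chargeSign_of_sign hs
    have hb := (mem_charges hs).2.2
    have b1 := one_sub_re_pos ((hdo γ hγ).le_half N.two_le ht.1)
    have b2 := one_sub_re_pos ((hdo _ hb).le_half N.two_le ht.1)
    rw [← Complex.add_re, log_add_log b1 b2, hray γ hγ, hray _ hb, h3]
    rcases hγs with rfl | rfl
    · rw [h1, N.pentagon_e θ hs ht.1]
    · rw [h2, N.pentagon_m θ hs ht.1]
  have p1 := hpent 1 (Or.inl rfl) γ hγo hγ
  have p2 := hpent (-1) (Or.inr rfl) (-γ) (neg_mem_chargesOut γ hγo)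
    (by rcases hγ with rfl | rfl <;> decide)
  have n3 : (-(1, 1) : Charge) = (-1, -1) := by decide
  simp only [rayGauge, n3]
  rw [p1, p2]
  ring

end

/-! ### Wall-crossing for type I. -/

/-- The conclusions about the wall-crossing at `u₀` with outer invariants `Ω`, for the gauge
functions built from the charge `g` and the bound state `b`. -/
structure WallCrossing (R : ℝ) (Z : ℂ → Charge →+ ℂ) (u₀ : ℂ) (Ω : Charge → ℤ) (g b : Charge) :
    Prop where
  inner : ∀ᶠ u in 𝓝[{u | 0 < (Z u (1, 0) * (starRingEnd ℂ) (Z u (0, 1))).im}] u₀,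
    ∀ θ : TwistedCharacter, DarbouxExists R (Z u) ΩIn θ ∧
      IntervalIntegrable (gaugeIntegrand (Z u) (darboux R (Z u) ΩIn θ) g) volume 0 1
  outer : ∀ᶠ u in 𝓝[{u | (Z u (1, 0) * (starRingEnd ℂ) (Z u (0, 1))).im < 0}] u₀,
    ∀ θ : TwistedCharacter, DarbouxExists R (Z u) Ω θ ∧
      IntervalIntegrable (gaugeIntegrand (Z u) (darboux R (Z u) Ω θ) g) volume 0 1 ∧
      IntervalIntegrable (gaugeIntegrand (Z u) (darboux R (Z u) Ω θ) b) volume 0 1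
  limit : ∀ θ : TwistedCharacter, ∃ l : ℝ,
    Tendsto (fun u => ∫ t in (0 : ℝ)..1, gaugeIntegrand (Z u) (darboux R (Z u) ΩIn θ) g t)
      (𝓝[{u | 0 < (Z u (1, 0) * (starRingEnd ℂ) (Z u (0, 1))).im}] u₀) (𝓝 l) ∧
    Tendsto (fun u => ∫ t in (0 : ℝ)..1, (gaugeIntegrand (Z u) (darboux R (Z u) Ω θ) g t +
        gaugeIntegrand (Z u) (darboux R (Z u) Ω θ) b t))
      (𝓝[{u | (Z u (1, 0) * (starRingEnd ℂ) (Z u (0, 1))).im < 0}] u₀) (𝓝 l)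

section

variable {R δ : ℝ} {Z : ℂ → Charge →+ ℂ} {u₀ : ℂ}

theorem OnWall.wallCrossing (W : OnWall (Z u₀) δ) (hZ : ∀ γ, ContinuousAt (fun u => Z u γ) u₀)
    (hR : 0 < R) (h2 : 2 ≤ R * δ / 2) (hs : 100 ≤ (1 - apartCos) * (R * δ / 2) ^ 2)
    {g : Charge} (hg : g = (1, 0) ∨ g = (0, 1)) :
    WallCrossing R Z u₀ (ΩOut .typeI) g (1, 1) := by
  have hN := W.eventually_nearWall hZ hR h2 hs
  have hgi : g ∈ chargesIn := by rcases hg with rfl | rfl <;> decide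
  have hgo : g ∈ chargesOut := chargesIn_subset hgi
  have hb : ((1, 1) : Charge) ∈ chargesOut := by decide
  have outer : ∀ᶠ u in 𝓝[{u | (Z u (1, 0) * (starRingEnd ℂ) (Z u (0, 1))).im < 0}] u₀,
      ∀ θ : TwistedCharacter, DarbouxExists R (Z u) (ΩOut .typeI) θ ∧
        IntervalIntegrable (gaugeIntegrand (Z u) (darboux R (Z u) (ΩOut .typeI) θ) g) volume 0 1 ∧
        IntervalIntegrable (gaugeIntegrand (Z u) (darboux R (Z u) (ΩOut .typeI) θ) (1, 1))
          volume 0 1 := by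
    filter_upwards [nhdsWithin_le_nhds hN, self_mem_nhdsWithin] with u N hu θ
    have S := N.rotates_out_of_neg θ hu
    have H := N.admissible_out θ
    exact ⟨S.darbouxExists H ΩOut_eq,
      S.intervalIntegrable_gaugeIntegrand H ΩOut_eq hgo (neg_mem_chargesOut _ hgo),
      S.intervalIntegrable_gaugeIntegrand H ΩOut_eq hb (neg_mem_chargesOut _ hb)⟩
  refine ⟨?_, outer, fun θ => ⟨_, W.tendsto_in hZ hR h2 hs θ hgi, ?_⟩⟩
  · filter_upwards [nhdsWithin_le_nhds hN, self_mem_nhdsWithin] with u N hu θ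
    have S := N.rotates_in_of_pos θ hu
    have H := N.admissible_in θ
    exact ⟨S.darbouxExists H ΩIn_eq,
      S.intervalIntegrable_gaugeIntegrand H ΩIn_eq hgi (neg_mem_chargesIn _ hgi)⟩
  · have N₀ := hN.self_of_nhds
    rw [W.relAngle_eq_zero (Or.inl rfl), W.relAngle_eq_zero (Or.inr rfl)] at N₀
    rw [N₀.rayGauge_eq θ hg]
    refine ((W.tendsto_out hZ hR h2 hs θ hgo).add (W.tendsto_out hZ hR h2 hs θ hb)).congr' ?_
    filter_upwards [outer] with u hu
    exact (intervalIntegral.integral_add (hu θ).2.1 (hu θ).2.2).symm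

end

/-! ### Reduction of type II to type I, and conclusion. -/

/-- The rotation `γ_e ↦ -γ_m`, `γ_m ↦ γ_e` of the charge lattice, which preserves the pairing and
exchanges the two types of wall. -/
def rotation : Charge ≃+ Charge where
  toFun γ := (γ.2, -γ.1)
  invFun γ := (-γ.2, γ.1)
  left_inv γ := by simp
  right_inv γ := by simp
  map_add' γ γ' := by ext <;> simp; ring

theorem pairing_rotation (γ γ' : Charge) : pairing (rotation γ) (rotation γ') = pairing γ γ' := by
  simp only [pairing, rotation, AddEquiv.coe_mk, Equiv.coe_fn_mk]; ring

/-- The twisted character `γ ↦ θ (rotation γ)`. -/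
def TwistedCharacter.rotate (θ : TwistedCharacter) : TwistedCharacter where
  toFun γ := θ.toFun (rotation γ)
  twist γ γ' := by rw [θ.twist, pairing_rotation, map_add]

/-- The central charge `γ ↦ Z (rotation γ)`. -/
def rotateCharge (Z : Charge →+ ℂ) : Charge →+ ℂ := Z.comp rotation.toAddMonoidHom

section

variable {R : ℝ} {Z : Charge →+ ℂ} {Ω : Charge → ℤ} {θ : TwistedCharacter}

/-- The integral equation involves the charges only through their pairing and the values of `Z`,
`Ω`, `θ`, so relabelling by an automorphism that preserves the pairing is a reindexing of the sum.
-/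
theorem iterStep_rotate (X : Charge → ℂ → ℂ) (γ : Charge) (ζ : ℂ) :
    iterStep R (rotateCharge Z) (fun γ => Ω (rotation γ)) θ.rotate (fun γ => X (rotation γ)) γ ζ =
      iterStep R Z Ω θ X (rotation γ) ζ := by
  have h := finsum_comp_equiv rotation.toEquiv (f := fun γ' : Charge =>
    (Ω γ' : ℂ) * (pairing (rotation γ) γ' : ℂ) * rayIntegral Z γ' (kernelLog X γ' ζ))
  unfold iterStep
  rw [← h]
  simp only [AddEquiv.toEquiv_eq_coe, EquivLike.coe_coe, pairing_rotation]
  rfl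

theorem iterate_rotate (ν : ℕ) :
    iterate R (rotateCharge Z) (fun γ => Ω (rotation γ)) θ.rotate ν =
      fun γ => iterate R Z Ω θ ν (rotation γ) := by
  induction ν with
  | zero => rfl
  | succ ν ih => funext γ ζ; rw [iterate, ih, iterStep_rotate]; rfl

theorem darboux_rotate :
    darboux R (rotateCharge Z) (fun γ => Ω (rotation γ)) θ.rotate =
      fun γ => darboux R Z Ω θ (rotation γ) := by
  funext γ ζ
  simp only [darboux, iterate_rotate]

theorem OffJumps.rotate {γ : Charge} {ζ : ℂ} (h : OffJumps Z Ω (rotation γ) ζ) :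
    OffJumps (rotateCharge Z) (fun γ => Ω (rotation γ)) γ ζ :=
  ⟨h.1, fun γ' h1 h2 => h.2 (rotation γ') h1 (by rwa [pairing_rotation])⟩

theorem darbouxExists_of_rotate
    (h : DarbouxExists R (rotateCharge Z) (fun γ => Ω (rotation γ)) θ.rotate) :
    DarbouxExists R Z Ω θ := by
  obtain ⟨h1, h2⟩ := h
  rw [darboux_rotate] at h1 h2
  simp only [iterate_rotate] at h1
  refine ⟨?_, ?_, ?_, ?_⟩ <;> refine rotation.surjective.forall.2 fun γ => ?_
  · exact fun ζ h => h1 γ ζ h.rotate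
  · exact h2.integrable γ
  · exact h2.norm_lt_one γ
  · exact fun ζ h => (h2.equation γ ζ h.rotate).trans (iterStep_rotate _ _ _)

theorem gaugeIntegrand_rotate (X : Charge → ℂ → ℂ) (γ : Charge) :
    gaugeIntegrand (rotateCharge Z) (fun γ => X (rotation γ)) γ =
      gaugeIntegrand Z X (rotation γ) := by
  funext t
  simp only [gaugeIntegrand, map_neg]
  rfl

end

theorem ΩIn_rotation : (fun γ => ΩIn (rotation γ)) = ΩIn := by
  funext ⟨p, q⟩
  simp only [ΩIn, γe, γm, rotation, AddEquiv.coe_mk, Equiv.coe_fn_mk, Prod.mk.injEq, Prod.neg_mk]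
  congr 1
  apply propext
  omega

theorem ΩOut_rotation : (fun γ => ΩOut .typeII (rotation γ)) = ΩOut .typeI := by
  funext ⟨p, q⟩
  simp only [ΩOut, γe, γm, rotation, AddEquiv.coe_mk, Equiv.coe_fn_mk, Prod.mk.injEq, Prod.neg_mk,
    WallType.bound, WallType.partner, Prod.mk_add_mk]
  congr 1
  apply propext
  omega

theorem WallCrossing.of_rotate {R : ℝ} {Z : ℂ → Charge →+ ℂ} {u₀ : ℂ} {g b : Charge}
    (h : WallCrossing R (fun u => rotateCharge (Z u)) u₀ (ΩOut .typeI) g b) :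
    WallCrossing R Z u₀ (ΩOut .typeII) (rotation g) (rotation b) := by
  have him : ∀ u, (rotateCharge (Z u) (1, 0) * (starRingEnd ℂ) (rotateCharge (Z u) (0, 1))).im =
      (Z u (1, 0) * (starRingEnd ℂ) (Z u (0, 1))).im := by
    intro u
    have e1 : rotateCharge (Z u) (1, 0) = -Z u (0, 1) := by rw [← map_neg]; rfl
    have e2 : rotateCharge (Z u) (0, 1) = Z u (1, 0) := rfl
    rw [e1, e2]; simp; ring
  have hin : ∀ u θ, darboux R (rotateCharge (Z u)) ΩIn (TwistedCharacter.rotate θ) =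
      fun γ => darboux R (Z u) ΩIn θ (rotation γ) := fun u θ => by
    rw [← darboux_rotate, ΩIn_rotation]
  have hout : ∀ u θ, darboux R (rotateCharge (Z u)) (ΩOut .typeI) (TwistedCharacter.rotate θ) =
      fun γ => darboux R (Z u) (ΩOut .typeII) θ (rotation γ) := fun u θ => by
    rw [← darboux_rotate, ΩOut_rotation]
  obtain ⟨h1, h2, h3⟩ := h
  simp only [him] at h1 h2 h3
  refine ⟨h1.mono fun u hu θ => ?_, h2.mono fun u hu θ => ?_, fun θ => ?_⟩
  · have := hu θ.rotate
    rw [hin, gaugeIntegrand_rotate] at this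
    exact ⟨darbouxExists_of_rotate (by rw [ΩIn_rotation]; exact this.1), this.2⟩
  · have := hu θ.rotate
    rw [hout, gaugeIntegrand_rotate, gaugeIntegrand_rotate] at this
    exact ⟨darbouxExists_of_rotate (by rw [ΩOut_rotation]; exact this.1), this.2⟩
  · obtain ⟨l, hl⟩ := h3 θ.rotate
    simp only [hin, hout, gaugeIntegrand_rotate] at hl
    exact ⟨l, hl⟩

/-- The gauge functions agree at the wall, for both types of wall-crossing. -/
theorem wallCrossing_of_mem_wall {δ R : ℝ} (hδ : 0 < δ)
    (hR : 2 / δ * (2 + 100 / (1 - apartCos)) ≤ R) (τ : WallType) {U : Set ℂ}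
    {Z : ℂ → Charge →+ ℂ} {u₀ : ℂ} (hZ : ∀ γ, ContinuousAt (fun u => Z u γ) u₀)
    (hu : u₀ ∈ wall U Z τ) (he : δ ≤ ‖Z u₀ γe‖) (hm : δ ≤ ‖Z u₀ γm‖) :
    WallCrossing R Z u₀ (ΩOut τ) γe τ.bound := by
  have hk : 0 < 1 - apartCos := by linarith [apartCos_lt_one]
  have hc : 2 + 100 / (1 - apartCos) ≤ R * δ / 2 := by
    rw [div_mul_eq_mul_div, div_le_iff₀ hδ] at hR
    linarith
  have hq : 0 < 100 / (1 - apartCos) := by positivity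
  have h2 : 2 ≤ R * δ / 2 := by linarith
  have hR0 : 0 < R := lt_of_lt_of_le (by positivity) hR
  have hs : 100 ≤ (1 - apartCos) * (R * δ / 2) ^ 2 := by
    -- With `c = R δ / 2` at least `2 + 100 / (1 - apartCos)`, in particular `c ≥ 1`, so `c² ≥ c`.
    have h4 : 100 / (1 - apartCos) ≤ (R * δ / 2) ^ 2 := by nlinarith
    rwa [div_le_iff₀' hk] at h4
  obtain ⟨-, -, -, r, hr, h⟩ := hu
  cases τ with
  | typeI => exact OnWall.wallCrossing ⟨hδ, ⟨r, hr, h⟩, he, hm⟩ hZ hR0 h2 hs (Or.inl rfl)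
  | typeII =>
    have e1 : rotateCharge (Z u₀) (1, 0) = Z u₀ (-γm) := rfl
    have e2 : rotateCharge (Z u₀) (0, 1) = Z u₀ γe := rfl
    have hr' : (r : ℂ) ≠ 0 := by exact_mod_cast hr.ne'
    -- The gauge charge is `(0, 1)` because the rotation sends it to `γ_e`; it sends `(1, 1)` to
    -- `γ_e - γ_m`. The ratio is inverted because the rotated electric charge is `-γ_m` and the
    -- rotated magnetic one is `γ_e`.
    refine WallCrossing.of_rotate (OnWall.wallCrossing (g := (0, 1))
      (Z := fun u => rotateCharge (Z u)) ⟨hδ, ⟨r⁻¹, inv_pos.2 hr, ?_⟩, ?_, ?_⟩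
      (fun γ => hZ (rotation γ)) hR0 h2 hs (Or.inr rfl))
    · rw [e1, e2, h, Complex.ofReal_inv, inv_mul_cancel_left₀ hr']; rfl
    · rwa [e1, map_neg, norm_neg]
    · rwa [e2]

end Pentagon

theorem mainTheorem7 :
    ∀ δ : ℝ, 0 < δ → ∃ R₀ : ℝ, 0 < R₀ ∧ ∀ R : ℝ, R₀ ≤ R →
      ∀ (τ : Pentagon.WallType) (U : Set ℂ), IsOpen U →
      ∀ Z : ℂ → Pentagon.Charge →+ ℂ,
        (∀ γ : Pentagon.Charge, DifferentiableOn ℂ (fun u => Z u γ) U) →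
      ∀ u₀ ∈ Pentagon.wall U Z τ,
        δ ≤ ‖Z u₀ Pentagon.γe‖ → δ ≤ ‖Z u₀ Pentagon.γm‖ →
        (∀ᶠ u in 𝓝[Pentagon.regionIn U Z] u₀, ∀ θ : Pentagon.TwistedCharacter,
          Pentagon.DarbouxExists R (Z u) Pentagon.ΩIn θ ∧
          IntervalIntegrable
            (Pentagon.gaugeIntegrand (Z u) (Pentagon.darboux R (Z u) Pentagon.ΩIn θ)
              Pentagon.γe) volume 0 1) ∧
        (∀ᶠ u in 𝓝[Pentagon.regionOut U Z] u₀, ∀ θ : Pentagon.TwistedCharacter,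
          Pentagon.DarbouxExists R (Z u) (Pentagon.ΩOut τ) θ ∧
          IntervalIntegrable
            (Pentagon.gaugeIntegrand (Z u) (Pentagon.darboux R (Z u) (Pentagon.ΩOut τ) θ)
              Pentagon.γe) volume 0 1 ∧
          IntervalIntegrable
            (Pentagon.gaugeIntegrand (Z u) (Pentagon.darboux R (Z u) (Pentagon.ΩOut τ) θ)
              τ.bound) volume 0 1) ∧
        ∀ θ : Pentagon.TwistedCharacter, ∃ l : ℝ,
          Tendsto (fun u => Pentagon.ψIn R (Z u) θ) (𝓝[Pentagon.regionIn U Z] u₀) (𝓝 l) ∧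
          Tendsto (fun u => Pentagon.ψOut τ R (Z u) θ) (𝓝[Pentagon.regionOut U Z] u₀) (𝓝 l) := by
  intro δ hδ
  have hk : 0 < 1 - Pentagon.apartCos := by linarith [Pentagon.apartCos_lt_one]
  -- The threshold depends on `δ` alone, because the angles of the rotated contours are absolute
  -- constants.
  refine ⟨2 / δ * (2 + 100 / (1 - Pentagon.apartCos)), by positivity, ?_⟩
  intro R hR τ U hU Z hZ u₀ hu he hm
  have W := Pentagon.wallCrossing_of_mem_wall hδ hR τ
    (fun γ => ((hZ γ).differentiableAt (hU.mem_nhds hu.1)).continuousAt) hu he hm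
  have hin : 𝓝[Pentagon.regionIn U Z] u₀ ≤ _ := nhdsWithin_mono u₀ fun _ h => h.2
  have hout : 𝓝[Pentagon.regionOut U Z] u₀ ≤ _ := nhdsWithin_mono u₀ fun _ h => h.2
  refine ⟨hin W.inner, hout W.outer, fun θ => ?_⟩
  obtain ⟨l, h1, h2⟩ := W.limit θ
  exact ⟨_, (h1.mono_left hin).const_mul _, (h2.mono_left hout).const_mul _⟩
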